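/- **The problem.** An instance of SSGW (subset sum with weak digraph constraint) consists of a set $A=\{a_1,\dots,a_n\}$ of $n\ge 1$ items, a digraph $G=(A,E)$ without loops, a size $s_j\in\mathbb{Z}_{>0}$ for every item $a_j$, and a capacity $c\in\mathbb{Z}_{>0}$. For $A'\subseteq A$ put $s(A')=\sum_{a_j\in A'}s_j$, and let $N^-(y)$ denote the set of predecessors of $y$. A set $A'\subseteq A$ is feasible if $s(A')\le c$ and $$\forall y\in A:\quad \bigl(N^-(y)\subseteq A'\ \text{and}\ N^-(y)\ne\emptyset\bigr)\Rightarrow y\in A'.$$ The task is to find a feasible set $A'$ that maximizes $s(A')$. **The digraphs.** For vertex-disjoint digraphs $G_1=(V_1,E_1)$ and $G_2=(V_2,E_2)$, the parallel composition is $(V_1\cup V_2,\,E_1\cup E_2)$ and the series composition is $(V_1\cup V_2,\,E_1\cup E_2\cup(O_1\times I_2))$, where $O_1$ is the set of vertices of outdegree $0$ in $G_1$ and $I_2$ is the set of vertices of indegree $0$ in $G_2$. The minimal series-parallel digraphs are the digraphs obtained from single vertices by these two operations. **The machine.** Time and space refer to a unit-cost word RAM with addition, truncated subtraction, multiplication and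 comparison of words. It has random access to a read-only input, which lists $n$, $m$, $c$, the sizes $s_1,\dots,s_n$, and the $m=|E|$ arcs of $G$ in an arbitrary order, each arc once. A word has $O(\log(n+c+s(A)))$ bits. Space is the number of words of work memory, including the memory that holds the output. **Theorem.** There is an algorithm that, for every instance of SSGW whose digraph $G$ is a minimal series-parallel digraph with $n$ vertices and $m$ arcs, finds an optimal solution in $O(n\cdot c^4+m)$ time and $O(n\cdot c^2)$ space. -/

import Mathlib

/-! ### Finite digraphs and minimal series-parallel digraphs -/

/-- A finite loopless digraph `(V, E)` whose vertices are taken from a type `α`. (Mathlib's `Digraph α`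
always has all of `α` as its vertex set, which does not fit compositions of vertex-disjoint digraphs.) -/
structure FinDigraph (α : Type) where
  /-- the vertex set `V` -/
  verts : Finset α
  /-- the arc set `E`; the pair `(u, v)` is the arc from `u` to `v` -/
  arcs : Finset (α × α)
  fst_mem : ∀ e ∈ arcs, e.1 ∈ verts
  snd_mem : ∀ e ∈ arcs, e.2 ∈ verts
  loopless : ∀ e ∈ arcs, e.1 ≠ e.2

namespace FinDigraph

variable {α : Type} [DecidableEq α]

/-- The set of all predecessors of `v`. -/
def preds (G : FinDigraph α) (v : α) : Finset α := G.verts.filter fun u => (u, v) ∈ G.arcs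

/-- The set of all successors of `v`. -/
def succs (G : FinDigraph α) (v : α) : Finset α := G.verts.filter fun w => (v, w) ∈ G.arcs

/-- The vertices of indegree `0`. -/
def sources (G : FinDigraph α) : Finset α := G.verts.filter fun v => (G.preds v).card = 0

/-- The vertices of outdegree `0`. -/
def sinks (G : FinDigraph α) : Finset α := G.verts.filter fun v => (G.succs v).card = 0

/-- The digraph `({v}, ∅)`. -/
def single (v : α) : FinDigraph α where
  verts := {v}
  arcs := ∅
  fst_mem := by simp
  snd_mem := by simp
  loopless := by simp

/-- The parallel composition of two vertex-disjoint digraphs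
(disjointness is demanded where the operation is used). -/
def parallel (G₁ G₂ : FinDigraph α) : FinDigraph α where
  verts := G₁.verts ∪ G₂.verts
  arcs := G₁.arcs ∪ G₂.arcs
  fst_mem := fun e he => by
    rcases Finset.mem_union.1 he with h | h
    · exact Finset.mem_union_left _ (G₁.fst_mem e h)
    · exact Finset.mem_union_right _ (G₂.fst_mem e h)
  snd_mem := fun e he => by
    rcases Finset.mem_union.1 he with h | h
    · exact Finset.mem_union_left _ (G₁.snd_mem e h)
    · exact Finset.mem_union_right _ (G₂.snd_mem e h)
  loopless := fun e he => by
    rcases Finset.mem_union.1 he with h | h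
    · exact G₁.loopless e h
    · exact G₂.loopless e h

/-- The series composition of two vertex-disjoint digraphs: an arc is added
from every sink of the first to every source of the second. -/
def series (G₁ G₂ : FinDigraph α) (hd : Disjoint G₁.verts G₂.verts) : FinDigraph α where
  verts := G₁.verts ∪ G₂.verts
  arcs := G₁.arcs ∪ G₂.arcs ∪ G₁.sinks ×ˢ G₂.sources
  fst_mem := fun e he => by
    simp only [Finset.mem_union, Finset.mem_product, sinks, sources, Finset.mem_filter] at he ⊢
    rcases he with (h | h) | h
    · exact Or.inl (G₁.fst_mem e h)
    · exact Or.inr (G₂.fst_mem e h)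
    · exact Or.inl h.1.1
  snd_mem := fun e he => by
    simp only [Finset.mem_union, Finset.mem_product, sinks, sources, Finset.mem_filter] at he ⊢
    rcases he with (h | h) | h
    · exact Or.inl (G₁.snd_mem e h)
    · exact Or.inr (G₂.snd_mem e h)
    · exact Or.inr h.2.1
  loopless := fun e he => by
    simp only [Finset.mem_union, Finset.mem_product, sinks, sources, Finset.mem_filter] at he
    rcases he with (h | h) | h
    · exact G₁.loopless e h
    · exact G₂.loopless e h
    · exact Finset.disjoint_left.1 hd h.1.1 |> fun hn heq => hn (heq ▸ h.2.1)

/-- Minimal series-parallel digraphs. -/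
inductive IsMSP : FinDigraph α → Prop
  | single (v : α) : IsMSP (single v)
  | parallel {G₁ G₂ : FinDigraph α} (h₁ : IsMSP G₁) (h₂ : IsMSP G₂)
      (hd : Disjoint G₁.verts G₂.verts) : IsMSP (parallel G₁ G₂)
  | series {G₁ G₂ : FinDigraph α} (h₁ : IsMSP G₁) (h₂ : IsMSP G₂)
      (hd : Disjoint G₁.verts G₂.verts) : IsMSP (series G₁ G₂ hd)

end FinDigraph

/-! ### The subset sum problem with weak digraph constraint -/

/-- An instance of SSGW; the items are numbered `0, …, n - 1`. All parameters are positive integers. -/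
structure SSGWInstance where
  /-- the number of items -/
  n : ℕ
  /-- the digraph on the set of all items -/
  graph : FinDigraph (Fin n)
  /-- the sizes of the items -/
  size : Fin n → ℕ
  /-- the capacity -/
  c : ℕ
  verts_eq : graph.verts = Finset.univ
  n_pos : 0 < n
  size_pos : ∀ j, 0 < size j
  c_pos : 0 < c

namespace SSGWInstance

/-- The number of arcs. -/
def m (I : SSGWInstance) : ℕ := I.graph.arcs.card

/-- The total size `s(A')` of a set of items. -/
def total (I : SSGWInstance) (A : Finset (Fin I.n)) : ℕ := ∑ j ∈ A, I.size j

/-- `A` satisfies the capacity constraint and the weak digraph constraint. -/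
def IsFeasible (I : SSGWInstance) (A : Finset (Fin I.n)) : Prop :=
  I.total A ≤ I.c ∧
    ∀ y : Fin I.n, I.graph.preds y ⊆ A ∧ (I.graph.preds y).Nonempty → y ∈ A

/-- `A` is a feasible solution of maximum total size. -/
def IsOptimal (I : SSGWInstance) (A : Finset (Fin I.n)) : Prop :=
  I.IsFeasible A ∧ ∀ B : Finset (Fin I.n), I.IsFeasible B → I.total B ≤ I.total A

/-- `l` lists every arc exactly once, in some order. -/
def IsArcList (I : SSGWInstance) (l : List (Fin I.n × Fin I.n)) : Prop :=
  l.Nodup ∧ ∀ e, e ∈ l ↔ e ∈ I.graph.arcs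

/-- The input `n, m, c, s₀, …, sₙ₋₁, u₁, v₁, …, uₘ, vₘ` given to the machine, where
`(u₁, v₁), …, (uₘ, vₘ)` is the list `l` of arcs. -/
def encode (I : SSGWInstance) (l : List (Fin I.n × Fin I.n)) : List ℕ :=
  [I.n, l.length, I.c] ++ List.ofFn I.size ++ l.flatMap fun e => [(e.1 : ℕ), (e.2 : ℕ)]

end SSGWInstance

/-! ### A word RAM

Programs are written in structured form. A program has `r` registers and `k` arrays of work memory, where
`r` and `k` are fixed with the program, and random access to a read-only input. Every array has
`len` cells, and every computed value has to be below `word`; a program that leaves an array, reads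
outside the input or produces an overflow gets stuck, that is, it has no run. -/

namespace WordRAM

/-- The arithmetic operations and comparisons of the machine. -/
inductive Op
  | add
  | sub
  | mul
  | lt
  | eq

/-- Subtraction is truncated at `0`; a comparison yields `1` if it holds and `0` if not. -/
def Op.apply : Op → ℕ → ℕ → ℕ
  | .add, x, y => x + y
  | .sub, x, y => x - y
  | .mul, x, y => x * y
  | .lt, x, y => if x < y then 1 else 0
  | .eq, x, y => if x = y then 1 else 0

/-- Expressions. -/
inductive Expr (r k : ℕ)
  /-- a numeral -/
  | const (a : ℕ)
  /-- the content of a register -/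
  | reg (x : Fin r)
  /-- the content of cell `i` of array `a` -/
  | cell (a : Fin k) (i : Expr r k)
  /-- the number at position `i` of the input -/
  | input (i : Expr r k)
  /-- an operation applied to two values -/
  | bin (o : Op) (e f : Expr r k)

/-- Programs. -/
inductive Cmd (r k : ℕ)
  /-- do nothing -/
  | skip
  /-- write the value of `e` into register `x` -/
  | set (x : Fin r) (e : Expr r k)
  /-- write the value of `e` into cell `i` of array `a` -/
  | store (a : Fin k) (i e : Expr r k)
  /-- first `p`, then `q` -/
  | seq (p q : Cmd r k)
  /-- `p` if the value of `b` is not `0`, otherwise `q` -/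
  | ite (b : Expr r k) (p q : Cmd r k)
  /-- repeat `p` as long as the value of `b` is not `0` -/
  | loop (b : Expr r k) (p : Cmd r k)

/-- The content of the work memory. -/
@[ext]
structure State (r k : ℕ) where
  /-- the registers -/
  reg : Fin r → ℕ
  /-- the arrays -/
  arr : Fin k → ℕ → ℕ

/-- The initial work memory: everything is `0`. -/
def State.zero (r k : ℕ) : State r k where
  reg := fun _ => 0
  arr := fun _ _ => 0

/-- Replace the content of register `x`. -/
def State.setReg {r k : ℕ} (σ : State r k) (x : Fin r) (v : ℕ) : State r k where
  reg := Function.update σ.reg x v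
  arr := σ.arr

/-- Replace the content of cell `i` of array `a`. -/
def State.setCell {r k : ℕ} (σ : State r k) (a : Fin k) (i v : ℕ) : State r k where
  reg := σ.reg
  arr := Function.update σ.arr a (Function.update (σ.arr a) i v)

/-- What a run of a program is given: the read-only input, the number of cells
of each array, and the bound for the values that fit into a machine word. -/
structure Config where
  /-- the read-only input -/
  inp : List ℕ
  /-- the number of cells of each array -/
  len : ℕ
  /-- every word holds a natural number below `word` -/
  word : ℕ

/-- The value `v`, provided that it fits into a word. -/
def Config.fit (M : Config) (v : ℕ) : Option ℕ := if v < M.word then some v else none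

/-- The value of an expression; `none` if an access is out of range or a value does not fit into a word. -/
def Expr.eval {r k : ℕ} (M : Config) (σ : State r k) : Expr r k → Option ℕ
  | .const a => M.fit a
  | .reg x => some (σ.reg x)
  | .cell a i => (i.eval M σ).bind fun v => if v < M.len then some (σ.arr a v) else none
  | .input i => (i.eval M σ).bind fun v => (M.inp[v]?).bind M.fit
  | .bin o e f => (e.eval M σ).bind fun x => (f.eval M σ).bind fun y => M.fit (o.apply x y)

/-- The time to evaluate an expression: one unit for each constant, register, memory access,
input access and operation in it. -/
def Expr.cost {r k : ℕ} : Expr r k → ℕ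
  | .const _ => 1
  | .reg _ => 1
  | .cell _ i => i.cost + 1
  | .input i => i.cost + 1
  | .bin _ e f => e.cost + f.cost + 1

/-- `Exec M p σ t τ`: started with work memory `σ`, the program `p` halts after `t` steps with work memory `τ`. -/
inductive Exec {r k : ℕ} (M : Config) : Cmd r k → State r k → ℕ → State r k → Prop
  | skip (σ : State r k) : Exec M .skip σ 1 σ
  | set {σ : State r k} {x : Fin r} {e : Expr r k} {v : ℕ} (he : e.eval M σ = some v) :
      Exec M (.set x e) σ (e.cost + 1) (σ.setReg x v)
  | store {σ : State r k} {a : Fin k} {i e : Expr r k} {j v : ℕ}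
      (hi : i.eval M σ = some j) (hj : j < M.len) (he : e.eval M σ = some v) :
      Exec M (.store a i e) σ (i.cost + e.cost + 1) (σ.setCell a j v)
  | seq {p q : Cmd r k} {σ σ' σ'' : State r k} {t t' : ℕ}
      (hp : Exec M p σ t σ') (hq : Exec M q σ' t' σ'') : Exec M (.seq p q) σ (t + t') σ''
  | ite_true {b : Expr r k} {p q : Cmd r k} {σ σ' : State r k} {v t : ℕ}
      (hb : b.eval M σ = some v) (hv : v ≠ 0) (hp : Exec M p σ t σ') :
      Exec M (.ite b p q) σ (b.cost + 1 + t) σ'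
  | ite_false {b : Expr r k} {p q : Cmd r k} {σ σ' : State r k} {t : ℕ}
      (hb : b.eval M σ = some 0) (hq : Exec M q σ t σ') :
      Exec M (.ite b p q) σ (b.cost + 1 + t) σ'
  | loop_true {b : Expr r k} {p : Cmd r k} {σ σ' σ'' : State r k} {v t t' : ℕ}
      (hb : b.eval M σ = some v) (hv : v ≠ 0)
      (hp : Exec M p σ t σ') (hl : Exec M (.loop b p) σ' t' σ'') :
      Exec M (.loop b p) σ (b.cost + 1 + t + t') σ''
  | loop_false {b : Expr r k} {p : Cmd r k} {σ : State r k}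
      (hb : b.eval M σ = some 0) : Exec M (.loop b p) σ (b.cost + 1) σ

/-- The number of words of work memory of a machine with `r` registers and `k` arrays of `len` cells. -/
def space (r k len : ℕ) : ℕ := r + k * len

/-- The output: the set of all `j < n` for which cell `j` of the array with number `0` is not `0`. -/
def State.output {r k : ℕ} (σ : State r (k + 1)) (n : ℕ) : Finset (Fin n) :=
  Finset.univ.filter fun j => σ.arr 0 (j : ℕ) ≠ 0

end WordRAM

/-! A minimal series-parallel digraph is given by a tree over its vertices (`SPTree`), but the
machine only sees a list of arcs. The proof therefore has two halves: recovering a decomposition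
tree in time O(n + m), and a dynamic program over this tree.

Recovering the tree. Two vertices with a common successor have the same successors
(`arc_of_common_succ`). Hence the digraph is the line digraph of a multigraph: the items are the
edges, the head of an item names its set of successors (one more than the least successor, or the
sink 0 if there is none), and its tail is the head of an arbitrary predecessor (or the source n + 1
if there is none). Arcs of the digraph are pairs of consecutive edges (`ArcsRead.encodes`). Two
parallel edges, or two edges that meet in a node without further edges, can be made siblings in the
tree by commutativity and associativity (`exists_subst_par`, `exists_subst_ser`), so each such pair
may be replaced by one edge that carries a larger subtree. The nodes are handled in topological
order. When a node is handled, every earlier inner node has only one incoming edge left. An edge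
whose tail has no other outgoing edge absorbs the edge into its tail, and edges with the same tail
are merged. By `Encodes.exists_reducible` a node at which neither reduction applies has a single
incoming edge (`RedInner.finish`). Each reduction removes an edge, which gives linear time in total,
and after the sink one edge is left, labelled by a tree that is equivalent to the original one.

Dynamic program. For a subtree it suffices to know which pairs (b, s) occur, where s ≤ c is the size
of a set that satisfies the constraint inside the subtree and b tells whether the set contains all
sinks. A parallel composition imposes no further condition. In a series composition the sources of
the right part get the sinks of the left part as predecessors. If all these sinks are chosen, then
all those sources have to be chosen, and with them the whole right part (`Closed.mem_of_src`,
`good_iff`). As sizes are positive, the choice of the whole right part is recognised by its size, so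
the pairs carry enough information (`good_of_ne_zero`, `ne_zero_of_good`). A row has 2(c + 1)
entries and is filled by trying all pairs of entries of the two children. This takes O(n c² + m)
time and O(n c) space, which is within the bounds. Stored witnesses lead from a best entry at the
root back to a solution.

The program is verified by computing the effect of loop-free pieces as functions on states, and by
one loop rule whose invariant is indexed by a potential that pays for the time. -/

/-! ### Total semantics of expressions and of loop-free programs -/

namespace WordRAM

variable {r k : ℕ}

/-- The number at position `i` of the input. -/
def Config.read (M : Config) (i : ℕ) : ℕ := M.inp.getD i 0

namespace Expr

instance : Add (Expr r k) := ⟨.bin .add⟩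
instance : Sub (Expr r k) := ⟨.bin .sub⟩
instance : Mul (Expr r k) := ⟨.bin .mul⟩
instance (a : ℕ) : OfNat (Expr r k) a := ⟨.const a⟩

/-- The expression that tests `e < f`. -/
def lt (e f : Expr r k) : Expr r k := .bin .lt e f

/-- The expression that tests `e = f`. -/
def eq (e f : Expr r k) : Expr r k := .bin .eq e f

/-- The value of an expression, ignoring range checks. -/
def val (M : Config) (σ : State r k) : Expr r k → ℕ
  | .const a => a
  | .reg x => σ.reg x
  | .cell a i => σ.arr a (i.val M σ)
  | .input i => M.read (i.val M σ)
  | .bin o e f => o.apply (e.val M σ) (f.val M σ)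

/-- A bound for the result of an operation. -/
def _root_.WordRAM.Op.bound : Op → ℕ → ℕ → ℕ
  | .add, x, y => x + y
  | .sub, x, _ => x
  | .mul, x, y => x * y
  | .lt, _, _ => 1
  | .eq, _, _ => 1

theorem _root_.WordRAM.Op.apply_le_bound (o : Op) (x y : ℕ) : o.apply x y ≤ o.bound x y := by
  cases o <;> simp only [Op.apply, Op.bound] <;> first | omega | (split_ifs <;> omega)

/-- All range checks in the evaluation of an expression succeed. -/
def Ok (M : Config) (σ : State r k) : Expr r k → Prop
  | .const a => a < M.word
  | .reg _ => True
  | .cell _ i => i.Ok M σ ∧ i.val M σ < M.len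
  | .input i => i.Ok M σ ∧ i.val M σ < M.inp.length ∧ M.read (i.val M σ) < M.word
  | .bin o e f => e.Ok M σ ∧ f.Ok M σ ∧ o.bound (e.val M σ) (f.val M σ) < M.word

/-- `Ok` is sufficient but not necessary for success: it tests `Op.bound` in place of the exact
result, so a difference counts as its minuend and a comparison as 1. This keeps the side conditions
free of case distinctions. -/
theorem eval_eq {M : Config} {σ : State r k} {e : Expr r k} (h : e.Ok M σ) :
    e.eval M σ = some (e.val M σ) := by
  induction e with
  | const a => simpa [eval, val, Config.fit, Ok] using h
  | reg x => rfl
  | cell a i ih =>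
    obtain ⟨h1, h2⟩ := h
    simp [eval, val, ih h1, h2]
  | input i ih =>
    obtain ⟨h1, h2, h3⟩ := h
    rw [Config.read, List.getD_eq_getElem _ _ h2] at h3
    simp [eval, val, ih h1, h2, Config.fit, h3, Config.read]
  | bin o e f ihe ihf =>
    obtain ⟨h1, h2, h3⟩ := h
    simp [eval, val, ihe h1, ihf h2, Config.fit, (Op.apply_le_bound _ _ _).trans_lt h3]

/-- The value of a test for `x < y`. -/
def ofLt (x y : ℕ) : ℕ := if x < y then 1 else 0

/-- The value of a test for `x = y`. -/
def ofEq (x y : ℕ) : ℕ := if x = y then 1 else 0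

@[simp] theorem ofLt_eq (x y : ℕ) : ofLt x y = if x < y then 1 else 0 := rfl
@[simp] theorem ofEq_eq (x y : ℕ) : ofEq x y = if x = y then 1 else 0 := rfl

section simp
variable (M : Config) (σ : State r k) (e f : Expr r k) (a : ℕ)

@[simp] theorem val_ofNat : (no_index (OfNat.ofNat a) : Expr r k).val M σ = OfNat.ofNat a := rfl
@[simp] theorem val_const : (const a : Expr r k).val M σ = a := rfl
@[simp] theorem val_reg (x : Fin r) : (reg x : Expr r k).val M σ = σ.reg x := rfl
@[simp] theorem val_cell (x : Fin k) : (cell x e).val M σ = σ.arr x (e.val M σ) := rfl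
@[simp] theorem val_input : (input e).val M σ = M.read (e.val M σ) := rfl
@[simp] theorem val_add : (e + f).val M σ = e.val M σ + f.val M σ := rfl
@[simp] theorem val_sub : (e - f).val M σ = e.val M σ - f.val M σ := rfl
@[simp] theorem val_mul : (e * f).val M σ = e.val M σ * f.val M σ := rfl
@[simp] theorem val_lt : (lt e f).val M σ = ofLt (e.val M σ) (f.val M σ) := rfl
@[simp] theorem val_eq : (eq e f).val M σ = ofEq (e.val M σ) (f.val M σ) := rfl
@[simp] theorem ok_ofNat :
    (no_index (OfNat.ofNat a) : Expr r k).Ok M σ ↔ OfNat.ofNat a < M.word := Iff.rfl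
@[simp] theorem ok_const : (const a : Expr r k).Ok M σ ↔ a < M.word := Iff.rfl
@[simp] theorem ok_reg (x : Fin r) : (reg x : Expr r k).Ok M σ := trivial
@[simp] theorem ok_cell (x : Fin k) :
    (cell x e).Ok M σ ↔ e.Ok M σ ∧ e.val M σ < M.len := Iff.rfl
@[simp] theorem ok_input : (input e).Ok M σ ↔
    e.Ok M σ ∧ e.val M σ < M.inp.length ∧ M.read (e.val M σ) < M.word := Iff.rfl
@[simp] theorem ok_add : (e + f).Ok M σ ↔
    e.Ok M σ ∧ f.Ok M σ ∧ e.val M σ + f.val M σ < M.word := Iff.rfl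
@[simp] theorem ok_mul : (e * f).Ok M σ ↔
    e.Ok M σ ∧ f.Ok M σ ∧ e.val M σ * f.val M σ < M.word := Iff.rfl
@[simp] theorem ok_sub : (e - f).Ok M σ ↔
    e.Ok M σ ∧ f.Ok M σ ∧ e.val M σ < M.word := Iff.rfl
@[simp] theorem ok_lt : (lt e f).Ok M σ ↔
    e.Ok M σ ∧ f.Ok M σ ∧ 1 < M.word := Iff.rfl
@[simp] theorem ok_eq : (eq e f).Ok M σ ↔
    e.Ok M σ ∧ f.Ok M σ ∧ 1 < M.word := Iff.rfl

end simp

end Expr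

namespace State

variable (σ : State r k)

@[simp] theorem setReg_reg (x y : Fin r) (v : ℕ) :
    (σ.setReg x v).reg y = if y = x then v else σ.reg y := by
  simp [setReg, Function.update_apply]
@[simp] theorem setReg_arr (x : Fin r) (v : ℕ) : (σ.setReg x v).arr = σ.arr := rfl
@[simp] theorem setCell_reg (a : Fin k) (i v : ℕ) : (σ.setCell a i v).reg = σ.reg := rfl
@[simp] theorem setCell_arr (a b : Fin k) (i v : ℕ) :
    (σ.setCell a i v).arr b = if b = a then Function.update (σ.arr a) i v else σ.arr b := by
  by_cases h : b = a
  · subst h; simp [setCell]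
  · simp [setCell, h]

end State

namespace Cmd

/-- The effect of a loop-free program, ignoring range checks. -/
def run (M : Config) : Cmd r k → State r k → State r k
  | .skip, σ => σ
  | .set x e, σ => σ.setReg x (e.val M σ)
  | .store a i e, σ => σ.setCell a (i.val M σ) (e.val M σ)
  | .seq p q, σ => q.run M (p.run M σ)
  | .ite b p q, σ => if b.val M σ ≠ 0 then p.run M σ else q.run M σ
  | .loop _ _, σ => σ

/-- The program is loop-free and all range checks in its run succeed. -/
def Ok (M : Config) : Cmd r k → State r k → Prop
  | .skip, _ => True
  | .set _ e, σ => e.Ok M σ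
  | .store _ i e, σ => i.Ok M σ ∧ i.val M σ < M.len ∧ e.Ok M σ
  | .seq p q, σ => p.Ok M σ ∧ q.Ok M (p.run M σ)
  | .ite b p q, σ => b.Ok M σ ∧ (b.val M σ ≠ 0 → p.Ok M σ) ∧ (b.val M σ = 0 → q.Ok M σ)
  | .loop _ _, _ => False

/-- A bound for the running time of a loop-free program. -/
def bound : Cmd r k → ℕ
  | .skip => 1
  | .set _ e => e.cost + 1
  | .store _ i e => i.cost + e.cost + 1
  | .seq p q => p.bound + q.bound
  | .ite b p q => b.cost + 1 + (p.bound + q.bound)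
  | .loop _ _ => 0

section simp
variable (M : Config) (σ : State r k) (e b : Expr r k) (p q : Cmd r k)

@[simp] theorem run_skip : (skip : Cmd r k).run M σ = σ := rfl
@[simp] theorem run_set (x : Fin r) : (set x e : Cmd r k).run M σ = σ.setReg x (e.val M σ) := rfl
@[simp] theorem run_store (a : Fin k) (i : Expr r k) :
    (store a i e).run M σ = σ.setCell a (i.val M σ) (e.val M σ) := rfl
@[simp] theorem run_seq : (seq p q).run M σ = q.run M (p.run M σ) := rfl
@[simp] theorem run_ite :
    (ite b p q).run M σ = if b.val M σ ≠ 0 then p.run M σ else q.run M σ := rfl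
@[simp] theorem ok_skip : (skip : Cmd r k).Ok M σ := trivial
@[simp] theorem ok_set (x : Fin r) : (set x e : Cmd r k).Ok M σ ↔ e.Ok M σ := Iff.rfl
@[simp] theorem ok_store (a : Fin k) (i : Expr r k) :
    (store a i e).Ok M σ ↔ i.Ok M σ ∧ i.val M σ < M.len ∧ e.Ok M σ := Iff.rfl
@[simp] theorem ok_seq : (seq p q).Ok M σ ↔ p.Ok M σ ∧ q.Ok M (p.run M σ) := Iff.rfl
@[simp] theorem ok_ite : (ite b p q).Ok M σ ↔
    b.Ok M σ ∧ (b.val M σ ≠ 0 → p.Ok M σ) ∧ (b.val M σ = 0 → q.Ok M σ) := Iff.rfl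

end simp

/-- This turns the execution of loop-free code into simplification of the term `run`. The time
enters only through `bound`, which does not depend on the state because it charges both branches of
a conditional. -/
theorem exec_run {M : Config} {p : Cmd r k} {σ : State r k} (h : p.Ok M σ) :
    ∃ t, Exec M p σ t (p.run M σ) ∧ t ≤ p.bound := by
  induction p generalizing σ with
  | skip => exact ⟨1, .skip σ, le_rfl⟩
  | set x e => exact ⟨_, .set (Expr.eval_eq h), le_rfl⟩
  | store a i e => exact ⟨_, .store (Expr.eval_eq h.1) h.2.1 (Expr.eval_eq h.2.2), le_rfl⟩
  | seq p q ihp ihq =>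
    obtain ⟨t, h1, h2⟩ := ihp h.1
    obtain ⟨t', h3, h4⟩ := ihq h.2
    exact ⟨_, .seq h1 h3, by simp only [bound]; omega⟩
  | ite b p q ihp ihq =>
    obtain ⟨hb, hp, hq⟩ := h
    by_cases hv : b.val M σ = 0
    · obtain ⟨t, h1, h2⟩ := ihq (hq hv)
      have h3 := Expr.eval_eq hb
      rw [hv] at h3
      refine ⟨b.cost + 1 + t, ?_, ?_⟩
      · rw [run_ite, if_neg (by simpa using hv)]
        exact .ite_false h3 h1
      · simp only [bound]; omega
    · obtain ⟨t, h1, h2⟩ := ihp (hp hv)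
      refine ⟨b.cost + 1 + t, ?_, ?_⟩
      · rw [run_ite, if_pos hv]
        exact .ite_true (Expr.eval_eq hb) hv h1
      · simp only [bound]; omega
  | loop b p => exact h.elim

/-- Whether a program may write to array `a`. -/
def writes (a : Fin k) : Cmd r k → Bool
  | .store b _ _ => decide (a = b)
  | .seq p q => p.writes a || q.writes a
  | .ite _ p q => p.writes a || q.writes a
  | .loop _ p => p.writes a
  | _ => false

/-- Whether a program may change register `x`. -/
def assigns (x : Fin r) : Cmd r k → Bool
  | .set y _ => decide (x = y)
  | .seq p q => p.assigns x || q.assigns x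
  | .ite _ p q => p.assigns x || q.assigns x
  | .loop _ p => p.assigns x
  | _ => false

end Cmd

/-- A frame rule with a syntactic hypothesis that is decided by computation. Because of it, the
invariants of the loops need not mention the arrays that a later phase relies on but the loop does
not write. -/
theorem Exec.arr_eq {M : Config} {p : Cmd r k} {σ τ : State r k} {t : ℕ} (h : Exec M p σ t τ)
    {a : Fin k} (ha : p.writes a = false) : τ.arr a = σ.arr a := by
  induction h with
  | skip => rfl
  | set => rfl
  | store => simp only [Cmd.writes, decide_eq_false_iff_not] at ha; simp [ha]
  | seq _ _ h1 h2 =>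
    simp only [Cmd.writes, Bool.or_eq_false_iff] at ha; rw [h2 ha.2, h1 ha.1]
  | ite_true _ _ _ h1 =>
    simp only [Cmd.writes, Bool.or_eq_false_iff] at ha; exact h1 ha.1
  | ite_false _ _ h1 =>
    simp only [Cmd.writes, Bool.or_eq_false_iff] at ha; exact h1 ha.2
  | loop_true _ _ _ _ h1 h2 =>
    rw [h2 ha, h1 (by simpa only [Cmd.writes] using ha)]
  | loop_false => rfl

theorem Exec.reg_eq {M : Config} {p : Cmd r k} {σ τ : State r k} {t : ℕ} (h : Exec M p σ t τ)
    {x : Fin r} (hx : p.assigns x = false) : τ.reg x = σ.reg x := by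
  induction h with
  | skip => rfl
  | store => rfl
  | set => simp only [Cmd.assigns, decide_eq_false_iff_not] at hx; simp [hx]
  | seq _ _ h1 h2 =>
    simp only [Cmd.assigns, Bool.or_eq_false_iff] at hx; rw [h2 hx.2, h1 hx.1]
  | ite_true _ _ _ h1 =>
    simp only [Cmd.assigns, Bool.or_eq_false_iff] at hx; exact h1 hx.1
  | ite_false _ _ h1 =>
    simp only [Cmd.assigns, Bool.or_eq_false_iff] at hx; exact h1 hx.2
  | loop_true _ _ _ _ h1 h2 =>
    rw [h2 hx, h1 (by simpa only [Cmd.assigns] using hx)]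
  | loop_false => rfl

/-- Loop rule. The index of the invariant is a potential that pays for the running time. -/
theorem exec_loop {M : Config} {b : Expr r k} {p : Cmd r k} (Inv : ℕ → State r k → Prop)
    (hok : ∀ φ σ, Inv φ σ → b.Ok M σ)
    (hstep : ∀ φ σ, Inv φ σ → b.val M σ ≠ 0 →
      ∃ t τ φ', Exec M p σ t τ ∧ Inv φ' τ ∧ t + b.cost + 1 + φ' ≤ φ)
    (φ : ℕ) (σ : State r k) (h : Inv φ σ) :
    ∃ t τ φ', Exec M (.loop b p) σ t τ ∧ Inv φ' τ ∧ b.val M τ = 0 ∧ t + φ' ≤ φ + (b.cost + 1) := by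
  -- The potential decreases strictly, since the test alone costs at least one unit in every round.
  induction φ using Nat.strong_induction_on generalizing σ with
  | _ φ ih =>
    by_cases hv : b.val M σ = 0
    · have h3 := Expr.eval_eq (hok φ σ h)
      rw [hv] at h3
      exact ⟨_, σ, φ, .loop_false h3, h, hv, by omega⟩
    · obtain ⟨t, τ, φ', h1, h2, h3⟩ := hstep φ σ h hv
      obtain ⟨t', τ', φ'', h4, h5, h6, h7⟩ := ih φ' (by omega) τ h2
      exact ⟨_, τ', φ'', .loop_true (Expr.eval_eq (hok φ σ h)) hv h1 h4, h5, h6, by omega⟩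

/-- The time of one round of a loop with a loop-free body. -/
def roundCost (b : Expr r k) (p : Cmd r k) : ℕ := p.bound + b.cost + 1

/-- Loop rule for a loop-free body. The index of the invariant bounds the number of rounds. -/
theorem exec_loop_run {M : Config} {b : Expr r k} {p : Cmd r k} (Inv : ℕ → State r k → Prop)
    (hok : ∀ φ σ, Inv φ σ → b.Ok M σ)
    (hstep : ∀ φ σ, Inv φ σ → b.val M σ ≠ 0 → p.Ok M σ ∧ ∃ φ' < φ, Inv φ' (p.run M σ))
    (φ : ℕ) (σ : State r k) (h : Inv φ σ) :
    ∃ t τ φ', Exec M (.loop b p) σ t τ ∧ Inv φ' τ ∧ b.val M τ = 0 ∧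
      t + φ' * roundCost b p ≤ φ * roundCost b p + (b.cost + 1) := by
  obtain ⟨t, τ, φ', h1, ⟨ψ, rfl, h2⟩, h3, h4⟩ := exec_loop (M := M) (b := b) (p := p)
    (fun φ σ => ∃ ψ, φ = ψ * roundCost b p ∧ Inv ψ σ)
    (fun φ σ ⟨ψ, _, hψ⟩ => hok ψ σ hψ)
    (by
      rintro _ σ ⟨ψ, rfl, hψ⟩ hv
      obtain ⟨h1, ψ', hlt, h2⟩ := hstep ψ σ hψ hv
      obtain ⟨t, h3, h4⟩ := Cmd.exec_run h1
      refine ⟨t, _, _, h3, ⟨ψ', rfl, h2⟩, ?_⟩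
      have : (ψ' + 1) * roundCost b p ≤ ψ * roundCost b p := Nat.mul_le_mul_right _ hlt
      rw [add_mul] at this
      simp only [roundCost] at this ⊢
      omega)
    (φ * roundCost b p) σ ⟨φ, rfl, h⟩
  exact ⟨t, τ, ψ, h1, h2, h3, h4⟩

end WordRAM

/-! ### Series-parallel expressions -/

/-- Expressions over vertices, built with parallel and series composition. -/
inductive SPTree
  | leaf (v : ℕ)
  | par (A B : SPTree)
  | ser (A B : SPTree)

namespace SPTree

/-- `x` is a leaf of the tree. -/
def Mem : SPTree → ℕ → Prop
  | leaf v, x => x = v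
  | par A B, x => A.Mem x ∨ B.Mem x
  | ser A B, x => A.Mem x ∨ B.Mem x

/-- `x` is a source of the digraph of the tree. -/
def Src : SPTree → ℕ → Prop
  | leaf v, x => x = v
  | par A B, x => A.Src x ∨ B.Src x
  | ser A _, x => A.Src x

/-- `x` is a sink of the digraph of the tree. -/
def Snk : SPTree → ℕ → Prop
  | leaf v, x => x = v
  | par A B, x => A.Snk x ∨ B.Snk x
  | ser _ B, x => B.Snk x

/-- The arcs of the digraph of the tree. -/
def Arc : SPTree → ℕ → ℕ → Prop
  | leaf _, _, _ => False
  | par A B, x, y => A.Arc x y ∨ B.Arc x y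
  | ser A B, x, y => A.Arc x y ∨ B.Arc x y ∨ A.Snk x ∧ B.Src y

/-- No two leaves carry the same vertex. -/
def Nodup : SPTree → Prop
  | leaf _ => True
  | par A B => A.Nodup ∧ B.Nodup ∧ ∀ x, A.Mem x → ¬ B.Mem x
  | ser A B => A.Nodup ∧ B.Nodup ∧ ∀ x, A.Mem x → ¬ B.Mem x

/-- The number of leaves. -/
def size : SPTree → ℕ
  | leaf _ => 1
  | par A B => A.size + B.size
  | ser A B => A.size + B.size

/-- Substitution of trees for the leaves. -/
def bind : SPTree → (ℕ → SPTree) → SPTree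
  | leaf v, σ => σ v
  | par A B, σ => par (A.bind σ) (B.bind σ)
  | ser A B, σ => ser (A.bind σ) (B.bind σ)

/-- Equality up to commutativity and associativity of the parallel composition
and associativity of the series composition. -/
inductive Equiv : SPTree → SPTree → Prop
  | refl (A) : Equiv A A
  | symm {A B} : Equiv A B → Equiv B A
  | trans {A B C} : Equiv A B → Equiv B C → Equiv A C
  | par {A A' B B'} : Equiv A A' → Equiv B B' → Equiv (par A B) (par A' B')
  | ser {A A' B B'} : Equiv A A' → Equiv B B' → Equiv (ser A B) (ser A' B')
  | par_comm (A B) : Equiv (.par A B) (.par B A)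
  | par_assoc (A B C) : Equiv (.par (.par A B) C) (.par A (.par B C))
  | ser_assoc (A B C) : Equiv (.ser (.ser A B) C) (.ser A (.ser B C))

theorem Src.mem {T : SPTree} {x : ℕ} (h : T.Src x) : T.Mem x := by
  induction T with
  | leaf v => exact h
  | par A B ihA ihB => exact h.imp ihA ihB
  | ser A B ihA ihB => exact .inl (ihA h)

theorem Snk.mem {T : SPTree} {x : ℕ} (h : T.Snk x) : T.Mem x := by
  induction T with
  | leaf v => exact h
  | par A B ihA ihB => exact h.imp ihA ihB
  | ser A B ihA ihB => exact .inr (ihB h)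

theorem Arc.mem {T : SPTree} {x y : ℕ} (h : T.Arc x y) : T.Mem x ∧ T.Mem y := by
  induction T with
  | leaf v => exact h.elim
  | par A B ihA ihB =>
    rcases h with h | h
    · exact ⟨.inl (ihA h).1, .inl (ihA h).2⟩
    · exact ⟨.inr (ihB h).1, .inr (ihB h).2⟩
  | ser A B ihA ihB =>
    rcases h with h | h | h
    · exact ⟨.inl (ihA h).1, .inl (ihA h).2⟩
    · exact ⟨.inr (ihB h).1, .inr (ihB h).2⟩
    · exact ⟨.inl h.1.mem, .inr h.2.mem⟩

theorem exists_src (T : SPTree) : ∃ x, T.Src x := by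
  induction T with
  | leaf v => exact ⟨v, rfl⟩
  | par A B ihA ihB => exact ihA.imp fun _ => .inl
  | ser A B ihA ihB => exact ihA

theorem exists_snk (T : SPTree) : ∃ x, T.Snk x := by
  induction T with
  | leaf v => exact ⟨v, rfl⟩
  | par A B ihA ihB => exact ihA.imp fun _ => .inl
  | ser A B ihA ihB => exact ihB

theorem size_pos (T : SPTree) : 0 < T.size := by
  induction T <;> simp_all [size]

theorem Equiv.mem {A B : SPTree} (h : Equiv A B) (x : ℕ) : A.Mem x ↔ B.Mem x := by
  induction h <;> simp_all [Mem] <;> tauto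

theorem Equiv.src {A B : SPTree} (h : Equiv A B) (x : ℕ) : A.Src x ↔ B.Src x := by
  induction h <;> simp_all [Src] <;> tauto

theorem Equiv.snk {A B : SPTree} (h : Equiv A B) (x : ℕ) : A.Snk x ↔ B.Snk x := by
  induction h <;> simp_all [Snk] <;> tauto

theorem Equiv.arc {A B : SPTree} (h : Equiv A B) (x y : ℕ) : A.Arc x y ↔ B.Arc x y := by
  induction h with
  | refl => rfl
  | symm _ ih => exact ih.symm
  | trans _ _ h1 h2 => exact h1.trans h2
  | par _ _ h1 h2 => exact or_congr h1 h2
  | ser h1 h2 h3 h4 => simp only [Arc, h3, h4, h1.snk, h2.src]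
  | par_comm => exact or_comm
  | par_assoc => exact or_assoc
  | ser_assoc => simp only [Arc, Snk, Src]; tauto

theorem Equiv.nodup {A B : SPTree} (h : Equiv A B) : A.Nodup ↔ B.Nodup := by
  induction h with
  | refl => rfl
  | symm _ ih => exact ih.symm
  | trans _ _ h1 h2 => exact h1.trans h2
  | par h1 h2 h3 h4 => simp only [Nodup, h3, h4, h1.mem, h2.mem]
  | ser h1 h2 h3 h4 => simp only [Nodup, h3, h4, h1.mem, h2.mem]
  | par_comm A B =>
    simp only [Nodup]
    constructor <;> exact fun ⟨a, b, c⟩ => ⟨b, a, fun x h1 h2 => c x h2 h1⟩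
  | par_assoc A B C =>
    simp only [Nodup, Mem]
    constructor
    · rintro ⟨⟨a, b, c⟩, d, e⟩
      exact ⟨a, ⟨b, d, fun x h => e x (.inr h)⟩, fun x h h' => h'.elim (c x h) (e x (.inl h))⟩
    · rintro ⟨a, ⟨b, d, e⟩, c⟩
      exact ⟨⟨a, b, fun x h h' => c x h (.inl h')⟩, d, fun x h h' => h.elim
        (fun h => c x h (.inr h')) (fun h => e x h h')⟩
  | ser_assoc A B C =>
    simp only [Nodup, Mem]
    constructor
    · rintro ⟨⟨a, b, c⟩, d, e⟩
      exact ⟨a, ⟨b, d, fun x h => e x (.inr h)⟩, fun x h h' => h'.elim (c x h) (e x (.inl h))⟩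
    · rintro ⟨a, ⟨b, d, e⟩, c⟩
      exact ⟨⟨a, b, fun x h h' => c x h (.inl h')⟩, d, fun x h h' => h.elim
        (fun h => c x h (.inr h')) (fun h => e x h h')⟩

theorem Equiv.size_eq {A B : SPTree} (h : Equiv A B) : A.size = B.size := by
  induction h <;> simp_all [size] <;> omega

theorem Equiv.bind {A B : SPTree} (h : Equiv A B) (σ : ℕ → SPTree) :
    Equiv (A.bind σ) (B.bind σ) := by
  induction h with
  | refl => exact .refl _
  | symm _ ih => exact ih.symm
  | trans _ _ h1 h2 => exact h1.trans h2
  | par _ _ h1 h2 => exact .par h1 h2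
  | ser _ _ h1 h2 => exact .ser h1 h2
  | par_comm => exact .par_comm _ _
  | par_assoc => exact .par_assoc _ _ _
  | ser_assoc => exact .ser_assoc _ _ _

theorem bind_bind (T : SPTree) (σ τ : ℕ → SPTree) :
    (T.bind σ).bind τ = T.bind fun v => (σ v).bind τ := by
  induction T <;> simp_all [SPTree.bind]

theorem bind_congr {T : SPTree} {σ τ : ℕ → SPTree} (h : ∀ v, T.Mem v → σ v = τ v) :
    T.bind σ = T.bind τ := by
  induction T with
  | leaf v => exact h v rfl
  | par A B ihA ihB =>
    simp only [SPTree.bind, ihA fun v hv => h v (.inl hv), ihB fun v hv => h v (.inr hv)]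
  | ser A B ihA ihB =>
    simp only [SPTree.bind, ihA fun v hv => h v (.inl hv), ihB fun v hv => h v (.inr hv)]

theorem bind_leaf (T : SPTree) : T.bind leaf = T := by
  induction T <;> simp_all [SPTree.bind]

/-! ### Substitution of a tree for a leaf -/

/-- Replacement of the leaf `f` by the tree `U`. -/
def subst (T : SPTree) (f : ℕ) (U : SPTree) : SPTree := T.bind (Function.update leaf f U)

@[simp] theorem subst_leaf_self (f : ℕ) (U : SPTree) : (leaf f).subst f U = U := by
  simp [subst, SPTree.bind]
@[simp] theorem subst_par (A B : SPTree) (f : ℕ) (U : SPTree) :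
    (par A B).subst f U = par (A.subst f U) (B.subst f U) := rfl
@[simp] theorem subst_ser (A B : SPTree) (f : ℕ) (U : SPTree) :
    (ser A B).subst f U = ser (A.subst f U) (B.subst f U) := rfl

theorem subst_of_not_mem {T : SPTree} {f : ℕ} (h : ¬ T.Mem f) (U : SPTree) : T.subst f U = T := by
  conv_rhs => rw [← bind_leaf T]
  refine bind_congr fun v hv => Function.update_of_ne ?_ _ _
  rintro rfl; exact h hv

theorem mem_subst (T : SPTree) (f : ℕ) (U : SPTree) (x : ℕ) :
    (T.subst f U).Mem x ↔ T.Mem x ∧ x ≠ f ∨ T.Mem f ∧ U.Mem x := by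
  induction T with
  | leaf v =>
    by_cases h : v = f
    · subst h; simp [Mem]
    · rw [subst_of_not_mem (by simpa [Mem] using Ne.symm h)]
      simp only [Mem]; grind
  | par A B ihA ihB => simp only [subst_par, Mem, ihA, ihB]; tauto
  | ser A B ihA ihB => simp only [subst_ser, Mem, ihA, ihB]; tauto

theorem src_subst (T : SPTree) (f : ℕ) (U : SPTree) (x : ℕ) :
    (T.subst f U).Src x ↔ T.Src x ∧ x ≠ f ∨ T.Src f ∧ U.Src x := by
  induction T with
  | leaf v =>
    by_cases h : v = f
    · subst h; simp [Src]
    · rw [subst_of_not_mem (by simpa [Mem] using Ne.symm h)]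
      simp only [Src]; grind
  | par A B ihA ihB => simp only [subst_par, Src, ihA, ihB]; tauto
  | ser A B ihA ihB => simp only [subst_ser, Src, ihA]

theorem snk_subst (T : SPTree) (f : ℕ) (U : SPTree) (x : ℕ) :
    (T.subst f U).Snk x ↔ T.Snk x ∧ x ≠ f ∨ T.Snk f ∧ U.Snk x := by
  induction T with
  | leaf v =>
    by_cases h : v = f
    · subst h; simp [Snk]
    · rw [subst_of_not_mem (by simpa [Mem] using Ne.symm h)]
      simp only [Snk]; grind
  | par A B ihA ihB => simp only [subst_par, Snk, ihA, ihB]; tauto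
  | ser A B ihA ihB => simp only [subst_ser, Snk, ihB]

theorem arc_irrefl {T : SPTree} (hT : T.Nodup) (x : ℕ) : ¬ T.Arc x x := by
  induction T with
  | leaf v => exact id
  | par A B ihA ihB => rintro (h | h); exacts [ihA hT.1 h, ihB hT.2.1 h]
  | ser A B ihA ihB =>
    rintro (h | h | h)
    exacts [ihA hT.1 h, ihB hT.2.1 h, hT.2.2 x h.1.mem h.2.mem]

/-- The tree `U` takes over the position of `f`: arcs into `f` become arcs into the sources of `U`,
and arcs out of `f` become arcs out of its sinks. Distinctness of the leaves matters, since with `f`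
on both sides of a series node there would be arcs from the sinks of one copy of `U` to the sources
of the other. -/
theorem arc_subst {T : SPTree} (hT : T.Nodup) (f : ℕ) (U : SPTree) (x y : ℕ) :
    (T.subst f U).Arc x y ↔ T.Arc x y ∧ x ≠ f ∧ y ≠ f ∨ T.Arc x f ∧ U.Src y ∨
      T.Arc f y ∧ U.Snk x ∨ T.Mem f ∧ U.Arc x y := by
  induction T with
  | leaf v =>
    by_cases h : v = f
    · subst h; simp [Arc, Mem]
    · rw [subst_of_not_mem (by simpa [Mem] using Ne.symm h)]
      simp only [Arc, Mem]; grind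
  | par A B ihA ihB =>
    simp only [subst_par, Arc, Mem, ihA hT.1, ihB hT.2.1, or_and_right]
    rw [← eq_iff_iff]; ac_rfl
  | ser A B ihA ihB =>
    simp only [subst_ser, Arc, Mem, ihA hT.1, ihB hT.2.1, src_subst, snk_subst]
    by_cases hA : A.Mem f
    · have hB := hT.2.2 f hA
      have h1 : ¬ B.Src f := fun h => hB h.mem
      have h2 : ∀ z, ¬ B.Arc z f := fun z h => hB h.mem.2
      have h3 : ∀ z, ¬ B.Arc f z := fun z h => hB h.mem.1
      have h4 : B.Src y → y ≠ f := by rintro h rfl; exact h1 h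
      have h5 : B.Arc x y → x ≠ f ∧ y ≠ f := fun h =>
        ⟨fun h' => h3 _ (h' ▸ h), fun h' => h2 _ (h' ▸ h)⟩
      simp only [hA, hB, h1, h2, h3, false_and, or_false, true_and, and_false, false_or]
      clear ihA ihB hT h1 h2 h3 hA hB
      grind
    · have h1 : ¬ A.Snk f := fun h => hA h.mem
      have h2 : ∀ z, ¬ A.Arc z f := fun z h => hA h.mem.2
      have h3 : ∀ z, ¬ A.Arc f z := fun z h => hA h.mem.1
      have h4 : A.Snk x → x ≠ f := by rintro h rfl; exact h1 h
      have h5 : A.Arc x y → x ≠ f ∧ y ≠ f := fun h =>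
        ⟨fun h' => h3 _ (h' ▸ h), fun h' => h2 _ (h' ▸ h)⟩
      simp only [hA, h1, h2, h3, false_and, or_false, false_or]
      clear ihA ihB hT h1 h2 h3 hA
      grind

theorem size_subst {T : SPTree} (hT : T.Nodup) {f : ℕ} (hf : T.Mem f) (U : SPTree) :
    (T.subst f U).size + 1 = T.size + U.size := by
  induction T with
  | leaf v => simp only [Mem] at hf; subst hf; simp [size, add_comm]
  | par A B ihA ihB =>
    rcases hf with hf | hf
    · have := ihA hT.1 hf
      rw [subst_par, subst_of_not_mem (hT.2.2 f hf)]
      simp only [size]; omega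
    · have := ihB hT.2.1 hf
      rw [subst_par, subst_of_not_mem (fun h => hT.2.2 f h hf)]
      simp only [size]; omega
  | ser A B ihA ihB =>
    rcases hf with hf | hf
    · have := ihA hT.1 hf
      rw [subst_ser, subst_of_not_mem (hT.2.2 f hf)]
      simp only [size]; omega
    · have := ihB hT.2.1 hf
      rw [subst_ser, subst_of_not_mem (fun h => hT.2.2 f h hf)]
      simp only [size]; omega

/-! ### Neighbourhoods in series-parallel digraphs -/

/-- Source-hood means having no predecessor. -/
theorem src_iff {T : SPTree} (hT : T.Nodup) (x : ℕ) : T.Src x ↔ T.Mem x ∧ ∀ y, ¬ T.Arc y x := by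
  induction T with
  | leaf v => simp [Src, Mem, Arc]
  | par A B ihA ihB =>
    simp only [Src, Mem, Arc, ihA hT.1, ihB hT.2.1, not_or, forall_and]
    have h3 : ∀ y, A.Arc y x → A.Mem x := fun z h => h.mem.2
    have h4 : ∀ y, B.Arc y x → B.Mem x := fun z h => h.mem.2
    have := hT.2.2 x
    constructor
    · rintro (h | h)
      · exact ⟨.inl h.1, h.2, fun y hy => this h.1 (h4 y hy)⟩
      · exact ⟨.inr h.1, fun y hy => this (h3 y hy) h.1, h.2⟩
    · tauto
  | ser A B ihA ihB =>
    simp only [Src, Mem, Arc, ihA hT.1, not_or, forall_and, not_and]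
    have h4 : ∀ y, B.Arc y x → B.Mem x := fun z h => h.mem.2
    have := hT.2.2 x
    constructor
    · rintro h
      exact ⟨.inl h.1, h.2, fun y hy => this h.1 (h4 y hy), fun y _ h5 => this h.1 h5.mem⟩
    · rintro ⟨h | h, h1, h2, h5⟩
      · exact ⟨h, h1⟩
      · obtain ⟨y, hy⟩ := A.exists_snk
        exact (h5 y hy ((ihB hT.2.1).2 ⟨h, h2⟩)).elim

/-- Sink-hood means having no successor. -/
theorem snk_iff {T : SPTree} (hT : T.Nodup) (x : ℕ) : T.Snk x ↔ T.Mem x ∧ ∀ y, ¬ T.Arc x y := by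
  induction T with
  | leaf v => simp [Snk, Mem, Arc]
  | par A B ihA ihB =>
    simp only [Snk, Mem, Arc, ihA hT.1, ihB hT.2.1, not_or, forall_and]
    have h3 : ∀ y, A.Arc x y → A.Mem x := fun z h => h.mem.1
    have h4 : ∀ y, B.Arc x y → B.Mem x := fun z h => h.mem.1
    have := hT.2.2 x
    constructor
    · rintro (h | h)
      · exact ⟨.inl h.1, h.2, fun y hy => this h.1 (h4 y hy)⟩
      · exact ⟨.inr h.1, fun y hy => this (h3 y hy) h.1, h.2⟩
    · tauto
  | ser A B ihA ihB =>
    simp only [Snk, Mem, Arc, ihB hT.2.1, not_or, forall_and, not_and]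
    have h4 : ∀ y, A.Arc x y → A.Mem x := fun z h => h.mem.1
    have := hT.2.2 x
    constructor
    · rintro h
      exact ⟨.inr h.1, fun y hy => this (h4 y hy) h.1, h.2, fun y h5 => (this h5.mem h.1).elim⟩
    · rintro ⟨h | h, h1, h2, h5⟩
      · obtain ⟨y, hy⟩ := B.exists_src
        exact (h5 y ((ihA hT.1).2 ⟨h, h1⟩) hy).elim
      · exact ⟨h, h2⟩

/-- Two vertices with a common successor have the same successors. -/
theorem arc_of_common_succ {T : SPTree} (hT : T.Nodup) {e u w f : ℕ} (h1 : T.Arc e w)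
    (h2 : T.Arc u w) (h3 : T.Arc u f) : T.Arc e f := by
  induction T with
  | leaf v => exact h1
  | par A B ihA ihB =>
    have := hT.2.2
    rcases h2 with h2 | h2
    · have h1 := h1.resolve_right fun h => this _ h2.mem.2 h.mem.2
      have h3 := h3.resolve_right fun h => this _ h2.mem.1 h.mem.1
      exact .inl (ihA hT.1 h1 h2 h3)
    · have h1 := h1.resolve_left fun h => this _ h.mem.2 h2.mem.2
      have h3 := h3.resolve_left fun h => this _ h.mem.1 h2.mem.1
      exact .inr (ihB hT.2.1 h1 h2 h3)
  | ser A B ihA ihB =>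
    have hd := hT.2.2
    have hs := fun x => (snk_iff hT.1 x)
    have hr := fun x => (src_iff hT.2.1 x)
    rcases h2 with h2 | h2 | h2
    · have h1 : A.Arc e w := by
        rcases h1 with h | h | h
        exacts [h, (hd _ h2.mem.2 h.mem.2).elim, (hd _ h2.mem.2 h.2.mem).elim]
      have h3 : A.Arc u f := by
        rcases h3 with h | h | h
        exacts [h, (hd _ h2.mem.1 h.mem.1).elim, (((hs u).1 h.1).2 _ h2).elim]
      exact .inl (ihA hT.1 h1 h2 h3)
    · have h1 : B.Arc e w := by
        rcases h1 with h | h | h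
        exacts [(hd _ h.mem.2 h2.mem.2).elim, h, (((hr w).1 h.2).2 _ h2).elim]
      have h3 : B.Arc u f := by
        rcases h3 with h | h | h
        exacts [(hd _ h.mem.1 h2.mem.1).elim, h, (hd _ h.1.mem h2.mem.1).elim]
      exact .inr (.inl (ihB hT.2.1 h1 h2 h3))
    -- Here the arc from `u` to `w` joins the two parts. Since `w` is a source of `B`, all its
    -- predecessors are sinks of `A`; since `u` is a sink of `A`, all its successors are sources of
    -- `B`. The joining arcs form a complete bipartite digraph.
    · have h1 : A.Snk e := by
        rcases h1 with h | h | h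
        exacts [(hd _ h.mem.2 h2.2.mem).elim, (((hr w).1 h2.2).2 _ h).elim, h.1]
      have h3 : B.Src f := by
        rcases h3 with h | h | h
        exacts [(((hs u).1 h2.1).2 _ h).elim, (hd _ h2.1.mem h.mem.1).elim, h.2]
      exact .inr (.inr ⟨h1, h3⟩)

/-- A topological numbering. -/
theorem exists_rank {T : SPTree} (hT : T.Nodup) :
    ∃ ρ : ℕ → ℕ, ∀ x y, T.Arc x y → ρ x < ρ y := by
  classical
  -- The additional bound on the ranks of the leaves allows the ranks in the right part of a series
  -- composition to be shifted beyond those in the left part.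
  suffices h : ∃ (ρ : ℕ → ℕ) (b : ℕ), (∀ x, T.Mem x → ρ x < b) ∧ ∀ x y, T.Arc x y → ρ x < ρ y by
    obtain ⟨ρ, b, -, h⟩ := h; exact ⟨ρ, h⟩
  induction T with
  | leaf v => exact ⟨fun _ => 0, 1, fun _ _ => one_pos, fun _ _ h => h.elim⟩
  | par A B ihA ihB =>
    obtain ⟨ρ, b, h1, h2⟩ := ihA hT.1
    obtain ⟨ρ', b', h1', h2'⟩ := ihB hT.2.1
    have hd := hT.2.2
    refine ⟨fun x => if A.Mem x then ρ x else ρ' x, max b b', ?_, ?_⟩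
    · intro x hx
      dsimp only
      split_ifs with h
      · exact (h1 x h).trans_le (le_max_left _ _)
      · exact (h1' x (hx.resolve_left h)).trans_le (le_max_right _ _)
    · rintro x y (h | h)
      · simp only [h.mem.1, h.mem.2, if_true, h2 x y h]
      · dsimp only
        rw [if_neg fun h' => hd _ h' h.mem.1, if_neg fun h' => hd _ h' h.mem.2]
        exact h2' x y h
  | ser A B ihA ihB =>
    obtain ⟨ρ, b, h1, h2⟩ := ihA hT.1
    obtain ⟨ρ', b', h1', h2'⟩ := ihB hT.2.1
    have hd := hT.2.2
    refine ⟨fun x => if A.Mem x then ρ x else b + ρ' x, b + b', ?_, ?_⟩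
    · intro x hx
      dsimp only
      split_ifs with h
      · exact (h1 x h).trans_le (Nat.le_add_right _ _)
      · exact Nat.add_lt_add_left (h1' x (hx.resolve_left h)) _
    · rintro x y (h | h | h)
      · simp only [h.mem.1, h.mem.2, if_true, h2 x y h]
      · dsimp only
        rw [if_neg fun h' => hd _ h' h.mem.1, if_neg fun h' => hd _ h' h.mem.2]
        exact Nat.add_lt_add_left (h2' x y h) _
      · dsimp only
        rw [if_pos h.1.mem, if_neg fun h' => hd _ h' h.2.mem]
        exact (h1 x h.1.mem).trans_le (Nat.le_add_right _ _)

end SPTree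

/-! ### Reductions of series-parallel expressions -/

namespace SPTree

/-- As `U` has a leaf `z`, a repetition of `f` in `T` would produce a repetition of `z` after the
substitution. -/
theorem nodup_of_subst {T : SPTree} {f : ℕ} {U : SPTree} (h : (T.subst f U).Nodup) : T.Nodup := by
  obtain ⟨z, hz⟩ := U.exists_src
  have key : ∀ A B : SPTree, (∀ x, (A.subst f U).Mem x → ¬ (B.subst f U).Mem x) →
      ∀ x, A.Mem x → ¬ B.Mem x := by
    intro A B h x hA hB
    by_cases hx : x = f
    · subst hx
      exact h z ((mem_subst _ _ _ _).2 (.inr ⟨hA, hz.mem⟩)) ((mem_subst _ _ _ _).2 (.inr ⟨hB, hz.mem⟩))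
    · exact h x ((mem_subst _ _ _ _).2 (.inl ⟨hA, hx⟩)) ((mem_subst _ _ _ _).2 (.inl ⟨hB, hx⟩))
  induction T with
  | leaf v => trivial
  | par A B ihA ihB => exact ⟨ihA h.1, ihB h.2.1, key A B h.2.2⟩
  | ser A B ihA ihB => exact ⟨ihA h.1, ihB h.2.1, key A B h.2.2⟩

/-- `e` and `f` have the same predecessors. -/
def Twin (T : SPTree) (e f : ℕ) : Prop := (∀ g, T.Arc g e ↔ T.Arc g f) ∧ (T.Src e ↔ T.Src f)

/-- `e` and `f` have the same successors. -/
def Cotwin (T : SPTree) (e f : ℕ) : Prop := (∀ g, T.Arc e g ↔ T.Arc f g) ∧ (T.Snk e ↔ T.Snk f)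

/-- A source of a series composition lies in the left part and a sink in the right part, so only
parallel nodes lie above an isolated vertex. Commutativity and associativity move it up to the root.
-/
theorem eq_leaf_or_par_of_isolated {T : SPTree} (hT : T.Nodup) {e : ℕ} (h1 : T.Src e)
    (h2 : T.Snk e) : T = leaf e ∨ ∃ B, Equiv T (par (leaf e) B) := by
  induction T with
  | leaf v => simp only [Src] at h1; subst h1; exact .inl rfl
  | par A B ihA ihB =>
    right
    rcases h1 with h1 | h1
    · have h2 := h2.resolve_right fun h => hT.2.2 _ h1.mem h.mem
      rcases ihA hT.1 h1 h2 with rfl | ⟨A', h⟩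
      · exact ⟨B, .refl _⟩
      · exact ⟨_, (h.par (.refl B)).trans (.par_assoc _ _ _)⟩
    · have h2 := h2.resolve_left fun h => hT.2.2 _ h.mem h1.mem
      rcases ihB hT.2.1 h1 h2 with rfl | ⟨A', h⟩
      · exact ⟨A, .par_comm _ _⟩
      · exact ⟨_, (Equiv.par_comm _ _).trans ((h.par (.refl A)).trans (.par_assoc _ _ _))⟩
  | ser A B ihA ihB => exact (hT.2.2 _ (Src.mem (T := A) h1) (Snk.mem (T := B) h2)).elim

/-- Two vertices with the same predecessors and the same successors can be brought together
by a rearrangement of the expression. -/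
theorem exists_subst_par {T : SPTree} (hT : T.Nodup) {e f : ℕ} (hne : e ≠ f) (he : T.Mem e)
    (hf : T.Mem f) (h1 : T.Twin e f) (h2 : T.Cotwin e f) :
    ∃ T' : SPTree, Equiv T (T'.subst f (par (leaf e) (leaf f))) ∧ ¬ T'.Mem e ∧ T'.Mem f := by
  induction T with
  | leaf v => exact (hne (he.trans hf.symm)).elim
  | par A B ihA ihB =>
    have hd := hT.2.2
    have hA : ∀ x, A.Mem x → (∀ g, ((par A B).Arc g x ↔ A.Arc g x)) ∧
        (∀ g, ((par A B).Arc x g ↔ A.Arc x g)) ∧ ((par A B).Src x ↔ A.Src x) ∧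
        ((par A B).Snk x ↔ A.Snk x) := fun x hx =>
      ⟨fun g => or_iff_left fun h => hd x hx h.mem.2, fun g => or_iff_left fun h => hd x hx h.mem.1,
        or_iff_left fun h => hd x hx h.mem, or_iff_left fun h => hd x hx h.mem⟩
    have hB : ∀ x, B.Mem x → (∀ g, ((par A B).Arc g x ↔ B.Arc g x)) ∧
        (∀ g, ((par A B).Arc x g ↔ B.Arc x g)) ∧ ((par A B).Src x ↔ B.Src x) ∧
        ((par A B).Snk x ↔ B.Snk x) := fun x hx =>
      ⟨fun g => or_iff_right fun h => hd x h.mem.2 hx,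
        fun g => or_iff_right fun h => hd x h.mem.1 hx,
        or_iff_right fun h => hd x h.mem hx, or_iff_right fun h => hd x h.mem hx⟩
    obtain ⟨h1, h3⟩ := h1
    obtain ⟨h2, h4⟩ := h2
    -- Neighbours of `e` lie in `A` and neighbours of `f` lie in `B`. Having their neighbours in
    -- common, the two vertices have none.
    have cross : ∀ e f, A.Mem e → B.Mem f → (∀ g, (par A B).Arc g e ↔ (par A B).Arc g f) →
        (∀ g, (par A B).Arc e g ↔ (par A B).Arc f g) → A.Src e ∧ A.Snk e ∧ B.Src f ∧ B.Snk f := by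
      intro e f he hf h1 h2
      simp only [(hA e he).1, (hB f hf).1] at h1
      simp only [(hA e he).2.1, (hB f hf).2.1] at h2
      have h5 : ∀ g, ¬ A.Arc g e := fun g h => hd g h.mem.1 ((h1 g).1 h).mem.1
      have h6 : ∀ g, ¬ A.Arc e g := fun g h => hd g h.mem.2 ((h2 g).1 h).mem.2
      exact ⟨(src_iff hT.1 _).2 ⟨he, h5⟩, (snk_iff hT.1 _).2 ⟨he, h6⟩,
        (src_iff hT.2.1 _).2 ⟨hf, fun g h => h5 g ((h1 g).2 h)⟩,
        (snk_iff hT.2.1 _).2 ⟨hf, fun g h => h6 g ((h2 g).2 h)⟩⟩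
    -- Both vertices are isolated, so each of them can be moved to the root of its part; then they
    -- are put side by side.
    have split : ∀ e f, A.Mem e → B.Mem f → (∀ g, (par A B).Arc g e ↔ (par A B).Arc g f) →
        (∀ g, (par A B).Arc e g ↔ (par A B).Arc f g) →
        Equiv (par A B) (par (leaf e) (leaf f)) ∨
          ∃ C, Equiv (par A B) (par C (par (leaf e) (leaf f))) := by
      intro e f he hf h1 h2
      obtain ⟨a, b, c, d⟩ := cross e f he hf h1 h2
      rcases eq_leaf_or_par_of_isolated hT.1 a b with rfl | ⟨A', hA'⟩ <;>
        rcases eq_leaf_or_par_of_isolated hT.2.1 c d with rfl | ⟨B', hB'⟩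
      · exact .inl (.refl _)
      · right
        exact ⟨B', ((Equiv.refl _).par hB').trans ((Equiv.par_assoc _ _ _).symm.trans (.par_comm _ _))⟩
      · right
        exact ⟨A', (hA'.par (.refl _)).trans <| ((Equiv.par_comm _ _).par (.refl _)).trans
          (.par_assoc _ _ _)⟩
      · right
        refine ⟨par A' B', (hA'.par hB').trans ?_⟩
        refine ((Equiv.par_comm _ _).par (.refl _)).trans ?_
        refine (Equiv.par_assoc _ _ _).trans ?_
        refine ((Equiv.refl _).par ((Equiv.par_assoc _ _ _).symm.trans (.par_comm _ _))).trans ?_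
        exact (Equiv.par_assoc _ _ _).symm
    have fin : ∀ T : SPTree, T.Nodup → (Equiv T (par (leaf e) (leaf f)) ∨
        ∃ C, Equiv T (par C (par (leaf e) (leaf f)))) →
        ∃ T' : SPTree, Equiv T (T'.subst f (par (leaf e) (leaf f))) ∧ ¬ T'.Mem e ∧ T'.Mem f := by
      rintro T hT (h | ⟨C, h⟩)
      · exact ⟨leaf f, by simpa using h, by simpa [Mem] using hne, rfl⟩
      · have hN := h.nodup.1 hT
        refine ⟨par C (leaf f), ?_, ?_, .inr rfl⟩
        · rw [subst_par, subst_leaf_self, subst_of_not_mem fun h' => hN.2.2 f h' (.inr rfl)]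
          exact h
        · rintro (h' | h')
          exacts [hN.2.2 e h' (.inl rfl), hne h']
    rcases he with he | he <;> rcases hf with hf | hf
    · have h1' := h1; have h2' := h2
      simp only [(hA e he).1, (hA f hf).1] at h1
      simp only [(hA e he).2.1, (hA f hf).2.1] at h2
      rw [(hA e he).2.2.1, (hA f hf).2.2.1] at h3
      rw [(hA e he).2.2.2, (hA f hf).2.2.2] at h4
      obtain ⟨T', a, b, c⟩ := ihA hT.1 he hf ⟨h1, h3⟩ ⟨h2, h4⟩
      refine ⟨par T' B, ?_, fun h => h.elim b (hd e he), .inl c⟩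
      rw [subst_par, subst_of_not_mem (hd f hf)]
      exact a.par (.refl _)
    · exact fin _ hT (split e f he hf h1 h2)
    · refine fin _ hT ?_
      rcases split f e hf he (fun g => (h1 g).symm) (fun g => (h2 g).symm) with h | ⟨C, h⟩
      · exact .inl (h.trans (.par_comm _ _))
      · exact .inr ⟨C, h.trans ((Equiv.refl _).par (.par_comm _ _))⟩
    · simp only [(hB e he).1, (hB f hf).1] at h1
      simp only [(hB e he).2.1, (hB f hf).2.1] at h2
      rw [(hB e he).2.2.1, (hB f hf).2.2.1] at h3
      rw [(hB e he).2.2.2, (hB f hf).2.2.2] at h4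
      obtain ⟨T', a, b, c⟩ := ihB hT.2.1 he hf ⟨h1, h3⟩ ⟨h2, h4⟩
      refine ⟨par A T', ?_, fun h => h.elim (fun h => hd e h he) b, .inr c⟩
      rw [subst_par, subst_of_not_mem (fun h => hd f h hf)]
      exact (Equiv.refl _).par a
  | ser A B ihA ihB =>
    have hd := hT.2.2
    -- Vertices on different sides of a series composition have different successors: if `e` is a
    -- sink of `A`, it precedes a source of `B`, which has no predecessor in `B`; otherwise `e` has
    -- a successor in `A`, which has no predecessor in `B` either.
    have cross : ∀ e f, A.Mem e → B.Mem f → (∀ g, (ser A B).Arc e g ↔ (ser A B).Arc f g) →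
        False := by
      intro e f he hf h
      by_cases hs : A.Snk e
      · obtain ⟨y, hy⟩ := B.exists_src
        rcases (h y).1 (.inr (.inr ⟨hs, hy⟩)) with h | h | h
        exacts [hd _ h.mem.1 hf, ((src_iff hT.2.1 _).1 hy).2 _ h, hd _ h.1.mem hf]
      · rw [snk_iff hT.1] at hs
        push Not at hs
        obtain ⟨y, hy⟩ := hs he
        rcases (h y).1 (.inl hy) with h | h | h
        exacts [hd _ h.mem.1 hf, hd _ hy.mem.2 h.mem.2, hd _ h.1.mem hf]
    rcases he with he | he <;> rcases hf with hf | hf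
    · have hA : ∀ x, A.Mem x → ∀ g, A.Mem g → (((ser A B).Arc g x ↔ A.Arc g x)) ∧
          ((ser A B).Arc x g ↔ A.Arc x g) := by
        intro x hx g hg
        have h1 : ¬ B.Mem x := hd x hx
        have h2 : ¬ B.Mem g := hd g hg
        refine ⟨or_iff_left ?_, or_iff_left ?_⟩
        · rintro (h | h)
          exacts [h1 h.mem.2, h1 h.2.mem]
        · rintro (h | h)
          exacts [h1 h.mem.1, h2 h.2.mem]
      -- The sinks of the composition are those of `B`, so the clause on sinks says nothing about
      -- `A`. It is recovered from the equality of the sets of successors inside `A`.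
      have h5 : A.Cotwin e f := by
        have key : ∀ g, A.Arc e g ↔ A.Arc f g := by
          intro g
          by_cases hg : A.Mem g
          · rw [← (hA e he g hg).2, ← (hA f hf g hg).2, h2.1 g]
          · exact iff_of_false (fun h => hg h.mem.2) (fun h => hg h.mem.2)
        refine ⟨key, ?_⟩
        simp [snk_iff hT.1, he, hf, key]
      have h6 : A.Twin e f := by
        refine ⟨fun g => ?_, h1.2⟩
        by_cases hg : A.Mem g
        · rw [← (hA e he g hg).1, ← (hA f hf g hg).1, h1.1 g]
        · exact iff_of_false (fun h => hg h.mem.1) (fun h => hg h.mem.1)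
      obtain ⟨T', a, b, c⟩ := ihA hT.1 he hf h6 h5
      refine ⟨ser T' B, ?_, fun h => h.elim b (hd e he), .inl c⟩
      rw [subst_ser, subst_of_not_mem (hd f hf)]
      exact a.ser (.refl _)
    · exact (cross e f he hf h2.1).elim
    · exact (cross f e hf he fun g => (h2.1 g).symm).elim
    · have hB : ∀ x, B.Mem x → ∀ g, B.Mem g → (((ser A B).Arc g x ↔ B.Arc g x)) ∧
          ((ser A B).Arc x g ↔ B.Arc x g) := by
        intro x hx g hg
        have h1 : ¬ A.Mem x := fun h => hd x h hx
        have h2 : ¬ A.Mem g := fun h => hd g h hg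
        constructor
        · refine ⟨?_, fun h => .inr (.inl h)⟩
          rintro (h | h | h)
          exacts [(h1 h.mem.2).elim, h, (h2 h.1.mem).elim]
        · refine ⟨?_, fun h => .inr (.inl h)⟩
          rintro (h | h | h)
          exacts [(h1 h.mem.1).elim, h, (h1 h.1.mem).elim]
      have h5 : B.Twin e f := by
        have key : ∀ g, B.Arc g e ↔ B.Arc g f := by
          intro g
          by_cases hg : B.Mem g
          · rw [← (hB e he g hg).1, ← (hB f hf g hg).1, h1.1 g]
          · exact iff_of_false (fun h => hg h.mem.1) (fun h => hg h.mem.1)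
        refine ⟨key, ?_⟩
        simp [src_iff hT.2.1, he, hf, key]
      have h6 : B.Cotwin e f := by
        refine ⟨fun g => ?_, h2.2⟩
        by_cases hg : B.Mem g
        · rw [← (hB e he g hg).2, ← (hB f hf g hg).2, h2.1 g]
        · exact iff_of_false (fun h => hg h.mem.2) (fun h => hg h.mem.2)
      obtain ⟨T', a, b, c⟩ := ihB hT.2.1 he hf h5 h6
      refine ⟨ser A T', ?_, fun h => h.elim (fun h => hd e h he) b, .inr c⟩
      rw [subst_ser, subst_of_not_mem (fun h => hd f h hf)]
      exact (Equiv.refl _).ser a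

/-- Each part of a parallel composition has a sink of its own, so a tree with a unique sink is a
leaf or a series composition whose right part again has a unique sink. Associativity moves the last
leaf up to the root. -/
theorem eq_leaf_or_ser_of_unique_snk {T : SPTree} (hT : T.Nodup) {e : ℕ}
    (h : ∀ x, T.Snk x → x = e) : T = leaf e ∨ ∃ A, Equiv T (ser A (leaf e)) := by
  induction T with
  | leaf v => have := h v rfl; subst this; exact .inl rfl
  | par A B ihA ihB =>
    obtain ⟨x, hx⟩ := A.exists_snk
    obtain ⟨y, hy⟩ := B.exists_snk
    refine (hT.2.2 e ?_ ?_).elim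
    · rw [← h x (.inl hx)]; exact hx.mem
    · rw [← h y (.inr hy)]; exact hy.mem
  | ser A B ihA ihB =>
    right
    rcases ihB hT.2.1 h with rfl | ⟨B', hB⟩
    · exact ⟨A, .refl _⟩
    · exact ⟨_, ((Equiv.refl A).ser hB).trans (Equiv.ser_assoc _ _ _).symm⟩

theorem eq_leaf_or_ser_of_unique_src {T : SPTree} (hT : T.Nodup) {e : ℕ}
    (h : ∀ x, T.Src x → x = e) : T = leaf e ∨ ∃ B, Equiv T (ser (leaf e) B) := by
  induction T with
  | leaf v => have := h v rfl; subst this; exact .inl rfl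
  | par A B ihA ihB =>
    obtain ⟨x, hx⟩ := A.exists_src
    obtain ⟨y, hy⟩ := B.exists_src
    refine (hT.2.2 e ?_ ?_).elim
    · rw [← h x (.inl hx)]; exact hx.mem
    · rw [← h y (.inr hy)]; exact hy.mem
  | ser A B ihA ihB =>
    right
    rcases ihA hT.1 h with rfl | ⟨A', hA⟩
    · exact ⟨B, .refl _⟩
    · exact ⟨_, (hA.ser (Equiv.refl B)).trans (Equiv.ser_assoc _ _ _)⟩

/-- If `f` is the only successor of `e` and `e` is the only predecessor of `f`, then the two
can be brought together by a rearrangement of the expression. -/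
theorem exists_subst_ser {T : SPTree} (hT : T.Nodup) {e f : ℕ} (h : T.Arc e f)
    (h1 : ∀ g, T.Arc e g → g = f) (h2 : ∀ g, T.Arc g f → g = e) :
    ∃ T' : SPTree, Equiv T (T'.subst f (ser (leaf e) (leaf f))) ∧ ¬ T'.Mem e ∧ T'.Mem f := by
  induction T with
  | leaf v => exact h.elim
  | par A B ihA ihB =>
    have hd := hT.2.2
    rcases h with h | h
    · obtain ⟨T', a, b, c⟩ := ihA hT.1 h (fun g hg => h1 g (.inl hg)) (fun g hg => h2 g (.inl hg))
      refine ⟨par T' B, ?_, fun h' => h'.elim b (hd e h.mem.1), .inl c⟩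
      rw [subst_par, subst_of_not_mem (hd f h.mem.2)]
      exact a.par (.refl _)
    · obtain ⟨T', a, b, c⟩ := ihB hT.2.1 h (fun g hg => h1 g (.inr hg)) (fun g hg => h2 g (.inr hg))
      refine ⟨par A T', ?_, fun h' => h'.elim (fun h' => hd e h' h.mem.1) b, .inr c⟩
      rw [subst_par, subst_of_not_mem (fun h' => hd f h' h.mem.2)]
      exact (Equiv.refl _).par a
  | ser A B ihA ihB =>
    have hd := hT.2.2
    rcases h with h | h | h
    · obtain ⟨T', a, b, c⟩ := ihA hT.1 h (fun g hg => h1 g (.inl hg)) (fun g hg => h2 g (.inl hg))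
      refine ⟨ser T' B, ?_, fun h' => h'.elim b (hd e h.mem.1), .inl c⟩
      rw [subst_ser, subst_of_not_mem (hd f h.mem.2)]
      exact a.ser (.refl _)
    · obtain ⟨T', a, b, c⟩ := ihB hT.2.1 h (fun g hg => h1 g (.inr (.inl hg)))
        (fun g hg => h2 g (.inr (.inl hg)))
      refine ⟨ser A T', ?_, fun h' => h'.elim (fun h' => hd e h' h.mem.1) b, .inr c⟩
      rw [subst_ser, subst_of_not_mem (fun h' => hd f h' h.mem.2)]
      exact (Equiv.refl _).ser a
    · have hne : e ≠ f := fun h' => hd e h.1.mem (h' ▸ h.2.mem)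
      -- The arc joins the two parts. Every sink of `A` precedes `f` and every source of `B`
      -- succeeds `e`, so `e` is the only sink of `A` and `f` is the only source of `B`.
      have hA := eq_leaf_or_ser_of_unique_snk hT.1 (e := e)
        fun x hx => h2 x (.inr (.inr ⟨hx, h.2⟩))
      have hB := eq_leaf_or_ser_of_unique_src hT.2.1 (e := f)
        fun x hx => h1 x (.inr (.inr ⟨h.1, hx⟩))
      have hfA : ∀ A', Equiv A (ser A' (leaf e)) → ¬ A'.Mem f ∧ ¬ A'.Mem e := fun A' hA' =>
        ⟨fun h' => hd f ((hA'.mem f).2 (.inl h')) h.2.mem,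
          fun h' => (hA'.nodup.1 hT.1).2.2 e h' rfl⟩
      have hfB : ∀ B', Equiv B (ser (leaf f) B') → ¬ B'.Mem f ∧ ¬ B'.Mem e := fun B' hB' =>
        ⟨fun h' => (hB'.nodup.1 hT.2.1).2.2 f rfl h',
          fun h' => hd e h.1.mem ((hB'.mem e).2 (.inr h'))⟩
      rcases hA with rfl | ⟨A', hA⟩ <;> rcases hB with rfl | ⟨B', hB⟩
      · exact ⟨leaf f, by simpa using Equiv.refl _, hne, rfl⟩
      · obtain ⟨a, b⟩ := hfB B' hB
        refine ⟨ser (leaf f) B', ?_, fun h => h.elim hne b, .inl rfl⟩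
        rw [subst_ser, subst_leaf_self, subst_of_not_mem a]
        exact ((Equiv.refl _).ser hB).trans (Equiv.ser_assoc _ _ _).symm
      · obtain ⟨a, b⟩ := hfA A' hA
        refine ⟨ser A' (leaf f), ?_, fun h => h.elim b hne, .inr rfl⟩
        rw [subst_ser, subst_leaf_self, subst_of_not_mem a]
        exact (hA.ser (.refl _)).trans (Equiv.ser_assoc _ _ _)
      · obtain ⟨a, b⟩ := hfA A' hA
        obtain ⟨a', b'⟩ := hfB B' hB
        refine ⟨ser A' (ser (leaf f) B'), ?_, fun h => h.elim b fun h => h.elim hne b',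
          .inr (.inl rfl)⟩
        rw [subst_ser, subst_ser, subst_leaf_self, subst_of_not_mem a, subst_of_not_mem a']
        exact (hA.ser hB).trans ((Equiv.ser_assoc _ _ _).trans
          ((Equiv.refl _).ser (Equiv.ser_assoc _ _ _).symm))

/-! ### Existence of reductions -/

/-- An expression with more than one leaf admits a reduction at its sinks. -/
theorem exists_reducible_snk {T : SPTree} (hT : T.Nodup) :
    (∃ v, T = leaf v) ∨ (∃ e f, e ≠ f ∧ T.Snk e ∧ T.Snk f ∧ T.Twin e f) ∨
      ∃ e h, T.Snk e ∧ T.Arc h e ∧ ∀ g, T.Arc h g → g = e := by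
  induction T with
  | leaf v => exact .inl ⟨v, rfl⟩
  | par A B ihA ihB =>
    right
    have hd := hT.2.2
    rcases ihA hT.1 with ⟨v, rfl⟩ | ⟨e, f, a, b, c, d⟩ | ⟨e, h, a, b, c⟩
    · rcases ihB hT.2.1 with ⟨v', rfl⟩ | ⟨e, f, a, b, c, d⟩ | ⟨e, h, a, b, c⟩
      · refine .inl ⟨v, v', fun h => hd v rfl h, .inl rfl, .inr rfl, ?_⟩
        simp [Twin, Arc, Src]
      · refine .inl ⟨e, f, a, .inr b, .inr c, ?_, ?_⟩
        · intro g
          simp only [Arc, false_or, d.1]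
        · have h1 : e ≠ v := fun h => hd v rfl (h ▸ b.mem)
          have h2 : f ≠ v := fun h => hd v rfl (h ▸ c.mem)
          simp only [Src, h1, h2, false_or, d.2]
      · exact .inr ⟨e, h, .inr a, .inr b, fun g hg => c g (hg.resolve_left id)⟩
    · refine .inl ⟨e, f, a, .inl b, .inl c, ?_, ?_⟩
      · intro g
        have h1 : ¬ B.Arc g e := fun h => hd _ b.mem h.mem.2
        have h2 : ¬ B.Arc g f := fun h => hd _ c.mem h.mem.2
        simp only [Arc, d.1, h1, h2]
      · have h1 : ¬ B.Src e := fun h => hd _ b.mem h.mem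
        have h2 : ¬ B.Src f := fun h => hd _ c.mem h.mem
        simp only [Src, h1, h2, d.2]
    · exact .inr ⟨e, h, .inl a, .inl b, fun g hg => c g (hg.resolve_right fun h' =>
        hd _ b.mem.1 h'.mem.1)⟩
  | ser A B ihA ihB =>
    right
    have hd := hT.2.2
    rcases ihB hT.2.1 with ⟨v, rfl⟩ | ⟨e, f, a, b, c, d⟩ | ⟨e, h, a, b, c⟩
    -- If the right part is a single vertex, then it is the only successor of any sink of the left
    -- part.
    · obtain ⟨x, hx⟩ := A.exists_snk
      refine .inr ⟨v, x, rfl, .inr (.inr ⟨hx, rfl⟩), ?_⟩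
      rintro g (h | h | h)
      exacts [(((snk_iff hT.1 _).1 hx).2 _ h).elim, h.elim, h.2]
    · refine .inl ⟨e, f, a, b, c, ?_, ?_⟩
      · intro g
        have h1 : ¬ A.Arc g e := fun h => hd _ h.mem.2 b.mem
        have h2 : ¬ A.Arc g f := fun h => hd _ h.mem.2 c.mem
        simp only [Arc, d.1, d.2, h1, h2]
      · exact iff_of_false (fun h => hd _ (Src.mem (T := A) h) b.mem)
          (fun h => hd _ (Src.mem (T := A) h) c.mem)
    · refine .inr ⟨e, h, a, .inr (.inl b), ?_⟩
      rintro g (h' | h' | h')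
      exacts [(hd _ h'.mem.1 b.mem.1).elim, c g h', (hd _ h'.1.mem b.mem.1).elim]

/-- If two vertices have the same successors, then a reduction is possible
among the vertices with these successors. -/
theorem exists_reducible {T : SPTree} (hT : T.Nodup) {e f : ℕ} (hne : e ≠ f) (he : T.Mem e)
    (hf : T.Mem f) (hc : T.Cotwin e f) :
    (∃ e' f', e' ≠ f' ∧ T.Mem e' ∧ T.Mem f' ∧ T.Cotwin e e' ∧ T.Cotwin e f' ∧ T.Twin e' f') ∨
      ∃ e' h, T.Mem e' ∧ T.Cotwin e e' ∧ T.Arc h e' ∧ ∀ g, T.Arc h g → g = e' := by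
  -- All sinks have the same, empty, set of successors. For a sink `e` any reduction at the sinks is
  -- thus of the required kind.
  by_cases hs : T.Snk e
  · have key : ∀ x, T.Snk x → T.Cotwin e x := fun x hx =>
      ⟨fun g => iff_of_false (((snk_iff hT _).1 hs).2 g) (((snk_iff hT _).1 hx).2 g),
        iff_of_true hs hx⟩
    rcases exists_reducible_snk hT with ⟨v, rfl⟩ | ⟨e, f, a, b, c, d⟩ | ⟨e, h, a, b, c⟩
    · exact (hne (he.trans hf.symm)).elim
    · exact .inl ⟨e, f, a, b.mem, c.mem, key _ b, key _ c, d⟩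
    · exact .inr ⟨e, h, a.mem, key _ a, b, c⟩
  induction T generalizing e f with
  | leaf v => exact (hs he).elim
  | par A B ihA ihB =>
    have hd := hT.2.2
    obtain ⟨y, hy⟩ : ∃ y, (par A B).Arc e y := by
      rw [snk_iff hT] at hs; push Not at hs; exact hs he
    rcases hy with hy | hy
    · have hA : ∀ x, A.Mem x → (∀ g, ((par A B).Arc g x ↔ A.Arc g x)) ∧
          (∀ g, ((par A B).Arc x g ↔ A.Arc x g)) ∧ ((par A B).Src x ↔ A.Src x) ∧
          ((par A B).Snk x ↔ A.Snk x) := fun x hx =>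
        ⟨fun g => or_iff_left fun h => hd x hx h.mem.2,
          fun g => or_iff_left fun h => hd x hx h.mem.1,
          or_iff_left fun h => hd x hx h.mem, or_iff_left fun h => hd x hx h.mem⟩
      have he := hy.mem.1
      have hf : A.Mem f := by
        rcases (hc.1 y).1 (.inl hy) with h | h
        exacts [h.mem.1, (hd _ hy.mem.2 h.mem.2).elim]
      have co : ∀ x x', A.Mem x → A.Mem x' → ((par A B).Cotwin x x' ↔ A.Cotwin x x') := by
        intro x x' h h'
        simp only [Cotwin, (hA x h).2, (hA x' h').2]
      have tw : ∀ x x', A.Mem x → A.Mem x' → ((par A B).Twin x x' ↔ A.Twin x x') := by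
        intro x x' h h'
        simp only [Twin, (hA x h).1, (hA x h).2.2.1, (hA x' h').1, (hA x' h').2.2.1]
      rcases ihA hT.1 hne he hf ((co _ _ he hf).1 hc) (fun h => hs (.inl h)) with
        ⟨e', f', a, b, c, d, g, h⟩ | ⟨e', h, a, b, c, d⟩
      · exact .inl ⟨e', f', a, .inl b, .inl c, (co _ _ he b).2 d, (co _ _ he c).2 g,
          (tw _ _ b c).2 h⟩
      · exact .inr ⟨e', h, .inl a, (co _ _ he a).2 b, .inl c,
          fun g hg => d g (((hA h c.mem.1).2.1 g).1 hg)⟩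
    · have hB : ∀ x, B.Mem x → (∀ g, ((par A B).Arc g x ↔ B.Arc g x)) ∧
          (∀ g, ((par A B).Arc x g ↔ B.Arc x g)) ∧ ((par A B).Src x ↔ B.Src x) ∧
          ((par A B).Snk x ↔ B.Snk x) := fun x hx =>
        ⟨fun g => or_iff_right fun h => hd x h.mem.2 hx,
          fun g => or_iff_right fun h => hd x h.mem.1 hx,
          or_iff_right fun h => hd x h.mem hx, or_iff_right fun h => hd x h.mem hx⟩
      have he := hy.mem.1
      have hf : B.Mem f := by
        rcases (hc.1 y).1 (.inr hy) with h | h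
        exacts [(hd _ h.mem.2 hy.mem.2).elim, h.mem.1]
      have co : ∀ x x', B.Mem x → B.Mem x' → ((par A B).Cotwin x x' ↔ B.Cotwin x x') := by
        intro x x' h h'
        simp only [Cotwin, (hB x h).2, (hB x' h').2]
      have tw : ∀ x x', B.Mem x → B.Mem x' → ((par A B).Twin x x' ↔ B.Twin x x') := by
        intro x x' h h'
        simp only [Twin, (hB x h).1, (hB x h).2.2.1, (hB x' h').1, (hB x' h').2.2.1]
      rcases ihB hT.2.1 hne he hf ((co _ _ he hf).1 hc) (fun h => hs (.inr h)) with
        ⟨e', f', a, b, c, d, g, h⟩ | ⟨e', h, a, b, c, d⟩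
      · exact .inl ⟨e', f', a, .inr b, .inr c, (co _ _ he b).2 d, (co _ _ he c).2 g,
          (tw _ _ b c).2 h⟩
      · exact .inr ⟨e', h, .inr a, (co _ _ he a).2 b, .inr c,
          fun g hg => d g (((hB h c.mem.1).2.1 g).1 hg)⟩
  | ser A B ihA ihB =>
    have hd := hT.2.2
    obtain ⟨y, hy⟩ : ∃ y, (ser A B).Arc e y := by
      rw [snk_iff hT] at hs; push Not at hs; exact hs he
    have hnA : ∀ x, A.Mem x → ¬ (ser A B).Snk x := fun x hx h => hd x hx (Snk.mem (T := B) h)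
    have inA : ∀ x, A.Mem x → ∀ g, (ser A B).Arc x g ↔ A.Arc x g ∨ A.Snk x ∧ B.Src g := by
      intro x hx g
      refine or_congr_right (or_iff_right fun h => hd _ hx h.mem.1)
    have twA : ∀ x x', A.Mem x → A.Mem x' → A.Twin x x' → (ser A B).Twin x x' := by
      intro x x' h h' ht
      have h1 : ∀ g, ¬ B.Arc g x := fun g h1 => hd _ h h1.mem.2
      have h2 : ∀ g, ¬ B.Arc g x' := fun g h1 => hd _ h' h1.mem.2
      have h3 : ¬ B.Src x := fun h1 => hd _ h h1.mem
      have h4 : ¬ B.Src x' := fun h1 => hd _ h' h1.mem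
      exact ⟨fun g => by simp only [Arc, ht.1, h1, h2, h3, h4], ht.2⟩
    rcases hy with hy | hy | hy
    · have he := hy.mem.1
      have hsA : ¬ A.Snk e := fun h => ((snk_iff hT.1 _).1 h).2 y hy
      have hf' : A.Arc f y := by
        rcases (hc.1 y).1 (.inl hy) with h | h | h
        exacts [h, (hd _ hy.mem.2 h.mem.2).elim, (hd _ hy.mem.2 h.2.mem).elim]
      have hf := hf'.mem.1
      have hsf : ¬ A.Snk f := fun h => ((snk_iff hT.1 _).1 h).2 y hf'
      have hcA : A.Cotwin e f := by
        refine ⟨fun g => ?_, iff_of_false hsA hsf⟩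
        have := hc.1 g
        rw [inA e he, inA f hf] at this
        simpa [hsA, hsf] using this
      have co : ∀ x, A.Mem x → A.Cotwin e x → (ser A B).Cotwin e x := by
        intro x hx h
        refine ⟨fun g => ?_, iff_of_false (hnA _ he) (hnA _ hx)⟩
        rw [inA e he, inA x hx, h.1, h.2]
      rcases ihA hT.1 hne he hf hcA hsA with
        ⟨e', f', a, b, c, d, g, h⟩ | ⟨e', h, a, b, c, d⟩
      · exact .inl ⟨e', f', a, .inl b, .inl c, co _ b d, co _ c g, twA _ _ b c h⟩
      · refine .inr ⟨e', h, .inl a, co _ a b, .inl c, fun g hg => ?_⟩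
        rcases (inA h c.mem.1 g).1 hg with h' | h'
        exacts [d g h', (((snk_iff hT.1 _).1 h'.1).2 _ c).elim]
    · have inB : ∀ x, B.Mem x → ∀ g, (ser A B).Arc x g ↔ B.Arc x g := by
        intro x hx g
        refine (or_iff_right fun h => hd _ h.mem.1 hx).trans (or_iff_left fun h => hd _ h.1.mem hx)
      have he := hy.mem.1
      have hf : B.Mem f := by
        rcases (hc.1 y).1 (.inr (.inl hy)) with h | h | h
        exacts [(hd _ h.mem.2 hy.mem.2).elim, h.mem.1, (((src_iff hT.2.1 _).1 h.2).2 _ hy).elim]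
      have co : ∀ x, B.Mem x → ((ser A B).Cotwin e x ↔ B.Cotwin e x) := by
        intro x hx
        simp only [Cotwin, inB e he, inB x hx, Snk]
      rcases ihB hT.2.1 hne he hf ((co _ hf).1 hc) hs with
        ⟨e', f', a, b, c, d, g, h⟩ | ⟨e', h, a, b, c, d⟩
      · refine .inl ⟨e', f', a, .inr b, .inr c, (co _ b).2 d, (co _ c).2 g, fun z => ?_, ?_⟩
        · have h1 : ¬ A.Arc z e' := fun h => hd _ h.mem.2 b
          have h2 : ¬ A.Arc z f' := fun h => hd _ h.mem.2 c
          simp only [Arc, h1, h2, h.1, h.2]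
        · exact iff_of_false (fun h => hd _ (Src.mem (T := A) h) b)
            (fun h => hd _ (Src.mem (T := A) h) c)
      · exact .inr ⟨e', h, .inr a, (co _ a).2 b, .inr (.inl c),
          fun g hg => d g ((inB h c.mem.1 g).1 hg)⟩
    -- The successors of `e` are the sources of `B`, and these are the successors of every sink of
    -- `A`. A reduction at the sinks of `A` is what is needed; it exists because `A` has the two
    -- different leaves `e` and `f`.
    · have hse := hy.1
      have hsf : A.Snk f := by
        rcases (hc.1 y).1 (.inr (.inr hy)) with h | h | h
        exacts [(hd _ h.mem.2 hy.2.mem).elim, (((src_iff hT.2.1 _).1 hy.2).2 _ h).elim, h.1]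
      have co : ∀ x, A.Snk x → (ser A B).Cotwin e x := by
        intro x hx
        refine ⟨fun g => ?_, iff_of_false (hnA _ hse.mem) (hnA _ hx.mem)⟩
        rw [inA e hse.mem, inA x hx.mem]
        simp only [hse, hx, iff_false_intro (((snk_iff hT.1 _).1 hse).2 g),
          iff_false_intro (((snk_iff hT.1 _).1 hx).2 g)]
      rcases exists_reducible_snk hT.1 with ⟨v, rfl⟩ | ⟨e', f', a, b, c, d⟩ | ⟨e', h, a, b, c⟩
      · exact (hne (hse.trans hsf.symm)).elim
      · exact .inl ⟨e', f', a, .inl b.mem, .inl c.mem, co _ b, co _ c, twA _ _ b.mem c.mem d⟩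
      · refine .inr ⟨e', h, .inl a.mem, co _ a, .inl b, fun g hg => ?_⟩
        rcases (inA h b.mem.1 g).1 hg with h' | h'
        exacts [c g h', (((snk_iff hT.1 _).1 h'.1).2 _ b).elim]

end SPTree

/-! ### Feasible sets of series-parallel expressions -/

namespace SPTree

/-- The set of all leaves. -/
def leaves : SPTree → Finset ℕ
  | leaf v => {v}
  | par A B => A.leaves ∪ B.leaves
  | ser A B => A.leaves ∪ B.leaves

theorem mem_leaves {T : SPTree} {x : ℕ} : x ∈ T.leaves ↔ T.Mem x := by
  induction T <;> simp_all [leaves, Mem]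

/-- The weak digraph constraint. -/
def Closed (T : SPTree) (A : Finset ℕ) : Prop :=
  ∀ y, (∃ x, T.Arc x y) → (∀ x, T.Arc x y → x ∈ A) → y ∈ A

theorem closed_congr {T : SPTree} {A B : Finset ℕ} (h : ∀ x, T.Mem x → (x ∈ A ↔ x ∈ B)) :
    T.Closed A ↔ T.Closed B := by
  suffices key : ∀ A B : Finset ℕ, (∀ x, T.Mem x → (x ∈ A ↔ x ∈ B)) → T.Closed A → T.Closed B from
    ⟨key A B h, key B A fun x hx => (h x hx).symm⟩
  intro A B h hA y hy hB
  obtain ⟨z, hz⟩ := hy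
  exact (h y hz.mem.2).1 (hA y ⟨z, hz⟩ fun x hx => (h x hx.mem.1).2 (hB x hx))

theorem closed_par {P Q : SPTree} (h : (par P Q).Nodup) (A : Finset ℕ) :
    (par P Q).Closed A ↔ P.Closed A ∧ Q.Closed A := by
  have hd := h.2.2
  constructor
  · intro hc
    constructor
    · rintro y ⟨z, hz⟩ h
      exact hc y ⟨z, .inl hz⟩ fun x hx => h x (hx.resolve_right fun h' => hd _ hz.mem.2 h'.mem.2)
    · rintro y ⟨z, hz⟩ h
      exact hc y ⟨z, .inr hz⟩ fun x hx => h x (hx.resolve_left fun h' => hd _ h'.mem.2 hz.mem.2)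
  · rintro ⟨h1, h2⟩ y ⟨z, hz | hz⟩ h
    · exact h1 y ⟨z, hz⟩ fun x hx => h x (.inl hx)
    · exact h2 y ⟨z, hz⟩ fun x hx => h x (.inr hx)

/-- Only the sources of `Q` have other predecessors than before, namely all sinks of `P`. These
exist, so the condition that there is a predecessor holds for all sources of `Q`. -/
theorem closed_ser {P Q : SPTree} (h : (ser P Q).Nodup) (A : Finset ℕ) :
    (ser P Q).Closed A ↔ P.Closed A ∧ Q.Closed A ∧
      ((∀ x, P.Snk x → x ∈ A) → ∀ x, Q.Src x → x ∈ A) := by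
  have hd := h.2.2
  constructor
  · intro hc
    refine ⟨?_, ?_, ?_⟩
    · rintro y ⟨z, hz⟩ h
      refine hc y ⟨z, .inl hz⟩ fun x hx => h x ?_
      rcases hx with h' | h' | h'
      exacts [h', (hd _ hz.mem.2 h'.mem.2).elim, (hd _ hz.mem.2 h'.2.mem).elim]
    · rintro y ⟨z, hz⟩ h'
      refine hc y ⟨z, .inr (.inl hz)⟩ fun x hx => h' x ?_
      rcases hx with h' | h' | h'
      exacts [(hd _ h'.mem.2 hz.mem.2).elim, h', (((src_iff h.2.1 _).1 h'.2).2 _ hz).elim]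
    · intro hs y hy
      obtain ⟨z, hz⟩ := P.exists_snk
      refine hc y ⟨z, .inr (.inr ⟨hz, hy⟩)⟩ fun x hx => ?_
      rcases hx with h' | h' | h'
      exacts [(hd _ h'.mem.2 hy.mem).elim, (((src_iff h.2.1 _).1 hy).2 _ h').elim, hs x h'.1]
  · rintro ⟨h1, h2, h3⟩ y ⟨z, hz | hz | hz⟩ h
    · exact h1 y ⟨z, hz⟩ fun x hx => h x (.inl hx)
    · exact h2 y ⟨z, hz⟩ fun x hx => h x (.inr (.inl hx))
    · exact h3 (fun x hx => h x (.inr (.inr ⟨hx, hz.2⟩))) y hz.2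

/-- Membership spreads along the arcs: in a series composition a full left part contains all its
sinks, which forces the sources of the right part. As a consequence, a set that contains all sinks
of the left part of a series composition contains the whole right part. -/
theorem Closed.mem_of_src {T : SPTree} (hT : T.Nodup) {A : Finset ℕ} (h : T.Closed A)
    (hs : ∀ x, T.Src x → x ∈ A) : ∀ x, T.Mem x → x ∈ A := by
  induction T with
  | leaf v => exact hs
  | par P Q ihP ihQ =>
    rw [closed_par hT] at h
    rintro x (hx | hx)
    · exact ihP hT.1 h.1 (fun x hx => hs x (.inl hx)) x hx
    · exact ihQ hT.2.1 h.2 (fun x hx => hs x (.inr hx)) x hx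
  | ser P Q ihP ihQ =>
    rw [closed_ser hT] at h
    have hP := ihP hT.1 h.1 hs
    have hQ := ihQ hT.2.1 h.2.1 (h.2.2 fun x hx => hP x hx.mem)
    rintro x (hx | hx)
    exacts [hP x hx, hQ x hx]

/-- `Good T A b`: the set `A` of leaves satisfies the weak digraph constraint,
and `b` tells whether it contains all sinks. -/
def Good : SPTree → Finset ℕ → Bool → Prop
  | leaf v, A, b => A = ∅ ∧ b = false ∨ A = {v} ∧ b = true
  | par P Q, A, b => ∃ A₁ A₂ b₁ b₂, P.Good A₁ b₁ ∧ Q.Good A₂ b₂ ∧ A = A₁ ∪ A₂ ∧ b = (b₁ && b₂)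
  | ser P Q, A, b => ∃ A₁ A₂ b₁, P.Good A₁ b₁ ∧ Q.Good A₂ b ∧ A = A₁ ∪ A₂ ∧
      (b₁ = true → A₂ = Q.leaves)

/-- The recursion in `Good` is the one that the dynamic program follows. At a series node the
constraint between the two parts asks only for the sources of `Q`, while `Good` asks for all leaves
of `Q`; `Closed.mem_of_src` closes this gap. The bit is determined by the set, so the existential
bits are supplied by deciding whether all sinks are in. -/
theorem good_iff {T : SPTree} (hT : T.Nodup) (A : Finset ℕ) (b : Bool) :
    T.Good A b ↔ A ⊆ T.leaves ∧ T.Closed A ∧ (b = true ↔ ∀ x, T.Snk x → x ∈ A) := by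
  classical
  induction T generalizing A b with
  | leaf v =>
    simp only [Good, leaves, Closed, Arc, Snk, forall_eq, Finset.subset_singleton_iff]
    constructor
    · rintro (⟨rfl, rfl⟩ | ⟨rfl, rfl⟩) <;> simp
    · rintro ⟨rfl | rfl, -, h⟩
      · left; simpa using h
      · right; simpa using h
  | par P Q ihP ihQ =>
    have hd := hT.2.2
    simp only [Good, ihP hT.1, ihQ hT.2.1, closed_par hT]
    constructor
    · rintro ⟨A₁, A₂, b₁, b₂, ⟨a1, a2, a3⟩, ⟨c1, c2, c3⟩, rfl, rfl⟩
      have e1 : ∀ x, P.Mem x → (x ∈ A₁ ∪ A₂ ↔ x ∈ A₁) := fun x hx => by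
        rw [Finset.mem_union]; exact or_iff_left fun h => hd x hx (mem_leaves.1 (c1 h))
      have e2 : ∀ x, Q.Mem x → (x ∈ A₁ ∪ A₂ ↔ x ∈ A₂) := fun x hx => by
        rw [Finset.mem_union]; exact or_iff_right fun h => hd x (mem_leaves.1 (a1 h)) hx
      refine ⟨Finset.union_subset_union a1 c1, ⟨(closed_congr e1).2 a2, (closed_congr e2).2 c2⟩, ?_⟩
      rw [Bool.and_eq_true, a3, c3]
      constructor
      · rintro ⟨h1, h2⟩ x (hx | hx)
        exacts [(e1 x hx.mem).2 (h1 x hx), (e2 x hx.mem).2 (h2 x hx)]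
      · exact fun h => ⟨fun x hx => (e1 x hx.mem).1 (h x (.inl hx)),
          fun x hx => (e2 x hx.mem).1 (h x (.inr hx))⟩
    · rintro ⟨h1, ⟨h2, h3⟩, h4⟩
      have e1 : ∀ x, P.Mem x → (x ∈ A ∩ P.leaves ↔ x ∈ A) := fun x hx => by
        simp [mem_leaves, hx]
      have e2 : ∀ x, Q.Mem x → (x ∈ A ∩ Q.leaves ↔ x ∈ A) := fun x hx => by
        simp [mem_leaves, hx]
      refine ⟨A ∩ P.leaves, A ∩ Q.leaves, decide (∀ x, P.Snk x → x ∈ A ∩ P.leaves),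
        decide (∀ x, Q.Snk x → x ∈ A ∩ Q.leaves),
        ⟨Finset.inter_subset_right, (closed_congr e1).2 h2, by simp⟩,
        ⟨Finset.inter_subset_right, (closed_congr e2).2 h3, by simp⟩, ?_, ?_⟩
      · rw [← Finset.inter_union_distrib_left]; exact (Finset.inter_eq_left.2 h1).symm
      · rw [Bool.eq_iff_iff, h4, Bool.and_eq_true, decide_eq_true_iff, decide_eq_true_iff]
        constructor
        · exact fun h => ⟨fun x hx => (e1 x hx.mem).2 (h x (.inl hx)),
            fun x hx => (e2 x hx.mem).2 (h x (.inr hx))⟩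
        · rintro ⟨h1, h2⟩ x (hx | hx)
          exacts [(e1 x hx.mem).1 (h1 x hx), (e2 x hx.mem).1 (h2 x hx)]
  | ser P Q ihP ihQ =>
    have hd := hT.2.2
    simp only [Good, ihP hT.1, ihQ hT.2.1, closed_ser hT]
    constructor
    · rintro ⟨A₁, A₂, b₁, ⟨a1, a2, a3⟩, ⟨c1, c2, c3⟩, rfl, h⟩
      have e1 : ∀ x, P.Mem x → (x ∈ A₁ ∪ A₂ ↔ x ∈ A₁) := fun x hx => by
        rw [Finset.mem_union]; exact or_iff_left fun h => hd x hx (mem_leaves.1 (c1 h))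
      have e2 : ∀ x, Q.Mem x → (x ∈ A₁ ∪ A₂ ↔ x ∈ A₂) := fun x hx => by
        rw [Finset.mem_union]; exact or_iff_right fun h => hd x (mem_leaves.1 (a1 h)) hx
      refine ⟨Finset.union_subset_union a1 c1,
        ⟨(closed_congr e1).2 a2, (closed_congr e2).2 c2, ?_⟩, ?_⟩
      · intro h5 x hx
        have := h (a3.2 fun x hx => (e1 x hx.mem).1 (h5 x hx))
        rw [e2 x hx.mem, this, mem_leaves]
        exact hx.mem
      · rw [c3]
        exact forall₂_congr fun x hx => (e2 x (Snk.mem (T := Q) hx)).symm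
    · rintro ⟨h1, ⟨h2, h3, h5⟩, h4⟩
      have e1 : ∀ x, P.Mem x → (x ∈ A ∩ P.leaves ↔ x ∈ A) := fun x hx => by
        simp [mem_leaves, hx]
      have e2 : ∀ x, Q.Mem x → (x ∈ A ∩ Q.leaves ↔ x ∈ A) := fun x hx => by
        simp [mem_leaves, hx]
      refine ⟨A ∩ P.leaves, A ∩ Q.leaves, decide (∀ x, P.Snk x → x ∈ A ∩ P.leaves),
        ⟨Finset.inter_subset_right, (closed_congr e1).2 h2, by simp⟩,
        ⟨Finset.inter_subset_right, (closed_congr e2).2 h3, ?_⟩, ?_, ?_⟩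
      · rw [h4]
        exact forall₂_congr fun x hx => (e2 x (Snk.mem (T := Q) hx)).symm
      · rw [← Finset.inter_union_distrib_left]; exact (Finset.inter_eq_left.2 h1).symm
      · rw [decide_eq_true_iff]
        intro h6
        have h7 := h5 fun x hx => (e1 x hx.mem).1 (h6 x hx)
        exact Finset.inter_eq_right.2 fun x hx => h3.mem_of_src hT.2.1 h7 x (mem_leaves.1 hx)

end SPTree

/-! ### Trees for minimal series-parallel digraphs -/

/-- The tree records the construction of the digraph. That sinks and sources agree, one kind being
defined by the recursion and the other by degrees, is `snk_iff` and `src_iff`. -/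
theorem FinDigraph.IsMSP.exists_tree {n : ℕ} {G : FinDigraph (Fin n)} (h : G.IsMSP) :
    ∃ T : SPTree, T.Nodup ∧ (∀ x : Fin n, T.Mem x ↔ x ∈ G.verts) ∧ (∀ v, T.Mem v → v < n) ∧
      ∀ x y : Fin n, T.Arc x y ↔ (x, y) ∈ G.arcs := by
  induction h with
  | single v =>
    refine ⟨.leaf v, trivial, fun x => ?_, ?_, fun x y => ?_⟩
    · simp [SPTree.Mem, FinDigraph.single, Fin.ext_iff]
    · rintro _ rfl; exact v.2
    · simp [SPTree.Arc, FinDigraph.single]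
  | @parallel G₁ G₂ _ _ hd ih₁ ih₂ =>
    obtain ⟨A, a1, a2, a3, a4⟩ := ih₁
    obtain ⟨B, b1, b2, b3, b4⟩ := ih₂
    refine ⟨.par A B, ⟨a1, b1, fun v hA hB => ?_⟩, fun x => ?_, ?_, fun x y => ?_⟩
    · exact Finset.disjoint_left.1 hd ((a2 ⟨v, a3 v hA⟩).1 hA) ((b2 ⟨v, a3 v hA⟩).1 hB)
    · simp [SPTree.Mem, FinDigraph.parallel, a2, b2]
    · rintro v (h | h)
      exacts [a3 v h, b3 v h]
    · simp [SPTree.Arc, FinDigraph.parallel, a4, b4]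
  | @series G₁ G₂ _ _ hd ih₁ ih₂ =>
    obtain ⟨A, a1, a2, a3, a4⟩ := ih₁
    obtain ⟨B, b1, b2, b3, b4⟩ := ih₂
    refine ⟨.ser A B, ⟨a1, b1, fun v hA hB => ?_⟩, fun x => ?_, ?_, fun x y => ?_⟩
    · exact Finset.disjoint_left.1 hd ((a2 ⟨v, a3 v hA⟩).1 hA) ((b2 ⟨v, a3 v hA⟩).1 hB)
    · simp [SPTree.Mem, FinDigraph.series, a2, b2]
    · rintro v (h | h)
      exacts [a3 v h, b3 v h]
    · have h1 : A.Snk x ↔ x ∈ G₁.sinks := by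
        rw [SPTree.snk_iff a1, a2]
        simp only [sinks, succs, Finset.mem_filter, Finset.card_eq_zero, Finset.filter_eq_empty_iff]
        refine and_congr_right fun _ => ⟨fun h w _ h' => h w ((a4 _ _).2 h'), fun h w h' => ?_⟩
        have := (a4 x ⟨w, a3 _ h'.mem.2⟩).1 h'
        exact h (G₁.snd_mem _ this) this
      have h2 : B.Src y ↔ y ∈ G₂.sources := by
        rw [SPTree.src_iff b1, b2]
        simp only [sources, preds, Finset.mem_filter, Finset.card_eq_zero,
          Finset.filter_eq_empty_iff]
        refine and_congr_right fun _ => ⟨fun h w _ h' => h w ((b4 _ _).2 h'), fun h w h' => ?_⟩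
        have := (b4 ⟨w, b3 _ h'.mem.1⟩ y).1 h'
        exact h (G₂.fst_mem _ this) this
      simp [SPTree.Arc, FinDigraph.series, a4, b4, h1, h2]

/-! ### Trees in arrays -/

/-- The node `i` of the forest that is stored in the arrays is the root of the tree `T`. -/
def Decodes (n cnt : ℕ) (typ lc rc : ℕ → ℕ) : ℕ → SPTree → Prop
  | i, .leaf v => i = v ∧ v < n
  | i, .par A B => n ≤ i ∧ i < cnt ∧ typ i = 0 ∧
      Decodes n cnt typ lc rc (lc i) A ∧ Decodes n cnt typ lc rc (rc i) B
  | i, .ser A B => n ≤ i ∧ i < cnt ∧ typ i ≠ 0 ∧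
      Decodes n cnt typ lc rc (lc i) A ∧ Decodes n cnt typ lc rc (rc i) B

/-- The inner nodes that are reached have numbers below `cnt`, so writing to cell `cnt` does not
affect them. -/
theorem Decodes.update {n cnt : ℕ} {typ lc rc : ℕ → ℕ} {i : ℕ} {T : SPTree}
    (h : Decodes n cnt typ lc rc i T) (a b d : ℕ) :
    Decodes n (cnt + 1) (Function.update typ cnt a) (Function.update lc cnt b)
      (Function.update rc cnt d) i T := by
  induction T generalizing i with
  | leaf v => exact h
  | par A B ihA ihB =>
    obtain ⟨h1, h2, h3, h4, h5⟩ := h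
    refine ⟨h1, by omega, ?_, ?_, ?_⟩ <;> rw [Function.update_of_ne h2.ne]
    exacts [h3, ihA h4, ihB h5]
  | ser A B ihA ihB =>
    obtain ⟨h1, h2, h3, h4, h5⟩ := h
    refine ⟨h1, by omega, ?_, ?_, ?_⟩ <;> rw [Function.update_of_ne h2.ne]
    exacts [h3, ihA h4, ihB h5]

/-! ### The dynamic program -/

/-- A number `p < 2 * (c + 1)` stands for the pair of the bit `p / (c + 1)` and the
amount `p % (c + 1)`. This is the bit. -/
def bit (c p : ℕ) : ℕ := if c < p then 1 else 0

/-- The amount that belongs to `p`. -/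
def amount (c p : ℕ) : ℕ := p - bit c p * (c + 1)

theorem amount_le {c p : ℕ} (h : p < 2 * (c + 1)) : amount c p ≤ c := by
  unfold amount bit; split_ifs <;> omega

theorem bit_code (c : ℕ) (b : Bool) {s : ℕ} (h : s ≤ c) : bit c (b.toNat * (c + 1) + s) = b.toNat := by
  unfold bit; cases b <;> simp <;> omega

theorem amount_code (c : ℕ) (b : Bool) {s : ℕ} (h : s ≤ c) :
    amount c (b.toNat * (c + 1) + s) = s := by
  unfold amount; rw [bit_code c b h]; omega

/-- `p` is the combination of `p₁` and `p₂` at a node of type `ty` (`0` for parallel, otherwise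
series) whose right subtree has the total `t`. -/
def Combines (c ty t p₁ p₂ p : ℕ) : Prop :=
  amount c p₁ + amount c p₂ ≤ c ∧
    (ty = 0 → p = bit c p₁ * bit c p₂ * (c + 1) + (amount c p₁ + amount c p₂)) ∧
    (ty ≠ 0 → (bit c p₁ = 0 ∨ p₂ = c + 1 + t) ∧
      p = bit c p₂ * (c + 1) + (amount c p₁ + amount c p₂))

/-- The arrays hold a complete table of the dynamic program. -/
structure IsTable (n cnt c : ℕ) (sz typ lc rc tot : ℕ → ℕ) (D X Y : ℕ → ℕ → ℕ) : Prop where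
  tot_leaf : ∀ j < n, tot j = min (sz j) (c + 1)
  tot_node : ∀ i, n ≤ i → i < cnt → tot i = min (tot (lc i) + tot (rc i)) (c + 1)
  leaf : ∀ j < n, ∀ p < 2 * (c + 1), D j p ≠ 0 ↔ p = 0 ∨ sz j ≤ c ∧ p = c + 1 + sz j
  sound : ∀ i, n ≤ i → i < cnt → ∀ p < 2 * (c + 1), D i p ≠ 0 →
    X i p < 2 * (c + 1) ∧ Y i p < 2 * (c + 1) ∧ D (lc i) (X i p) ≠ 0 ∧ D (rc i) (Y i p) ≠ 0 ∧
      Combines c (typ i) (tot (rc i)) (X i p) (Y i p) p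
  complete : ∀ i, n ≤ i → i < cnt → ∀ p₁ < 2 * (c + 1), ∀ p₂ < 2 * (c + 1),
    D (lc i) p₁ ≠ 0 → D (rc i) p₂ ≠ 0 → ∀ p, Combines c (typ i) (tot (rc i)) p₁ p₂ p → D i p ≠ 0

namespace IsTable

variable {n cnt c : ℕ} {sz typ lc rc tot : ℕ → ℕ} {D X Y : ℕ → ℕ → ℕ}

theorem disjoint_leaves {P Q : SPTree} (hd : ∀ x, P.Mem x → ¬ Q.Mem x) :
    Disjoint P.leaves Q.leaves :=
  Finset.disjoint_left.2 fun x hx hx' => hd x (SPTree.mem_leaves.1 hx) (SPTree.mem_leaves.1 hx')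

/-- Truncation at c + 1 is compatible with addition. A total above c is recorded as c + 1, which no
amount reaches, so the test whether a selection is the whole subtree is not affected by the
truncation. -/
theorem tot_eq (h : IsTable n cnt c sz typ lc rc tot D X Y) {i : ℕ} {T : SPTree}
    (hi : Decodes n cnt typ lc rc i T) (hT : T.Nodup) :
    tot i = min (∑ j ∈ T.leaves, sz j) (c + 1) := by
  induction T generalizing i with
  | leaf v => obtain ⟨rfl, hv⟩ := hi; simpa [SPTree.leaves] using h.tot_leaf i hv
  | par P Q ihP ihQ =>
    obtain ⟨h1, h2, h3, h4, h5⟩ := hi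
    rw [h.tot_node i h1 h2, ihP h4 hT.1, ihQ h5 hT.2.1, SPTree.leaves,
      Finset.sum_union (disjoint_leaves hT.2.2)]
    omega
  | ser P Q ihP ihQ =>
    obtain ⟨h1, h2, h3, h4, h5⟩ := hi
    rw [h.tot_node i h1 h2, ihP h4 hT.1, ihQ h5 hT.2.1, SPTree.leaves,
      Finset.sum_union (disjoint_leaves hT.2.2)]
    omega

theorem filter_union {P Q : SPTree} (sel : ℕ → ℕ) :
    (P.leaves ∪ Q.leaves).filter (sel · ≠ 0) =
      P.leaves.filter (sel · ≠ 0) ∪ Q.leaves.filter (sel · ≠ 0) := Finset.filter_union _ _ _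

/-- Following the stored witnesses from a nonzero entry down to the leaves gives a set that realises
the entry. An item is chosen if the code at its leaf is not 0: code 0 stands for the empty set, and
the code of the chosen item is at least c + 1. -/
theorem good_of_ne_zero (h : IsTable n cnt c sz typ lc rc tot D X Y) (hsz : ∀ j < n, 0 < sz j)
    {sel : ℕ → ℕ}
    (hsel : ∀ i, n ≤ i → i < cnt → sel (lc i) = X i (sel i) ∧ sel (rc i) = Y i (sel i))
    {i : ℕ} {T : SPTree} (hi : Decodes n cnt typ lc rc i T) (hT : T.Nodup)
    (hlt : ∀ v, T.Mem v → v < n)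
    (hp : sel i < 2 * (c + 1)) (hD : D i (sel i) ≠ 0) :
    T.Good (T.leaves.filter (sel · ≠ 0)) (decide (bit c (sel i) = 1)) ∧
      ∑ j ∈ T.leaves.filter (sel · ≠ 0), sz j = amount c (sel i) := by
  induction T generalizing i with
  | leaf v =>
    obtain ⟨rfl, hv⟩ := hi
    rcases (h.leaf i hv _ hp).1 hD with h0 | ⟨h1, h2⟩
    · simp [SPTree.Good, SPTree.leaves, h0, Finset.filter_singleton, bit, amount]
    · have h3 : sel i ≠ 0 := by omega
      have h4 : bit c (sel i) = 1 := by unfold bit; rw [if_pos (by omega)]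
      have h5 : amount c (sel i) = sz i := by unfold amount; rw [h4, h2]; omega
      simp [SPTree.Good, SPTree.leaves, h3, Finset.filter_singleton, h4, h5]
  | par P Q ihP ihQ =>
    obtain ⟨h1, h2, h3, h4, h5⟩ := hi
    obtain ⟨a, b, d, e, f⟩ := h.sound i h1 h2 _ hp hD
    obtain ⟨s1, s2⟩ := hsel i h1 h2
    rw [← s1] at a d f
    rw [← s2] at b e f
    obtain ⟨g1, t1⟩ := ihP h4 hT.1 (fun v hv => hlt v (.inl hv)) a d
    obtain ⟨g2, t2⟩ := ihQ h5 hT.2.1 (fun v hv => hlt v (.inr hv)) b e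
    obtain ⟨f1, f2, -⟩ := f
    have f2 := f2 h3
    generalize sel (lc i) = x at *
    generalize sel (rc i) = y at *
    have hb : bit c (sel i) = bit c x * bit c y ∧
        amount c (sel i) = amount c x + amount c y := by
      unfold amount bit at *
      by_cases c1 : c < x <;> by_cases c2 : c < y <;> simp only [c1, c2, if_true, if_false] at * <;>
        split_ifs <;> omega
    constructor
    · refine ⟨_, _, _, _, g1, g2, filter_union sel, ?_⟩
      rw [hb.1, ← Bool.decide_and, decide_eq_decide]
      unfold bit
      split_ifs <;> simp
    · rw [SPTree.leaves, filter_union, Finset.sum_union, t1, t2, hb.2]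
      exact Finset.disjoint_filter_filter (disjoint_leaves hT.2.2)
  | ser P Q ihP ihQ =>
    obtain ⟨h1, h2, h3, h4, h5⟩ := hi
    obtain ⟨a, b, d, e, f⟩ := h.sound i h1 h2 _ hp hD
    obtain ⟨s1, s2⟩ := hsel i h1 h2
    rw [← s1] at a d f
    rw [← s2] at b e f
    obtain ⟨g1, t1⟩ := ihP h4 hT.1 (fun v hv => hlt v (.inl hv)) a d
    obtain ⟨g2, t2⟩ := ihQ h5 hT.2.1 (fun v hv => hlt v (.inr hv)) b e
    obtain ⟨f1, -, f2⟩ := f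
    have f2 := f2 h3
    have ht := h.tot_eq h5 hT.2.1
    generalize sel (lc i) = x at *
    generalize sel (rc i) = y at *
    have hb : bit c (sel i) = bit c y ∧ amount c (sel i) = amount c x + amount c y := by
      unfold amount bit at *
      by_cases c1 : c < x <;> by_cases c2 : c < y <;> simp only [c1, c2, if_true, if_false] at * <;>
        split_ifs <;> omega
    constructor
    · rw [hb.1]
      refine ⟨_, _, _, g1, g2, filter_union sel, fun hx => ?_⟩
      rw [decide_eq_true_iff] at hx
      have hy : y = c + 1 + tot (rc i) := by rcases f2.1 with f2 | f2 <;> omega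
      have hy1 : bit c y = 1 := by unfold bit; rw [if_pos (by omega)]
      have hy2 : amount c y = tot (rc i) := by unfold amount; rw [hy1]; omega
      -- The code `y` is below 2(c + 1), so the recorded total of `Q` is at most c and hence exact.
      -- The selection in `Q` has the size of all of `Q`; as sizes are positive, no leaf of `Q` can
      -- be missing.
      have hs : ∑ j ∈ Q.leaves.filter (sel · ≠ 0), sz j = ∑ j ∈ Q.leaves, sz j := by
        rw [t2]; omega
      refine Finset.filter_true_of_mem fun v hv => ?_
      by_contra h0
      have : ∑ j ∈ Q.leaves.filter (sel · ≠ 0), sz j < ∑ j ∈ Q.leaves, sz j :=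
        Finset.sum_lt_sum_of_subset (Finset.filter_subset _ _) hv (fun h' => (Finset.mem_filter.1 h').2 h0)
          (hsz v (hlt v (.inr (SPTree.mem_leaves.1 hv)))) (fun _ _ _ => Nat.zero_le _)
      omega
    · rw [SPTree.leaves, filter_union, Finset.sum_union, t1, t2, hb.2]
      exact Finset.disjoint_filter_filter (disjoint_leaves hT.2.2)

/-- The converse direction: no feasible selection is overlooked. The parts of a selection of size at
most c have size at most c as well, so their codes occur in the rows of the children. -/
theorem ne_zero_of_good (h : IsTable n cnt c sz typ lc rc tot D X Y)
    {i : ℕ} {T : SPTree} (hi : Decodes n cnt typ lc rc i T) (hT : T.Nodup) {A : Finset ℕ} {b : Bool}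
    (hA : T.Good A b) (hc : ∑ j ∈ A, sz j ≤ c) : D i (b.toNat * (c + 1) + ∑ j ∈ A, sz j) ≠ 0 := by
  have lt : ∀ (b : Bool) {s}, s ≤ c → b.toNat * (c + 1) + s < 2 * (c + 1) := by
    intro b s hs; cases b <;> simp <;> omega
  induction T generalizing i A b with
  | leaf v =>
    obtain ⟨rfl, hv⟩ := hi
    rw [h.leaf i hv _ (lt b hc)]
    rcases hA with ⟨rfl, rfl⟩ | ⟨rfl, rfl⟩
    · simp
    · right; simpa using hc
  | par P Q ihP ihQ =>
    obtain ⟨h1, h2, h3, h4, h5⟩ := hi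
    obtain ⟨A₁, A₂, b₁, b₂, g1, g2, rfl, rfl⟩ := hA
    have hdis : Disjoint A₁ A₂ := (disjoint_leaves hT.2.2).mono
      ((SPTree.good_iff hT.1 _ _).1 g1).1 ((SPTree.good_iff hT.2.1 _ _).1 g2).1
    rw [Finset.sum_union hdis] at hc ⊢
    have d1 := ihP h4 hT.1 g1 (by omega)
    have d2 := ihQ h5 hT.2.1 g2 (by omega)
    refine h.complete i h1 h2 _ (lt _ (by omega)) _ (lt _ (by omega)) d1 d2 _ ⟨?_, fun _ => ?_, ?_⟩
    · rw [amount_code _ _ (by omega), amount_code _ _ (by omega)]; exact hc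
    · rw [amount_code _ _ (by omega), amount_code _ _ (by omega), bit_code _ _ (by omega),
        bit_code _ _ (by omega)]
      cases b₁ <;> cases b₂ <;> rfl
    · exact fun h => (h h3).elim
  | ser P Q ihP ihQ =>
    obtain ⟨h1, h2, h3, h4, h5⟩ := hi
    obtain ⟨A₁, A₂, b₁, g1, g2, rfl, hb⟩ := hA
    have hdis : Disjoint A₁ A₂ := (disjoint_leaves hT.2.2).mono
      ((SPTree.good_iff hT.1 _ _).1 g1).1 ((SPTree.good_iff hT.2.1 _ _).1 g2).1
    rw [Finset.sum_union hdis] at hc ⊢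
    have d1 := ihP h4 hT.1 g1 (by omega)
    have d2 := ihQ h5 hT.2.1 g2 (by omega)
    refine h.complete i h1 h2 _ (lt _ (by omega)) _ (lt _ (by omega)) d1 d2 _
      ⟨?_, fun h => (h3 h).elim, fun _ => ⟨?_, ?_⟩⟩
    · rw [amount_code _ _ (by omega), amount_code _ _ (by omega)]; exact hc
    · rw [bit_code _ _ (by omega)]
      cases b₁
      · exact .inl rfl
      · right
        have hA := hb rfl
        -- With all leaves of `Q` its sinks are in, so the code of the right part is c + 1 plus the
        -- total, as the series rule demands.
        have hb : b = true := ((SPTree.good_iff hT.2.1 _ _).1 g2).2.2.2 fun x hx =>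
          hA ▸ SPTree.mem_leaves.2 hx.mem
        have ht := h.tot_eq h5 hT.2.1
        rw [← hA] at ht
        rw [hb, ht, min_eq_left (by omega), Bool.toNat_true, one_mul]
    · rw [amount_code _ _ (by omega), amount_code _ _ (by omega), bit_code _ _ (by omega)]

/-- A best entry at the root leads to an optimal solution. -/
theorem isOptimal {I : SSGWInstance} {T : SPTree} (hT : T.Nodup) (hm : ∀ v, T.Mem v ↔ v < I.n)
    (ha : ∀ x y : Fin I.n, T.Arc x y ↔ (x, y) ∈ I.graph.arcs) (hs : ∀ j : Fin I.n, sz j = I.size j)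
    (h : IsTable I.n cnt I.c sz typ lc rc tot D X Y) {root : ℕ}
    (hr : Decodes I.n cnt typ lc rc root T) {sel : ℕ → ℕ}
    (hsel : ∀ i, I.n ≤ i → i < cnt → sel (lc i) = X i (sel i) ∧ sel (rc i) = Y i (sel i))
    (hp : sel root < 2 * (I.c + 1)) (hD : D root (sel root) ≠ 0)
    (hbest : ∀ p < 2 * (I.c + 1), D root p ≠ 0 → amount I.c p ≤ amount I.c (sel root)) :
    I.IsOptimal (Finset.univ.filter fun j : Fin I.n => sel j ≠ 0) := by
  have htot : ∀ A : Finset (Fin I.n), ∑ j ∈ A.map Fin.valEmbedding, sz j = I.total A := by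
    intro A
    simp [SSGWInstance.total, hs]
  have hcl : ∀ A : Finset (Fin I.n), T.Closed (A.map Fin.valEmbedding) ↔
      ∀ y, I.graph.preds y ⊆ A ∧ (I.graph.preds y).Nonempty → y ∈ A := by
    intro A
    have mp : ∀ x y : Fin I.n, x ∈ I.graph.preds y ↔ T.Arc x y := by
      intro x y
      simp [FinDigraph.preds, ha, I.verts_eq]
    constructor
    · rintro h y ⟨h1, x, hx⟩
      have := h y ⟨x, (mp x y).1 hx⟩ fun z hz => by
        have hz' := (hm z).1 hz.mem.1
        exact Finset.mem_map.2 ⟨⟨z, hz'⟩, h1 ((mp ⟨z, hz'⟩ y).2 hz), rfl⟩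
      obtain ⟨w, hw, hw'⟩ := Finset.mem_map.1 this
      rwa [Fin.ext hw'] at hw
    · rintro h y ⟨x, hx⟩ h1
      have hy := (hm y).1 hx.mem.2
      have hx' := (hm x).1 hx.mem.1
      refine Finset.mem_map.2 ⟨⟨y, hy⟩, h _ ⟨fun z hz => ?_, ⟨x, hx'⟩, (mp _ _).2 hx⟩, rfl⟩
      obtain ⟨w, hw, hw'⟩ := Finset.mem_map.1 (h1 z ((mp z ⟨y, hy⟩).1 hz))
      rwa [Fin.ext hw'] at hw
  have hsol : T.leaves.filter (sel · ≠ 0) =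
      (Finset.univ.filter fun j : Fin I.n => sel j ≠ 0).map Fin.valEmbedding := by
    ext v
    simp only [Finset.mem_filter, SPTree.mem_leaves, hm, Finset.mem_map, Finset.mem_univ, true_and,
      Fin.valEmbedding_apply]
    exact ⟨fun ⟨a, b⟩ => ⟨⟨v, a⟩, b, rfl⟩, by rintro ⟨w, a, rfl⟩; exact ⟨w.2, a⟩⟩
  obtain ⟨g, t⟩ := h.good_of_ne_zero (fun j hj => (hs ⟨j, hj⟩).symm ▸ I.size_pos _) hsel hr hT
    (fun v hv => (hm v).1 hv) hp hD
  rw [hsol] at g t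
  rw [htot] at t
  refine ⟨⟨t.trans_le (amount_le hp), (hcl _).1 ((SPTree.good_iff hT _ _).1 g).2.1⟩, ?_⟩
  rintro B ⟨hB1, hB2⟩
  classical
  have hgood : T.Good (B.map Fin.valEmbedding)
      (decide (∀ x, T.Snk x → x ∈ B.map Fin.valEmbedding)) := by
    refine (SPTree.good_iff hT _ _).2 ⟨fun v hv => ?_, (hcl B).2 hB2, by simp⟩
    obtain ⟨w, -, rfl⟩ := Finset.mem_map.1 hv
    exact SPTree.mem_leaves.2 ((hm _).2 w.2)
  have hne := h.ne_zero_of_good hr hT hgood (by rwa [htot])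
  rw [htot] at hne
  have := hbest _ (by
    generalize decide (∀ x, T.Snk x → x ∈ B.map Fin.valEmbedding) = b
    cases b <;> simp <;> omega) hne
  rwa [amount_code _ _ hB1, ← t] at this

end IsTable

/-! ### Reductions of the root multigraph -/

namespace SPTree

theorem of_equiv_subst_par {T T' : SPTree} {e f : ℕ} (hT : T.Nodup)
    (h : Equiv T (T'.subst f (par (leaf e) (leaf f)))) (he : ¬ T'.Mem e) (hf : T'.Mem f) :
    T'.Nodup ∧ (∀ x, T'.Mem x ↔ T.Mem x ∧ x ≠ e) ∧
      (∀ x y, x ≠ e → y ≠ e → (T'.Arc x y ↔ T.Arc x y)) ∧ (∀ x, x ≠ e → (T'.Src x ↔ T.Src x)) ∧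
      (∀ x, x ≠ e → (T'.Snk x ↔ T.Snk x)) ∧ T.size = T'.size + 1 := by
  have hT' := nodup_of_subst (h.nodup.1 hT)
  have hs := size_subst hT' hf (par (leaf e) (leaf f))
  rw [← h.size_eq] at hs
  refine ⟨hT', fun x => ?_, fun x y hx hy => ?_, fun x hx => ?_, fun x hx => ?_, ?_⟩
  · rw [h.mem, mem_subst]; simp only [Mem]
    have : x = e → ¬ T'.Mem x := by rintro rfl; exact he
    have : x = f → T'.Mem x := by rintro rfl; exact hf
    tauto
  · rw [h.arc, arc_subst hT']; simp only [Src, Snk, Arc, hx, hy]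
    by_cases h1 : x = f <;> by_cases h2 : y = f <;> simp [h1, h2, arc_irrefl hT']
  · rw [h.src, src_subst]; simp only [Src, hx]
    by_cases h1 : x = f <;> simp [h1]
  · rw [h.snk, snk_subst]; simp only [Snk, hx]
    by_cases h1 : x = f <;> simp [h1]
  · simp only [size] at hs; omega

/-- The leaf `f` of `T'` stands for the pair of `e` followed by `f`: it inherits the predecessors of
`e` and keeps its own successors. In the multigraph this means that the tail of `f` moves to the
tail of `e`. -/
theorem of_equiv_subst_ser {T T' : SPTree} {e f : ℕ} (hT : T.Nodup)
    (h : Equiv T (T'.subst f (ser (leaf e) (leaf f)))) (he : ¬ T'.Mem e) (hf : T'.Mem f) :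
    T'.Nodup ∧ (∀ x, T'.Mem x ↔ T.Mem x ∧ x ≠ e) ∧
      (∀ x y, x ≠ e → y ≠ e → y ≠ f → (T'.Arc x y ↔ T.Arc x y)) ∧
      (∀ x, x ≠ e → (T'.Arc x f ↔ T.Arc x e)) ∧
      (∀ x, x ≠ e → x ≠ f → (T'.Src x ↔ T.Src x)) ∧ (T'.Src f ↔ T.Src e) ∧
      (∀ x, x ≠ e → (T'.Snk x ↔ T.Snk x)) ∧ T.size = T'.size + 1 := by
  have hT' := nodup_of_subst (h.nodup.1 hT)
  have hne : f ≠ e := by rintro rfl; exact he hf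
  have hs := size_subst hT' hf (ser (leaf e) (leaf f))
  rw [← h.size_eq] at hs
  have he1 : ¬ T'.Src e := fun h => he h.mem
  have he2 : ∀ x, ¬ T'.Arc x e := fun x h => he h.mem.2
  refine ⟨hT', fun x => ?_, fun x y hx hy hy' => ?_, fun x hx => ?_, fun x hx hx' => ?_, ?_,
    fun x hx => ?_, ?_⟩
  · rw [h.mem, mem_subst]; simp only [Mem]
    have : x = e → ¬ T'.Mem x := by rintro rfl; exact he
    have : x = f → T'.Mem x := by rintro rfl; exact hf
    tauto
  · rw [h.arc, arc_subst hT']; simp only [Src, Snk, Arc, hx, hy]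
    by_cases h1 : x = f <;> simp [h1, hy']
  · rw [h.arc, arc_subst hT']; simp only [Src, Snk, Arc, hx]
    by_cases h1 : x = f <;> simp [h1, hne.symm, he2, arc_irrefl hT']
  · rw [h.src, src_subst]; simp [Src, hx, hx']
  · rw [h.src, src_subst]; simp [Src, he1]
  · rw [h.snk, snk_subst]; simp only [Snk]
    by_cases h1 : x = f <;> simp [h1]
  · simp only [size] at hs; omega

end SPTree

open SPTree

/-- The leaves of `T` are the edges of a multigraph in which the edge `e` leads from the node
`tl e` to the node `hd e`, and the arcs of `T` are the pairs of consecutive edges. The source of the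
multigraph is `n + 1`, its sink is `0`. -/
structure Encodes (n : ℕ) (hd tl : ℕ → ℕ) (T : SPTree) : Prop where
  nodup : T.Nodup
  lt : ∀ e, T.Mem e → e < n
  arc : ∀ e f, T.Mem e → T.Mem f → (T.Arc e f ↔ hd e = tl f)
  snk : ∀ e, T.Mem e → (T.Snk e ↔ hd e = 0)
  src : ∀ e, T.Mem e → (T.Src e ↔ tl e = n + 1)

namespace Encodes

variable {n : ℕ} {hd tl : ℕ → ℕ} {T : SPTree}

/-- A common predecessor `y` forces both tails to be the head of `y`; without predecessors both
tails are the source n + 1. -/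
theorem twin (h : Encodes n hd tl T) {e f : ℕ} (he : T.Mem e) (hf : T.Mem f) :
    T.Twin e f ↔ tl e = tl f := by
  constructor
  · rintro ⟨h1, h2⟩
    by_cases hs : T.Src e
    · rw [(h.src e he).1 hs, (h.src f hf).1 (h2.1 hs)]
    · rw [src_iff h.nodup] at hs
      push Not at hs
      obtain ⟨y, hy⟩ := hs he
      rw [← (h.arc y e hy.mem.1 he).1 hy, ← (h.arc y f hy.mem.1 hf).1 ((h1 y).1 hy)]
  · intro h1
    refine ⟨fun g => ?_, by rw [h.src e he, h.src f hf, h1]⟩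
    by_cases hg : T.Mem g
    · rw [h.arc g e hg he, h.arc g f hg hf, h1]
    · exact iff_of_false (fun h => hg h.mem.1) (fun h => hg h.mem.1)

theorem cotwin (h : Encodes n hd tl T) {e f : ℕ} (he : T.Mem e) (hf : T.Mem f) :
    T.Cotwin e f ↔ hd e = hd f := by
  constructor
  · rintro ⟨h1, h2⟩
    by_cases hs : T.Snk e
    · rw [(h.snk e he).1 hs, (h.snk f hf).1 (h2.1 hs)]
    · rw [snk_iff h.nodup] at hs
      push Not at hs
      obtain ⟨y, hy⟩ := hs he
      rw [(h.arc e y he hy.mem.2).1 hy, (h.arc f y hf hy.mem.2).1 ((h1 y).1 hy)]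
  · intro h1
    refine ⟨fun g => ?_, by rw [h.snk e he, h.snk f hf, h1]⟩
    by_cases hg : T.Mem g
    · rw [h.arc e g he hg, h.arc f g hf hg, h1]
    · exact iff_of_false (fun h => hg h.mem.2) (fun h => hg h.mem.2)

theorem hd_ne_tl (h : Encodes n hd tl T) {e : ℕ} (he : T.Mem e) : hd e ≠ tl e := fun h' =>
  arc_irrefl h.nodup e ((h.arc e e he he).2 h')

/-- Every node other than the source that has an outgoing edge has an incoming edge. -/
theorem exists_hd_eq (h : Encodes n hd tl T) {f : ℕ} (hf : T.Mem f) (hs : tl f ≠ n + 1) :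
    ∃ g, T.Mem g ∧ hd g = tl f := by
  rw [ne_eq, ← h.src f hf, src_iff h.nodup] at hs
  push Not at hs
  obtain ⟨y, hy⟩ := hs hf
  exact ⟨y, hy.mem.1, (h.arc y f hy.mem.1 hf).1 hy⟩

/-- Every node other than the sink that has an incoming edge has an outgoing edge. -/
theorem exists_tl_eq (h : Encodes n hd tl T) {f : ℕ} (hf : T.Mem f) (hs : hd f ≠ 0) :
    ∃ g, T.Mem g ∧ tl g = hd f := by
  rw [ne_eq, ← h.snk f hf, snk_iff h.nodup] at hs
  push Not at hs
  obtain ⟨y, hy⟩ := hs hf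
  exact ⟨y, hy.mem.2, ((h.arc f y hf hy.mem.2).1 hy).symm⟩

/-- Series reduction. -/
theorem series (h : Encodes n hd tl T) {f g : ℕ} (hf : T.Mem f) (hg : T.Mem g)
    (hgf : hd g = tl f) (h1 : ∀ a, T.Mem a → tl a = tl f → a = f)
    (h2 : ∀ a, T.Mem a → hd a = tl f → a = g) :
    ∃ T' : SPTree, Equiv T (T'.subst f (ser (leaf g) (leaf f))) ∧
      (∀ x, T'.Mem x ↔ T.Mem x ∧ x ≠ g) ∧ T.size = T'.size + 1 ∧
      Encodes n hd (Function.update tl f (tl g)) T' := by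
  have ha : T.Arc g f := (h.arc g f hg hf).2 hgf
  obtain ⟨T', a, b, c⟩ := exists_subst_ser h.nodup ha
    (fun x hx => h1 x hx.mem.2 (((h.arc _ _ hg hx.mem.2).1 hx).symm.trans hgf))
    (fun x hx => h2 x hx.mem.1 ((h.arc _ _ hx.mem.1 hf).1 hx))
  obtain ⟨d1, d2, d3, d4, d5, d6, d7, d8⟩ := of_equiv_subst_ser h.nodup a b c
  refine ⟨T', a, d2, d8, d1, fun e he => h.lt e ((d2 e).1 he).1, fun x y hx hy => ?_,
    fun x hx => ?_, fun x hx => ?_⟩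
  · obtain ⟨hx, hx'⟩ := (d2 x).1 hx
    obtain ⟨hy, hy'⟩ := (d2 y).1 hy
    by_cases hyf : y = f
    · subst hyf
      rw [d4 x hx', h.arc x g hx hg, Function.update_self]
    · rw [d3 x y hx' hy' hyf, Function.update_of_ne hyf, h.arc x y hx hy]
  · obtain ⟨hx, hx'⟩ := (d2 x).1 hx
    rw [d7 x hx', h.snk x hx]
  · obtain ⟨hx, hx'⟩ := (d2 x).1 hx
    by_cases hxf : x = f
    · subst hxf
      rw [d6, h.src g hg, Function.update_self]
    · rw [d5 x hx' hxf, h.src x hx, Function.update_of_ne hxf]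

/-- Parallel reduction. -/
theorem parallel (h : Encodes n hd tl T) {e f : ℕ} (hne : e ≠ f) (he : T.Mem e) (hf : T.Mem f)
    (h1 : hd e = hd f) (h2 : tl e = tl f) :
    ∃ T' : SPTree, Equiv T (T'.subst f (par (leaf e) (leaf f))) ∧
      (∀ x, T'.Mem x ↔ T.Mem x ∧ x ≠ e) ∧ T.size = T'.size + 1 ∧ Encodes n hd tl T' := by
  obtain ⟨T', a, b, c⟩ := exists_subst_par h.nodup hne he hf ((h.twin he hf).2 h2)
    ((h.cotwin he hf).2 h1)
  obtain ⟨d1, d2, d3, d4, d5, d6⟩ := of_equiv_subst_par h.nodup a b c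
  refine ⟨T', a, d2, d6, d1, fun e he => h.lt e ((d2 e).1 he).1, fun x y hx hy => ?_,
    fun x hx => ?_, fun x hx => ?_⟩
  · obtain ⟨hx, hx'⟩ := (d2 x).1 hx
    obtain ⟨hy, hy'⟩ := (d2 y).1 hy
    rw [d3 x y hx' hy', h.arc x y hx hy]
  · obtain ⟨hx, hx'⟩ := (d2 x).1 hx
    rw [d5 x hx', h.snk x hx]
  · obtain ⟨hx, hx'⟩ := (d2 x).1 hx
    rw [d4 x hx', h.src x hx]

/-- A node with two incoming edges has two parallel incoming edges or an incoming edge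
that is the only edge out of its tail. -/
theorem exists_reducible (h : Encodes n hd tl T) {e f : ℕ} (hne : e ≠ f) (he : T.Mem e)
    (hf : T.Mem f) (hh : hd e = hd f) :
    (∃ e' f', e' ≠ f' ∧ T.Mem e' ∧ T.Mem f' ∧ hd e' = hd e ∧ hd f' = hd e ∧ tl e' = tl f') ∨
      ∃ e', T.Mem e' ∧ hd e' = hd e ∧ tl e' ≠ n + 1 ∧ ∀ a, T.Mem a → tl a = tl e' → a = e' := by
  rcases SPTree.exists_reducible h.nodup hne he hf ((h.cotwin he hf).2 hh) with
    ⟨e', f', a, b, c, d, k, l⟩ | ⟨e', z, a, b, c, d⟩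
  · exact .inl ⟨e', f', a, b, c, ((h.cotwin he b).1 d).symm, ((h.cotwin he c).1 k).symm,
      (h.twin b c).1 l⟩
  · refine .inr ⟨e', a, ((h.cotwin he a).1 b).symm, fun h' => ?_, fun x hx hx' => ?_⟩
    · exact ((src_iff h.nodup _).1 ((h.src _ a).2 h')).2 z c
    · refine d x ((h.arc z x c.mem.1 hx).2 ?_)
      rw [hx', (h.arc z e' c.mem.1 a).1 c]

/-- The end of the reduction. -/
theorem eq_leaf (h : Encodes n hd tl T) {e : ℕ} (h1 : ∀ a, T.Mem a → hd a = 0 → a = e)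
    (h2 : tl e = n + 1 ∨ ∃ a, T.Mem a ∧ tl a = tl e ∧ a ≠ e) : T = leaf e := by
  -- A tree with more than one leaf would have two sinks, which `h1` excludes, or a vertex whose
  -- only successor is the sink `e`. In the latter case `e` has a predecessor and is the only edge
  -- out of its tail, contrary to `h2`.
  rcases exists_reducible_snk h.nodup with ⟨v, rfl⟩ | ⟨a, b, hab, ha, hb, -⟩ | ⟨a, z, ha, hz, hu⟩
  · rw [h1 v rfl ((h.snk v rfl).1 rfl)]
  · exact (hab ((h1 a ha.mem ((h.snk a ha.mem).1 ha)).trans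
      (h1 b hb.mem ((h.snk b hb.mem).1 hb)).symm)).elim
  · obtain rfl := h1 a ha.mem ((h.snk a ha.mem).1 ha)
    have hz' := (h.arc z a hz.mem.1 hz.mem.2).1 hz
    rcases h2 with h2 | ⟨b, hb, hb', hne⟩
    · exact (((src_iff h.nodup _).1 ((h.src _ hz.mem.2).2 h2)).2 z hz).elim
    · exact (hne (hu b ((h.arc z b hz.mem.1 hb).2 (hz'.trans hb'.symm)))).elim

end Encodes

/-! ### Out-degrees in the multigraph -/

open Classical in
/-- The number of edges with tail `x`. -/
noncomputable def outdeg (n : ℕ) (tl : ℕ → ℕ) (T : SPTree) (x : ℕ) : ℕ :=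
  ((Finset.range n).filter fun e => T.Mem e ∧ tl e = x).card

section outdeg

variable {n : ℕ} {tl : ℕ → ℕ} {T T' : SPTree}

theorem eq_of_outdeg_eq_one (hlt : ∀ e, T.Mem e → e < n) {x : ℕ} (h : outdeg n tl T x = 1)
    {a b : ℕ} (ha : T.Mem a) (hb : T.Mem b) (ha' : tl a = x) (hb' : tl b = x) : a = b := by
  classical
  unfold outdeg at h
  rw [Finset.card_eq_one] at h
  obtain ⟨z, hz⟩ := h
  simp only [Finset.ext_iff, Finset.mem_filter, Finset.mem_range, Finset.mem_singleton] at hz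
  rw [(hz a).1 ⟨hlt a ha, ha, ha'⟩, (hz b).1 ⟨hlt b hb, hb, hb'⟩]

theorem outdeg_pos (hlt : ∀ e, T.Mem e → e < n) {a : ℕ} (ha : T.Mem a) :
    0 < outdeg n tl T (tl a) := by
  classical
  unfold outdeg
  refine Finset.card_pos.2 ⟨a, ?_⟩
  simp [hlt a ha, ha]

theorem exists_ne_of_two_le_outdeg {x : ℕ} (h : 2 ≤ outdeg n tl T x) (e : ℕ) :
    ∃ a, T.Mem a ∧ tl a = x ∧ a ≠ e := by
  classical
  unfold outdeg at h
  obtain ⟨a, ha, hne⟩ := Finset.exists_mem_ne h e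
  exact ⟨a, (Finset.mem_filter.1 ha).2.1, (Finset.mem_filter.1 ha).2.2, hne⟩

theorem outdeg_le : outdeg n tl T x ≤ n := by
  classical
  unfold outdeg
  exact (Finset.card_filter_le _ _).trans (by simp)

theorem outdeg_parallel (hlt : ∀ e, T.Mem e → e < n) {e : ℕ} (he : T.Mem e)
    (hm : ∀ x, T'.Mem x ↔ T.Mem x ∧ x ≠ e) :
    outdeg n tl T' = Function.update (outdeg n tl T) (tl e) (outdeg n tl T (tl e) - 1) := by
  classical
  funext y
  by_cases hy : y = tl e
  · subst hy
    rw [Function.update_self]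
    unfold outdeg
    rw [← Finset.card_erase_of_mem (a := e) (by simp [hlt e he, he])]
    congr 1
    ext a
    simp only [Finset.mem_filter, Finset.mem_range, hm, Finset.mem_erase]
    tauto
  · rw [Function.update_of_ne hy]
    unfold outdeg
    congr 1
    ext a
    simp only [Finset.mem_filter, Finset.mem_range, hm]
    have : tl a = y → a ≠ e := by rintro h rfl; exact hy h.symm
    tauto

/-- At the tail of `g` the edge `f` replaces `g`, so the number does not change there; the old tail
of `f` loses its only outgoing edge. -/
theorem outdeg_series (hlt : ∀ e, T.Mem e → e < n) {f g : ℕ} (hf : T.Mem f) (hg : T.Mem g)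
    (hne : tl g ≠ tl f) (h1 : ∀ a, T.Mem a → tl a = tl f → a = f)
    (hm : ∀ x, T'.Mem x ↔ T.Mem x ∧ x ≠ g) :
    outdeg n (Function.update tl f (tl g)) T' = Function.update (outdeg n tl T) (tl f) 0 := by
  classical
  have hgf : g ≠ f := by rintro rfl; exact hne rfl
  funext y
  by_cases hy : y = tl f
  · subst hy
    rw [Function.update_self]
    unfold outdeg
    rw [Finset.card_eq_zero, Finset.filter_eq_empty_iff]
    rintro a - ⟨ha, ha'⟩
    by_cases haf : a = f
    · subst haf; rw [Function.update_self] at ha'; exact hne ha'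
    · rw [Function.update_of_ne haf] at ha'
      exact haf (h1 a ((hm a).1 ha).1 ha')
  rw [Function.update_of_ne hy]
  unfold outdeg
  by_cases hy' : y = tl g
  · subst hy'
    have e1 : (Finset.range n).filter (fun e => T'.Mem e ∧ Function.update tl f (tl g) e = tl g) =
        insert f (((Finset.range n).filter fun e => T.Mem e ∧ tl e = tl g).erase g) := by
      ext a
      simp only [Finset.mem_filter, Finset.mem_range, hm, Finset.mem_erase, Finset.mem_insert]
      by_cases haf : a = f
      · subst haf; simp [hf, hlt a hf, hgf.symm]
      · rw [Function.update_of_ne haf]; tauto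
    rw [e1, Finset.card_insert_of_notMem, Finset.card_erase_add_one]
    · simp [hlt g hg, hg]
    · simp [hne.symm]
  · congr 1
    ext a
    simp only [Finset.mem_filter, Finset.mem_range, hm]
    by_cases haf : a = f
    · subst haf
      simp [Ne.symm hy', Ne.symm hy]
    · rw [Function.update_of_ne haf]
      have : tl a = y → a ≠ g := by rintro h rfl; exact hy' h.symm
      tauto

end outdeg

/-- The arrays hold, for every leaf `e` of `T`, a tree with root `lab e`. Substituted into `T` these
trees give `T₀`. Every node is a child of at most one node and no root is a child. -/
structure IsForest (n cnt : ℕ) (typ lc rc lab : ℕ → ℕ) (T T₀ : SPTree) : Prop where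
  decodes : ∃ L : ℕ → SPTree, (∀ e, T.Mem e → Decodes n cnt typ lc rc (lab e) (L e)) ∧
    Equiv (T.bind L) T₀
  parents : ∃ π : ℕ → ℕ, (∀ e, T.Mem e → lab e < cnt ∧ π (lab e) = e) ∧
    ∀ j, n ≤ j → j < cnt →
      lc j < j ∧ rc j < j ∧ π (lc j) = n + 2 * j ∧ π (rc j) = n + 2 * j + 1

/-- The new node `cnt` becomes the label of `f`, and the former labels of `e` and `f` become its
children. The function `π` records the role of a node: a value e < n for the label of the edge e, n
+ 2j for the left child of j, n + 2j + 1 for the right child of j. Being a function, it excludes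
that a node has two roles. The two former labels pass from the first kind of role to the others. -/
theorem IsForest.merge {n cnt : ℕ} {typ lc rc lab : ℕ → ℕ} {T T' T₀ : SPTree}
    (h : IsForest n cnt typ lc rc lab T T₀) (hn : n ≤ cnt) (hlt : ∀ e, T.Mem e → e < n)
    {e f : ℕ} (he : T.Mem e) (hf : T.Mem f) (hne : e ≠ f) (hm : ∀ x, T'.Mem x ↔ T.Mem x ∧ x ≠ e)
    {ty : ℕ} (hT : ty = 0 ∧ Equiv T (T'.subst f (par (leaf e) (leaf f))) ∨
      ty ≠ 0 ∧ Equiv T (T'.subst f (ser (leaf e) (leaf f)))) :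
    IsForest n (cnt + 1) (Function.update typ cnt ty) (Function.update lc cnt (lab e))
      (Function.update rc cnt (lab f)) (Function.update lab f cnt) T' T₀ := by
  constructor
  · obtain ⟨L, h1, h2⟩ := h.decodes
    have up : ∀ U : SPTree, (T'.subst f U).bind L = T'.bind (Function.update L f (U.bind L)) := by
      intro U
      rw [subst, bind_bind]
      congr 1
      funext v
      by_cases hv : v = f
      · subst hv; simp
      · simp [Function.update_of_ne hv, SPTree.bind]
    have dec : ∀ U : SPTree, Decodes n (cnt + 1) (Function.update typ cnt ty)
        (Function.update lc cnt (lab e)) (Function.update rc cnt (lab f)) cnt U →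
        ∀ x, T'.Mem x → Decodes n (cnt + 1) (Function.update typ cnt ty)
        (Function.update lc cnt (lab e)) (Function.update rc cnt (lab f))
        (Function.update lab f cnt x) (Function.update L f U x) := by
      intro U hU x hx
      by_cases hxf : x = f
      · subst hxf; simpa using hU
      · rw [Function.update_of_ne hxf, Function.update_of_ne hxf]
        exact (h1 x ((hm x).1 hx).1).update _ _ _
    have d1 := (h1 e he).update ty (lab e) (lab f)
    have d2 := (h1 f hf).update ty (lab e) (lab f)
    rcases hT with ⟨rfl, hT⟩ | ⟨hty, hT⟩
    · refine ⟨_, dec (par (L e) (L f)) ⟨hn, by omega, by simp, by simpa using d1, by simpa using d2⟩,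
        ?_⟩
      have := up (par (leaf e) (leaf f))
      simp only [SPTree.bind] at this
      rw [← this]
      exact (hT.bind L).symm.trans h2
    · refine ⟨_, dec (ser (L e) (L f)) ⟨hn, by omega, by simpa using hty, by simpa using d1,
        by simpa using d2⟩, ?_⟩
      have := up (ser (leaf e) (leaf f))
      simp only [SPTree.bind] at this
      rw [← this]
      exact (hT.bind L).symm.trans h2
  · obtain ⟨π, h1, h2⟩ := h.parents
    have le := h1 e he
    have lf := h1 f hf
    have hef : lab e ≠ lab f := fun h => hne (le.2 ▸ lf.2 ▸ h ▸ rfl)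
    have hen := hlt e he
    have hfn := hlt f hf
    refine ⟨Function.update (Function.update (Function.update π (lab e) (n + 2 * cnt)) (lab f)
      (n + 2 * cnt + 1)) cnt f, fun a ha => ?_, fun j hj hj' => ?_⟩
    · obtain ⟨ha, hae⟩ := (hm a).1 ha
      have la := h1 a ha
      by_cases haf : a = f
      · subst haf; simp
      · have n1 : lab a ≠ lab f := fun h => haf (la.2 ▸ lf.2 ▸ h ▸ rfl)
        have n2 : lab a ≠ lab e := fun h => hae (la.2 ▸ le.2 ▸ h ▸ rfl)
        rw [Function.update_of_ne haf, Function.update_of_ne la.1.ne, Function.update_of_ne n1,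
          Function.update_of_ne n2]
        exact ⟨by omega, la.2⟩
    · rcases Nat.lt_succ_iff_lt_or_eq.1 hj' with hj' | rfl
      · obtain ⟨a, b, c, d⟩ := h2 j hj hj'
        have n1 : lc j ≠ lab e := fun h => by rw [h] at c; omega
        have n2 : lc j ≠ lab f := fun h => by rw [h] at c; omega
        have n3 : rc j ≠ lab e := fun h => by rw [h] at d; omega
        have n4 : rc j ≠ lab f := fun h => by rw [h] at d; omega
        have n5 : lc j ≠ cnt := by omega
        have n6 : rc j ≠ cnt := by omega
        rw [Function.update_of_ne hj'.ne, Function.update_of_ne hj'.ne]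
        simp only [Function.update_of_ne n1, Function.update_of_ne n2, Function.update_of_ne n3,
          Function.update_of_ne n4, Function.update_of_ne n5, Function.update_of_ne n6]
        exact ⟨a, b, c, d⟩
      · have n1 := le.1.ne
        have n2 := lf.1.ne
        simp only [Function.update_self, Function.update_of_ne n1, Function.update_of_ne n2,
          Function.update_of_ne hef]
        exact ⟨le.1, lf.1, trivial, trivial⟩

/-! ### The multigraph that is computed from the list of arcs -/

/-- The state of the computation after the first `i` arcs `(us j, vs j)`: `hd u` is one more than the least
successor of `u` and `pr v` is one more than some predecessor of `v`; `0` stands for none. -/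
structure ArcsRead (us vs : ℕ → ℕ) (i : ℕ) (hd pr : ℕ → ℕ) : Prop where
  hd_zero : ∀ u, hd u = 0 → ∀ j < i, us j ≠ u
  hd_pos : ∀ u, hd u ≠ 0 → ∃ j < i, us j = u ∧ hd u = vs j + 1
  hd_le : ∀ j < i, hd (us j) ≤ vs j + 1
  pr_zero : ∀ v, pr v = 0 → ∀ j < i, vs j ≠ v
  pr_pos : ∀ v, pr v ≠ 0 → ∃ j < i, vs j = v ∧ pr v = us j + 1

theorem ArcsRead.zero (us vs : ℕ → ℕ) : ArcsRead us vs 0 (fun _ => 0) fun _ => 0 := by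
  constructor <;> simp

theorem ArcsRead.succ {us vs : ℕ → ℕ} {i : ℕ} {hd pr : ℕ → ℕ} (h : ArcsRead us vs i hd pr) :
    ArcsRead us vs (i + 1)
      (if hd (us i) = 0 ∨ vs i + 1 < hd (us i) then Function.update hd (us i) (vs i + 1) else hd)
      (Function.update pr (vs i) (us i + 1)) := by
  constructor
  · intro u hu j hj
    split_ifs at hu with hc
    · by_cases h1 : u = us i
      · subst h1; simp at hu
      · rw [Function.update_of_ne h1] at hu
        rcases Nat.lt_succ_iff_lt_or_eq.1 hj with hj | rfl
        exacts [h.hd_zero u hu j hj, Ne.symm h1]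
    · rcases Nat.lt_succ_iff_lt_or_eq.1 hj with hj | rfl
      · exact h.hd_zero u hu j hj
      · rintro rfl; exact hc (.inl hu)
  · intro u hu
    split_ifs at hu ⊢ with hc
    · by_cases h1 : u = us i
      · subst h1; exact ⟨i, by omega, rfl, by simp⟩
      · rw [Function.update_of_ne h1] at hu ⊢
        obtain ⟨j, a, b⟩ := h.hd_pos u hu
        exact ⟨j, by omega, b⟩
    · obtain ⟨j, a, b⟩ := h.hd_pos u hu
      exact ⟨j, by omega, b⟩
  · intro j hj
    split_ifs with hc
    · by_cases h1 : us j = us i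
      · rw [h1, Function.update_self]
        rcases Nat.lt_succ_iff_lt_or_eq.1 hj with hj | rfl
        · have h2 := h.hd_le j hj
          have h3 : hd (us j) ≠ 0 := fun h3 => h.hd_zero _ h3 j hj rfl
          rw [h1] at h2 h3
          omega
        · exact le_rfl
      · rw [Function.update_of_ne h1]
        rcases Nat.lt_succ_iff_lt_or_eq.1 hj with hj | rfl
        exacts [h.hd_le j hj, (h1 rfl).elim]
    · rcases Nat.lt_succ_iff_lt_or_eq.1 hj with hj | rfl
      · exact h.hd_le j hj
      · omega
  · intro v hv j hj
    by_cases h1 : v = vs i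
    · subst h1; simp at hv
    · rw [Function.update_of_ne h1] at hv
      rcases Nat.lt_succ_iff_lt_or_eq.1 hj with hj | rfl
      exacts [h.pr_zero v hv j hj, Ne.symm h1]
  · intro v hv
    by_cases h1 : v = vs i
    · subst h1; exact ⟨i, by omega, rfl, by simp⟩
    · rw [Function.update_of_ne h1] at hv ⊢
      obtain ⟨j, a, b⟩ := h.pr_pos v hv
      exact ⟨j, by omega, b⟩

/-- The tail of the edge `j`. -/
def tailOf (n : ℕ) (hd pr : ℕ → ℕ) (j : ℕ) : ℕ := if pr j = 0 then n + 1 else hd (pr j - 1)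

/-- Vertices with a common successor have the same successors and thus the same least successor.
Therefore `hd` is constant on the predecessors of a vertex, and it does not matter which predecessor
`pr` remembers. Conversely, if the head of `e` is the tail of `f`, then `e` shares its least
successor with a predecessor of `f`, so `f` is a successor of `e`. -/
theorem ArcsRead.encodes {n m : ℕ} {us vs hd pr : ℕ → ℕ} (h : ArcsRead us vs m hd pr)
    {T : SPTree} (hT : T.Nodup) (hm : ∀ v, T.Mem v ↔ v < n)
    (ha : ∀ x y, T.Arc x y ↔ ∃ j < m, us j = x ∧ vs j = y) :
    Encodes n hd (tailOf n hd pr) T := by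
  have hd_arc : ∀ u, hd u ≠ 0 → T.Arc u (hd u - 1) := by
    intro u hu
    obtain ⟨j, a, b, c⟩ := h.hd_pos u hu
    exact (ha _ _).2 ⟨j, a, b, by omega⟩
  have hd_min : ∀ u v, T.Arc u v → hd u ≠ 0 ∧ hd u ≤ v + 1 := by
    intro u v huv
    obtain ⟨j, a, rfl, rfl⟩ := (ha _ _).1 huv
    exact ⟨fun h0 => h.hd_zero _ h0 j a rfl, h.hd_le j a⟩
  have pr_arc : ∀ v, pr v ≠ 0 → T.Arc (pr v - 1) v := by
    intro v hv
    obtain ⟨j, a, b, c⟩ := h.pr_pos v hv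
    exact (ha _ _).2 ⟨j, a, by omega, b⟩
  have pr_ne : ∀ u v, T.Arc u v → pr v ≠ 0 := by
    intro u v huv h0
    obtain ⟨j, a, rfl, rfl⟩ := (ha _ _).1 huv
    exact h.pr_zero _ h0 j a rfl
  have hd_lt : ∀ u, hd u ≤ n := by
    intro u
    by_cases hu : hd u = 0
    · omega
    · have := (hm _).1 (hd_arc u hu).mem.2; omega
  -- The least successor of each of the two vertices is a successor of the other one, so neither can
  -- be smaller.
  have hd_eq : ∀ e u v, T.Arc e v → T.Arc u v → hd e = hd u := by
    intro e u v he hu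
    have h1 := hd_arc e (hd_min e v he).1
    have h2 := hd_arc u (hd_min u v hu).1
    have h3 := (hd_min e _ (arc_of_common_succ hT he hu h2)).2
    have h4 := (hd_min u _ (arc_of_common_succ hT hu he h1)).2
    have := (hd_min e v he).1
    have := (hd_min u v hu).1
    omega
  refine ⟨hT, fun e he => (hm e).1 he, fun e f he hf => ?_, fun e he => ?_, fun e he => ?_⟩
  · unfold tailOf
    constructor
    · intro hef
      have h0 := pr_ne e f hef
      rw [if_neg h0]
      exact hd_eq e _ f hef (pr_arc f h0)
    · intro hef
      split_ifs at hef with h0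
      -- Heads are at most n, so the source n + 1 is not the head of an edge.
      · have := hd_lt e; omega
      · have h1 := pr_arc f h0
        have h2 := (hd_min _ _ h1).1
        have h3 := hd_arc _ h2
        rw [← hef] at h2 h3
        exact arc_of_common_succ hT (hd_arc e h2) h3 h1
  · rw [snk_iff hT]
    constructor
    · rintro ⟨-, h1⟩
      by_contra h0
      exact h1 _ (hd_arc e h0)
    · exact fun h0 => ⟨he, fun y hy => (hd_min e y hy).1 h0⟩
  · rw [src_iff hT]
    unfold tailOf
    constructor
    · rintro ⟨-, h1⟩
      rw [if_pos]
      by_contra h0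
      exact h1 _ (pr_arc e h0)
    · intro h0
      refine ⟨he, fun y hy => ?_⟩
      rw [if_neg (pr_ne y e hy)] at h0
      have := hd_lt (pr e - 1)
      omega

/-! ### Linked lists -/

/-- The linked list that starts at the pointer `p` (one more than an index, `0` at the end). -/
def IsLinked (nx : ℕ → ℕ) : ℕ → List ℕ → Prop
  | p, [] => p = 0
  | p, a :: l => p = a + 1 ∧ IsLinked nx (nx a) l

theorem IsLinked.update {nx : ℕ → ℕ} {p : ℕ} {l : List ℕ} (h : IsLinked nx p l) {i : ℕ} (hi : i ∉ l)
    (v : ℕ) : IsLinked (Function.update nx i v) p l := by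
  induction l generalizing p with
  | nil => exact h
  | cons a l ih =>
    simp only [List.mem_cons, not_or] at hi
    refine ⟨h.1, ?_⟩
    rw [Function.update_of_ne (Ne.symm hi.1)]
    exact ih h.2 hi.2

/-- The indices below `i` at which `g` has the value `x`, in decreasing order. -/
def fiber (g : ℕ → ℕ) (x i : ℕ) : List ℕ := (List.range i).reverse.filter (g · = x)

theorem fiber_succ (g : ℕ → ℕ) (x i : ℕ) :
    fiber g x (i + 1) = if g i = x then i :: fiber g x i else fiber g x i := by
  simp [fiber, List.range_succ, List.filter_cons]

theorem mem_fiber {g : ℕ → ℕ} {x i a : ℕ} : a ∈ fiber g x i ↔ a < i ∧ g a = x := by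
  simp [fiber]

theorem nodup_fiber (g : ℕ → ℕ) (x i : ℕ) : (fiber g x i).Nodup :=
  (List.nodup_reverse.2 List.nodup_range).filter _

theorem length_fiber (g : ℕ → ℕ) (x i : ℕ) :
    (fiber g x i).length = ((Finset.range i).filter (g · = x)).card := by
  rw [← List.toFinset_card_of_nodup (nodup_fiber g x i)]
  congr 1
  ext a
  simp [mem_fiber]

/-- The list of the indices below `i` with value `x` is stored for all `x`. -/
def AreFibers (g : ℕ → ℕ) (nx fs : ℕ → ℕ) (i : ℕ) : Prop := ∀ x, IsLinked nx (fs x) (fiber g x i)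

/-- Index `i` occurs in no list yet, so its link can be set freely; it is put in front of the list
of its value. Pointers are shifted by one because 0 marks the end. -/
theorem AreFibers.succ {g nx fs : ℕ → ℕ} {i : ℕ} (h : AreFibers g nx fs i) :
    AreFibers g (Function.update nx i (fs (g i))) (Function.update fs (g i) (i + 1)) (i + 1) := by
  intro x
  have hi : ∀ y, i ∉ fiber g y i := fun y hy => (mem_fiber.1 hy).1.ne rfl
  rw [fiber_succ]
  by_cases hx : g i = x
  · subst hx
    rw [if_pos rfl, Function.update_self]
    exact ⟨rfl, by rw [Function.update_self]; exact (h _).update (hi _) _⟩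
  · rw [if_neg hx, Function.update_of_ne (Ne.symm hx)]
    exact (h x).update (hi _) _

theorem length_fiber_succ (g : ℕ → ℕ) (i : ℕ) {d : ℕ → ℕ} (h : ∀ x, d x = (fiber g x i).length) :
    ∀ x, Function.update d (g i) (d (g i) + 1) x = (fiber g x (i + 1)).length := by
  intro x
  rw [fiber_succ]
  by_cases hx : g i = x
  · subst hx; simp [h]
  · simp [hx, h, Function.update_of_ne (Ne.symm hx)]

/-! ### The program: reading the input -/

namespace WordRAM

infixr:60 " ;; " => Cmd.seq

notation "rN" => (0 : Fin 16)
notation "rM" => (1 : Fin 16)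
notation "rC" => (2 : Fin 16)
notation "rW" => (3 : Fin 16)
notation "rI" => (4 : Fin 16)
notation "rU" => (5 : Fin 16)
notation "rV" => (6 : Fin 16)
notation "rE" => (7 : Fin 16)
notation "rF" => (8 : Fin 16)
notation "rH" => (9 : Fin 16)
notation "rQ" => (10 : Fin 16)
notation "rT" => (11 : Fin 16)
notation "rP" => (12 : Fin 16)
notation "rR" => (13 : Fin 16)
notation "rS" => (14 : Fin 16)
notation "rB" => (15 : Fin 16)

notation "aSel" => (0 : Fin 21)
notation "aHd" => (1 : Fin 21)
notation "aPr" => (2 : Fin 21)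
notation "aTl" => (3 : Fin 21)
notation "aNxI" => (4 : Fin 21)
notation "aFsI" => (5 : Fin 21)
notation "aNxO" => (6 : Fin 21)
notation "aFsO" => (7 : Fin 21)
notation "aOd" => (8 : Fin 21)
notation "aPd" => (9 : Fin 21)
notation "aOrd" => (10 : Fin 21)
notation "aLab" => (11 : Fin 21)
notation "aMk" => (12 : Fin 21)
notation "aIn" => (13 : Fin 21)
notation "aTy" => (14 : Fin 21)
notation "aLc" => (15 : Fin 21)
notation "aRc" => (16 : Fin 21)
notation "aTot" => (17 : Fin 21)
notation "aD" => (18 : Fin 21)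
notation "aX" => (19 : Fin 21)
notation "aY" => (20 : Fin 21)

/-- Programs with 16 registers and 21 arrays. -/
abbrev Prog := Cmd 16 21

/-- Memory of the programs with 16 registers and 21 arrays. -/
abbrev Mem := State 16 21

open WordRAM.Expr WordRAM.Cmd

/-- The machine `M` is given an input with `n` items, `m` arcs `(us j, vs j)`, capacity `c` and
sizes `sz j`, and its memory and words are large enough. -/
structure Setting (M : Config) (n m c : ℕ) (sz us vs : ℕ → ℕ) : Prop where
  read_zero : M.read 0 = n
  read_one : M.read 1 = m
  read_two : M.read 2 = c
  read_size : ∀ j < n, M.read (3 + j) = sz j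
  read_fst : ∀ j < m, M.read (3 + n + 2 * j) = us j
  read_snd : ∀ j < m, M.read (3 + n + 2 * j + 1) = vs j
  length : M.inp.length = 3 + n + 2 * m
  len : M.len = 4 * n * (c + 1)
  word : 4 * n * (c + 1) + 2 * m + n + 4 * c + 20 < M.word
  size_lt : ∀ j < n, sz j < M.word
  n_pos : 0 < n
  c_pos : 0 < c
  fst_lt : ∀ j < m, us j < n
  snd_lt : ∀ j < m, vs j < n

namespace Setting

variable {M : Config} {n m c : ℕ} {sz us vs : ℕ → ℕ}

theorem le_len (h : Setting M n m c sz us vs) : 8 * n ≤ M.len := by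
  have := h.c_pos
  rw [h.len]; nlinarith

theorem len_lt (h : Setting M n m c sz us vs) : M.len + 2 * m + n + 4 * c + 20 < M.word :=
  h.len ▸ h.word

end Setting

/-- Read the numbers `n`, `m`, `c`. -/
def readHeader : Prog :=
  .set rN (.input 0) ;; .set rM (.input 1) ;; .set rC (.input 2) ;; .set rI 0

/-- Process the arc number `rI`. -/
def readArc : Prog :=
  .set rU (.input (3 + .reg rN + 2 * .reg rI)) ;;
  .set rV (.input (3 + .reg rN + 2 * .reg rI + 1)) ;;
  .ite (eq (.cell aHd (.reg rU)) 0) (.store aHd (.reg rU) (.reg rV + 1))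
    (.ite (lt (.reg rV + 1) (.cell aHd (.reg rU))) (.store aHd (.reg rU) (.reg rV + 1)) .skip) ;;
  .store aPr (.reg rV) (.reg rU + 1) ;;
  .set rI (.reg rI + 1)

/-- Process all arcs. -/
def readArcs : Prog := readHeader ;; .loop (lt (.reg rI) (.reg rM)) readArc

theorem exec_readArcs {M : Config} {n m c : ℕ} {sz us vs : ℕ → ℕ} (hM : Setting M n m c sz us vs)
    {σ : Mem} (h1 : σ.arr aHd = fun _ => 0) (h2 : σ.arr aPr = fun _ => 0) :
    ∃ t τ, Exec M readArcs σ t τ ∧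
      t ≤ readHeader.bound + m * roundCost (lt (.reg rI) (.reg rM)) readArc + 4 ∧
      τ.reg rN = n ∧ τ.reg rM = m ∧ τ.reg rC = c ∧
      ArcsRead us vs m (τ.arr aHd) (τ.arr aPr) := by
  have hl := hM.le_len
  have hw := hM.len_lt
  have hn := hM.n_pos
  have w1 : 1 < M.word := by omega
  have w0 : 0 < M.word := by omega
  obtain ⟨t₀, e₀, b₀⟩ := Cmd.exec_run (M := M) (p := readHeader) (σ := σ) (by
    simp [readHeader, hM.read_zero, hM.read_one, hM.read_two, hM.length, w0, w1]
    omega)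
  obtain ⟨t, τ, φ, e, ⟨i, rfl, hi, hin, him, hic, hle, hA⟩, hb, ht⟩ :=
    exec_loop_run (M := M) (b := lt (.reg rI) (.reg rM)) (p := readArc)
    (fun φ σ => ∃ i, φ = m - i ∧ σ.reg rI = i ∧ σ.reg rN = n ∧ σ.reg rM = m ∧ σ.reg rC = c ∧
      i ≤ m ∧ ArcsRead us vs i (σ.arr aHd) (σ.arr aPr))
    (by
      rintro φ σ ⟨i, -, hi, hin, him, hic, hle, hA⟩
      simp [w1])
    (by
      rintro φ σ ⟨i, rfl, hi, hin, him, hic, hle, hA⟩ hv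
      have hlt : i < m := by simpa [hi, him] using hv
      have q1 := hM.read_fst i hlt
      have q2 := hM.read_snd i hlt
      have q3 := hM.fst_lt i hlt
      have q4 := hM.snd_lt i hlt
      have q5 := hM.length
      have hA := hA.succ
      by_cases c1 : σ.arr aHd (us i) = 0
      · simp only [c1, true_or, if_true] at hA
        constructor
        · simp [readArc, hi, hin, q1, q2, c1, w0, w1]
          omega
        · exact ⟨m - (i + 1), by omega, i + 1, rfl, by
            simp [readArc, hi, hin, him, hic, q1, q2, c1, hA]; omega⟩
      · by_cases c2 : vs i + 1 < σ.arr aHd (us i)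
        · simp only [c2, or_true, if_true] at hA
          constructor
          · simp [readArc, hi, hin, q1, q2, c1, c2, w0, w1]
            omega
          · exact ⟨m - (i + 1), by omega, i + 1, rfl, by
              simp [readArc, hi, hin, him, hic, q1, q2, c1, c2, hA]; omega⟩
        · simp only [c1, c2, or_false, if_false] at hA
          constructor
          · simp [readArc, hi, hin, q1, q2, c1, c2, w0, w1]
            omega
          · exact ⟨m - (i + 1), by omega, i + 1, rfl, by
              simp [readArc, hi, hin, him, hic, q1, q2, c1, c2, hA]; omega⟩)
    m (readHeader.run M σ) ⟨0, by simp [readHeader, hM.read_zero, hM.read_one, hM.read_two, h1, h2,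
      ArcsRead.zero]⟩
  obtain rfl : i = m := by
    have : ¬ i < m := by simpa [hi, him] using hb
    omega
  refine ⟨_, τ, .seq e₀ e, ?_, hin, him, hic, hA⟩
  -- The test of the loop has cost 3. Its last evaluation, which ends the loop, accounts for the
  -- summand 4.
  simp only [Expr.cost, lt] at ht
  simp only [lt]
  omega

end WordRAM

/-! ### The program: adjacency lists -/

namespace WordRAM

open WordRAM.Expr WordRAM.Cmd

/-- Insert the edge `rI` into the multigraph. -/
def addEdge : Prog :=
  .ite (eq (.cell aPr (.reg rI)) 0) (.set rU (.reg rN + 1))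
    (.set rU (.cell aHd (.cell aPr (.reg rI) - 1))) ;;
  .set rV (.cell aHd (.reg rI)) ;;
  .store aTl (.reg rI) (.reg rU) ;;
  .store aNxI (.reg rI) (.cell aFsI (.reg rV)) ;;
  .store aFsI (.reg rV) (.reg rI + 1) ;;
  .store aNxO (.reg rI) (.cell aFsO (.reg rU)) ;;
  .store aFsO (.reg rU) (.reg rI + 1) ;;
  .store aOd (.reg rU) (.cell aOd (.reg rU) + 1) ;;
  .store aPd (.reg rV) (.cell aPd (.reg rV) + 1) ;;
  .store aLab (.reg rI) (.reg rI) ;;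
  .set rI (.reg rI + 1)

/-- Build the adjacency lists of the multigraph. -/
def addEdges : Prog := .set rI 0 ;; .loop (lt (.reg rI) (.reg rN)) addEdge

/-- The adjacency lists of the edges below `i` are complete. -/
structure EdgesAdded (hd tl : ℕ → ℕ) (i : ℕ) (σ : Mem) : Prop where
  hd_eq : σ.arr aHd = hd
  tl_eq : ∀ j < i, σ.arr aTl j = tl j
  lab_eq : ∀ j < i, σ.arr aLab j = j
  heads : AreFibers hd (σ.arr aNxI) (σ.arr aFsI) i
  tails : AreFibers tl (σ.arr aNxO) (σ.arr aFsO) i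
  outdeg_eq : ∀ x, σ.arr aOd x = (fiber tl x i).length
  indeg_eq : ∀ x, σ.arr aPd x = (fiber hd x i).length

theorem ok_addEdge {M : Config} {n m c : ℕ} {sz us vs : ℕ → ℕ} (hM : Setting M n m c sz us vs)
    {σ : Mem} {i : ℕ} (hi : σ.reg rI = i) (hin : σ.reg rN = n) (hlt : i < n)
    (hhd : ∀ j, σ.arr aHd j ≤ n) (hpr : ∀ j, σ.arr aPr j ≤ n)
    (hod : ∀ x, σ.arr aOd x ≤ i) (hpd : ∀ x, σ.arr aPd x ≤ i) :
    addEdge.Ok M σ := by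
  have hl := hM.le_len
  have hw := hM.len_lt
  have w1 : 1 < M.word := by omega
  have w0 : 0 < M.word := by omega
  have b1 := hhd i
  have b2 := hpr i
  have b4 := hpd (σ.arr aHd i)
  by_cases c1 : σ.arr aPr i = 0
  · have b3 := hod (n + 1)
    simp [addEdge, hi, hin, c1, w0, w1]
    omega
  · have b3 := hod (σ.arr aHd (σ.arr aPr i - 1))
    have b5 := hhd (σ.arr aPr i - 1)
    simp [addEdge, hi, hin, c1, w0, w1]
    omega

theorem run_addEdge {M : Config} {σ : Mem} {i n : ℕ} {hd tl : ℕ → ℕ} (hi : σ.reg rI = i)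
    (hin : σ.reg rN = n) (htl : tl i = tailOf n hd (σ.arr aPr) i) (h : EdgesAdded hd tl i σ) :
    (addEdge.run M σ).reg rI = i + 1 ∧ (addEdge.run M σ).arr aPr = σ.arr aPr ∧
      EdgesAdded hd tl (i + 1) (addEdge.run M σ) := by
  obtain ⟨h1, h2, h3, h4, h5, h6, h7⟩ := h
  -- All arrays after the round are written down explicitly, while the registers other than `rI`
  -- stay abstract. In this form the invariants can be matched with the lemmas on lists by
  -- unfolding.
  have e : ∃ ρ : Fin 16 → ℕ, ρ rI = i + 1 ∧ addEdge.run M σ = ⟨ρ, fun a =>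
      if a = aTl then Function.update (σ.arr aTl) i (tl i) else
      if a = aNxI then Function.update (σ.arr aNxI) i (σ.arr aFsI (hd i)) else
      if a = aFsI then Function.update (σ.arr aFsI) (hd i) (i + 1) else
      if a = aNxO then Function.update (σ.arr aNxO) i (σ.arr aFsO (tl i)) else
      if a = aFsO then Function.update (σ.arr aFsO) (tl i) (i + 1) else
      if a = aOd then Function.update (σ.arr aOd) (tl i) (σ.arr aOd (tl i) + 1) else
      if a = aPd then Function.update (σ.arr aPd) (hd i) (σ.arr aPd (hd i) + 1) else
      if a = aLab then Function.update (σ.arr aLab) i i else σ.arr a⟩ := by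
    refine ⟨(addEdge.run M σ).reg, ?_, ?_⟩
    · by_cases c1 : σ.arr aPr i = 0 <;> simp [addEdge, hi, c1]
    · refine State.ext rfl ?_
      funext a
      unfold tailOf at htl
      by_cases c1 : σ.arr aPr i = 0
      · rw [if_pos c1] at htl
        simp only [htl]
        fin_cases a <;> simp [addEdge, hi, hin, c1, h1]
      · rw [if_neg c1] at htl
        simp only [htl]
        fin_cases a <;> simp [addEdge, hi, c1, h1]
  obtain ⟨ρ, e1, e2⟩ := e
  rw [e2]
  refine ⟨e1, rfl, ?_, ?_, ?_, ?_, ?_, ?_, ?_⟩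
  · exact h1
  · intro j hj
    change Function.update (σ.arr aTl) i (tl i) j = _
    by_cases hji : j = i
    · subst hji; simp
    · rw [Function.update_of_ne hji]; exact h2 j (by omega)
  · intro j hj
    change Function.update (σ.arr aLab) i i j = _
    by_cases hji : j = i
    · subst hji; simp
    · rw [Function.update_of_ne hji]; exact h3 j (by omega)
  · exact h4.succ
  · exact h5.succ
  · exact length_fiber_succ tl i h6
  · exact length_fiber_succ hd i h7

theorem length_fiber_le (g : ℕ → ℕ) (x i : ℕ) : (fiber g x i).length ≤ i := by
  rw [length_fiber]
  exact (Finset.card_filter_le _ _).trans (by simp)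

theorem exec_addEdges {M : Config} {n m c : ℕ} {sz us vs : ℕ → ℕ} (hM : Setting M n m c sz us vs)
    {σ : Mem} (hin : σ.reg rN = n) {hd pr : ℕ → ℕ} (hhd : σ.arr aHd = hd) (hpr : σ.arr aPr = pr)
    (hhd' : ∀ j, hd j ≤ n) (hpr' : ∀ j, pr j ≤ n)
    (z : ∀ a : Fin 21, 4 ≤ a → σ.arr a = fun _ => 0) :
    ∃ t τ, Exec M addEdges σ t τ ∧ t ≤ n * roundCost (lt (.reg rI) (.reg rN)) addEdge + 6 ∧
      EdgesAdded hd (tailOf n hd pr) n τ := by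
  have hl := hM.le_len
  have hw := hM.len_lt
  have w1 : 1 < M.word := by omega
  have w0 : 0 < M.word := by omega
  obtain ⟨t₀, e₀, b₀⟩ := Cmd.exec_run (M := M) (p := .set rI 0) (σ := σ) (by simp [w0])
  obtain ⟨t, τ, φ, e, ⟨i, rfl, hi, hin, hpr, hle, hA⟩, hb, ht⟩ :=
    exec_loop_run (M := M) (b := lt (.reg rI) (.reg rN)) (p := addEdge)
    (fun φ σ => ∃ i, φ = n - i ∧ σ.reg rI = i ∧ σ.reg rN = n ∧ σ.arr aPr = pr ∧ i ≤ n ∧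
      EdgesAdded hd (tailOf n hd pr) i σ)
    (by
      rintro φ σ ⟨i, -⟩
      simp [w1])
    (by
      rintro φ σ ⟨i, rfl, hi, hin, hpr, hle, hA⟩ hv
      have hlt : i < n := by simpa [hi, hin] using hv
      have ok : addEdge.Ok M σ := by
        refine ok_addEdge hM hi hin hlt (by rwa [hA.hd_eq]) (by rwa [hpr]) ?_ ?_
        · intro x; rw [hA.outdeg_eq]; exact length_fiber_le _ _ _
        · intro x; rw [hA.indeg_eq]; exact length_fiber_le _ _ _
      obtain ⟨r1, r2, r3⟩ := run_addEdge (M := M) hi hin (by rw [hpr]) hA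
      obtain ⟨t, hex, -⟩ := Cmd.exec_run ok
      refine ⟨ok, n - (i + 1), by omega, i + 1, rfl, r1, ?_, r2.trans hpr, hlt, r3⟩
      rw [hex.reg_eq (by rfl), hin])
    n ((Cmd.set rI 0).run M σ) ⟨0, by
      refine ⟨rfl, by simp, by simpa using hin, by simpa using hpr, Nat.zero_le _, ?_⟩
      constructor <;> simp [hhd, z, AreFibers, fiber, IsLinked]⟩
  obtain rfl : i = n := by
    have : ¬ i < n := by simpa [hi, hin] using hb
    omega
  refine ⟨_, τ, .seq e₀ e, ?_, hA⟩
  have : bound (.set rI 0 : Prog) = 2 := rfl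
  simp only [Expr.cost, lt] at ht
  simp only [lt]
  omega

end WordRAM

/-! ### Topological sorting of the nodes -/

/-- `ord 0, …, ord (q - 1)` is a topological order of the nodes of the multigraph. -/
structure IsTopo (n : ℕ) (hd tl : ℕ → ℕ) (q : ℕ) (ord : ℕ → ℕ) : Prop where
  zero : ord 0 = n + 1
  pos : 1 ≤ q
  inj : ∀ i < q, ∀ j < q, ord i = ord j → i = j
  exists_edge : ∀ k, 1 ≤ k → k < q → ∃ a < n, hd a = ord k
  exists_eq : ∀ a < n, ∃ k, 1 ≤ k ∧ k < q ∧ ord k = hd a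
  exists_lt : ∀ k < q, ∀ a < n, hd a = ord k → ∃ k' < k, ord k' = tl a

/-- The invariant of topological sorting: the nodes `ord 0, …, ord (h - 1)` are processed,
`ord h, …, ord (q - 1)` are waiting, `l` is the rest of the list of edges out of `ord (h - 1)`, and
`U` is the set of edges that have not been scanned. -/
structure TopoInv (n : ℕ) (hd tl nx : ℕ → ℕ) (h q e : ℕ) (ord pd : ℕ → ℕ) (U : Finset ℕ)
    (l : List ℕ) : Prop where
  linked : IsLinked nx e l
  nodup : l.Nodup
  mem_U : ∀ a, a ∈ U ↔ a < n ∧ (a ∈ l ∨ ∀ k < h, ord k ≠ tl a)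
  mem_l : ∀ a ∈ l, a < n ∧ ∃ k < h, ord k = tl a
  pd_eq : ∀ w, pd w = (U.filter (hd · = w)).card
  zero : ord 0 = n + 1
  le : h ≤ q
  pos : 1 ≤ q
  inj : ∀ i < q, ∀ j < q, ord i = ord j → i = j
  waiting : ∀ w, (∃ k, 1 ≤ k ∧ k < q ∧ ord k = w) ↔ (∃ a < n, hd a = w) ∧ pd w = 0
  exists_lt : ∀ k < q, ∀ a < n, hd a = ord k → ∃ k' < k, ord k' = tl a

namespace TopoInv

variable {n : ℕ} {hd tl nx : ℕ → ℕ} {h q e : ℕ} {ord pd : ℕ → ℕ} {U : Finset ℕ} {l : List ℕ}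

theorem init (hhd : ∀ a < n, hd a ≤ n) (ho : ord 0 = n + 1)
    (hpd : ∀ w, pd w = (fiber hd w n).length) :
    TopoInv n hd tl nx 0 1 0 ord pd (Finset.range n) [] := by
  refine ⟨rfl, List.nodup_nil, by simp, by simp, fun w => by rw [hpd, length_fiber], ho, by simp,
    le_rfl, fun i hi j hj _ => by omega, fun w => ?_, fun k hk a ha hak => ?_⟩
  · constructor
    · rintro ⟨k, h1, h2, -⟩; omega
    · rintro ⟨⟨a, ha, rfl⟩, h0⟩
      rw [hpd, List.length_eq_zero_iff] at h0
      have : a ∈ fiber hd (hd a) n := mem_fiber.2 ⟨ha, rfl⟩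
      simp [h0] at this
  · obtain rfl : k = 0 := by omega
    have := hhd a ha
    omega

theorem ord_le (H : TopoInv n hd tl nx h q e ord pd U l) (hhd : ∀ a < n, hd a ≤ n) {k : ℕ}
    (hk : k < q) : ord k ≤ n + 1 := by
  rcases Nat.eq_zero_or_pos k with rfl | h1
  · exact H.zero.le
  · obtain ⟨⟨a, ha, ha'⟩, -⟩ := (H.waiting _).1 ⟨k, h1, hk, rfl⟩
    have := hhd a ha
    omega

theorem le_add (H : TopoInv n hd tl nx h q e ord pd U l) (hhd : ∀ a < n, hd a ≤ n) :
    q ≤ n + 2 := by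
  have := Finset.card_le_card_of_injOn (s := Finset.range q) (t := Finset.range (n + 2)) ord
    (fun k hk => by
      have := H.ord_le hhd (Finset.mem_range.1 hk)
      exact Finset.mem_coe.2 (Finset.mem_range.2 (by omega)))
    (fun i hi j hj hij => H.inj i (by simpa using hi) j (by simpa using hj) hij)
  simpa using this

/-- When the node `ord h` is processed, the edges out of it stay unscanned but pass to the current
list. The set `U` and the counters are not affected. -/
theorem pop (H : TopoInv n hd tl nx h q 0 ord pd U l) {fs : ℕ → ℕ} (hfs : AreFibers tl nx fs n)
    (hq : h < q) :
    TopoInv n hd tl nx (h + 1) q (fs (ord h)) ord pd U (fiber tl (ord h) n) := by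
  have hl : l = [] := by
    cases l with
    | nil => rfl
    | cons a l => have := H.linked.1; omega
  subst hl
  refine ⟨hfs _, nodup_fiber _ _ _, fun a => ?_, fun a ha => ?_, H.pd_eq, H.zero, hq, H.pos, H.inj,
    H.waiting, H.exists_lt⟩
  · rw [H.mem_U, mem_fiber]
    simp only [List.not_mem_nil, false_or]
    refine and_congr_right fun ha => ?_
    constructor
    · intro h1
      by_cases h2 : tl a = ord h
      · exact .inl ⟨ha, h2⟩
      · right
        intro k hk
        rcases Nat.lt_succ_iff_lt_or_eq.1 hk with hk | rfl
        exacts [h1 k hk, Ne.symm h2]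
    · rintro (⟨-, h2⟩ | h2) k hk
      · rw [h2]
        intro h3
        have := H.inj k (by omega) h hq h3
        omega
      · exact h2 k (by omega)
  · rw [mem_fiber] at ha
    exact ⟨ha.1, h, by omega, ha.2.symm⟩

/-- The edge `e` leaves `U`, so the counter of its head drops by one. The head joins the queue
exactly when this was the last unscanned edge into it, and since its counter was positive before, it
cannot have been in the queue already. -/
theorem scan (H : TopoInv n hd tl nx h q (e + 1) ord pd U l) (hhd : ∀ a < n, hd a ≤ n) :
    e < n ∧ e ∈ U ∧ pd (hd e) ≠ 0 ∧
    (pd (hd e) - 1 ≠ 0 → TopoInv n hd tl nx h q (nx e) ord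
      (Function.update pd (hd e) (pd (hd e) - 1)) (U.erase e) l.tail) ∧
    (pd (hd e) - 1 = 0 → TopoInv n hd tl nx h (q + 1) (nx e) (Function.update ord q (hd e))
      (Function.update pd (hd e) (pd (hd e) - 1)) (U.erase e) l.tail) := by
  obtain ⟨a, l', rfl⟩ : ∃ a l', l = a :: l' := by
    cases l with
    | nil => have : e + 1 = 0 := H.linked; omega
    | cons a l => exact ⟨a, l, rfl⟩
  obtain ⟨h1, h2⟩ := H.linked
  obtain rfl : a = e := by omega
  have hnd := List.nodup_cons.1 H.nodup
  obtain ⟨ha, k₀, hk₀, hk₀'⟩ := H.mem_l a (by simp)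
  have haU : a ∈ U := (H.mem_U a).2 ⟨ha, .inl (by simp)⟩
  have hmem : ∀ b, b ∈ U.erase a ↔ b < n ∧ (b ∈ l' ∨ ∀ k < h, ord k ≠ tl b) := by
    intro b
    rw [Finset.mem_erase, H.mem_U, List.mem_cons]
    constructor
    · rintro ⟨h3, h4, (h5 | h5) | h5⟩
      exacts [(h3 h5).elim, ⟨h4, .inl h5⟩, ⟨h4, .inr h5⟩]
    · rintro ⟨h4, h5 | h5⟩
      · exact ⟨fun h => hnd.1 (h ▸ h5), h4, .inl (.inr h5)⟩
      · exact ⟨fun h => h5 k₀ hk₀ (h ▸ hk₀'), h4, .inr h5⟩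
  have hpd : ∀ w, Function.update pd (hd a) (pd (hd a) - 1) w =
      ((U.erase a).filter (hd · = w)).card := by
    intro w
    rw [Finset.filter_erase]
    by_cases hw : w = hd a
    · subst hw
      rw [Function.update_self, H.pd_eq, Finset.card_erase_of_mem (by simp [haU])]
    · rw [Function.update_of_ne hw, H.pd_eq, Finset.erase_eq_of_notMem]
      simp [Ne.symm hw]
  have hpos : pd (hd a) ≠ 0 := by
    rw [H.pd_eq]
    exact (Finset.card_pos.2 ⟨a, by simp [haU]⟩).ne'
  refine ⟨ha, haU, hpos, fun hne => ?_, fun heq => ?_⟩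
  · refine ⟨h2, hnd.2, hmem, fun b hb => H.mem_l b (List.mem_cons_of_mem _ hb), hpd, H.zero, H.le,
      H.pos, H.inj, fun w => ?_, H.exists_lt⟩
    rw [H.waiting]
    by_cases hw : w = hd a
    · subst hw; simp [hpos, hne]
    · rw [Function.update_of_ne hw]
  · have hold : ∀ k, k ≠ q → Function.update ord q (hd a) k = ord k := fun k hk =>
      Function.update_of_ne hk _ _
    have hnew : ∀ k < q, ord k ≠ hd a := by
      intro k hk h3
      rcases Nat.eq_zero_or_pos k with rfl | h4
      · have := hhd a ha
        have := H.zero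
        omega
      · exact hpos ((H.waiting _).1 ⟨k, h4, hk, h3⟩).2
    have hle := H.le
    have hqpos := H.pos
    refine ⟨h2, hnd.2, fun b => ?_, fun b hb => ?_, hpd, ?_, by omega, by omega, ?_, fun w => ?_, ?_⟩
    · rw [hmem]
      refine and_congr_right fun _ => or_congr_right <| forall₂_congr fun k hk => ?_
      rw [hold k (by omega)]
    · obtain ⟨h3, k, hk, h4⟩ := H.mem_l b (List.mem_cons_of_mem _ hb)
      exact ⟨h3, k, hk, by rw [hold k (by omega)]; exact h4⟩
    · rw [hold 0 (by omega)]; exact H.zero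
    · intro i hi j hj hij
      by_cases hiq : i = q <;> by_cases hjq : j = q
      · omega
      · subst hiq
        rw [Function.update_self, hold j hjq] at hij
        exact (hnew j (by omega) hij.symm).elim
      · subst hjq
        rw [Function.update_self, hold i hiq] at hij
        exact (hnew i (by omega) hij).elim
      · rw [hold i hiq, hold j hjq] at hij
        exact H.inj i (by omega) j (by omega) hij
    · by_cases hw : w = hd a
      · subst hw
        refine iff_of_true ⟨q, hqpos, by omega, by simp⟩ ⟨⟨a, ha, rfl⟩, by simpa using heq⟩
      · rw [Function.update_of_ne hw, ← H.waiting]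
        constructor
        · rintro ⟨k, h3, h4, h5⟩
          by_cases hkq : k = q
          · subst hkq; rw [Function.update_self] at h5; exact (hw h5.symm).elim
          · rw [hold k hkq] at h5; exact ⟨k, h3, by omega, h5⟩
        · rintro ⟨k, h3, h4, h5⟩
          exact ⟨k, h3, by omega, by rw [hold k (by omega)]; exact h5⟩
    · intro k hk b hb hbk
      by_cases hkq : k = q
      · subst hkq
        rw [Function.update_self] at hbk
        -- The new node has no unscanned incoming edge. An edge that has been scanned has a
        -- processed tail, and processed nodes precede the new one.
        have h6 := hpd (hd a)
        rw [Function.update_self, heq, eq_comm, Finset.card_eq_zero,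
          Finset.filter_eq_empty_iff] at h6
        have h7 : b ∉ U.erase a := fun h => h6 h hbk
        rw [hmem] at h7
        push Not at h7
        obtain ⟨-, k', hk', h8⟩ := h7 hb
        exact ⟨k', by omega, by rw [hold k' (by omega)]; exact h8⟩
      · rw [hold k hkq] at hbk
        obtain ⟨k', hk', h8⟩ := H.exists_lt k (by omega) b hb hbk
        exact ⟨k', hk', by rw [hold k' (by omega)]; exact h8⟩

/-- If an edge were unscanned at the end, take one of least rank in a topological numbering. Its
tail is not the source, and the edges into its tail have smaller rank and have been scanned. So the
tail is in the queue and, the queue being exhausted, has been processed; but then the edge would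
have been scanned. -/
theorem isTopo (H : TopoInv n hd tl nx q q 0 ord pd U l) {T : SPTree} (hE : Encodes n hd tl T)
    (hm : ∀ v, T.Mem v ↔ v < n) : IsTopo n hd tl q ord := by
  have hl : l = [] := by
    cases l with
    | nil => rfl
    | cons a l => have := H.linked.1; omega
  subst hl
  have hU : U = ∅ := by
    by_contra hne
    obtain ⟨ρ, hρ⟩ := exists_rank hE.nodup
    obtain ⟨a, ha, hmin⟩ := Finset.exists_min_image U ρ (Finset.nonempty_iff_ne_empty.2 hne)
    obtain ⟨han, h1⟩ := (H.mem_U a).1 ha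
    have h1 := h1.resolve_left (by simp)
    have h2 : tl a ≠ n + 1 := fun h => h1 0 H.pos (H.zero.trans h.symm)
    obtain ⟨g, hg, hga⟩ := hE.exists_hd_eq ((hm a).2 han) h2
    have h3 : pd (tl a) = 0 := by
      rw [H.pd_eq, Finset.card_eq_zero, Finset.filter_eq_empty_iff]
      intro b hb hba
      have hbn := ((H.mem_U b).1 hb).1
      have := hρ b a ((hE.arc b a ((hm b).2 hbn) ((hm a).2 han)).2 hba)
      have := hmin b hb
      omega
    obtain ⟨k, -, hk, hk'⟩ := (H.waiting (tl a)).2 ⟨⟨g, (hm g).1 hg, hga⟩, h3⟩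
    exact h1 k hk hk'
  subst hU
  refine ⟨H.zero, H.pos, H.inj, fun k h1 h2 => ((H.waiting _).1 ⟨k, h1, h2, rfl⟩).1, fun a ha => ?_,
    H.exists_lt⟩
  exact (H.waiting (hd a)).2 ⟨⟨a, ha, rfl⟩, by simp [H.pd_eq]⟩

end TopoInv

namespace WordRAM

open WordRAM.Expr WordRAM.Cmd

/-- Prepare topological sorting. -/
def topoInit : Prog := .store aOrd 0 (.reg rN + 1) ;; .set rH 0 ;; .set rQ 1 ;; .set rE 0

/-- The condition under which topological sorting continues. -/
def topoCond : Expr 16 21 := .reg rE + lt (.reg rH) (.reg rQ)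

/-- Scan an edge or process the next node. -/
def topoStep : Prog :=
  .ite (.reg rE)
    (.set rU (.cell aHd (.reg rE - 1)) ;;
      .store aPd (.reg rU) (.cell aPd (.reg rU) - 1) ;;
      .ite (.cell aPd (.reg rU)) .skip (.store aOrd (.reg rQ) (.reg rU) ;; .set rQ (.reg rQ + 1)) ;;
      .set rE (.cell aNxO (.reg rE - 1)))
    (.set rE (.cell aFsO (.cell aOrd (.reg rH))) ;; .set rH (.reg rH + 1))

/-- Sort the nodes of the multigraph topologically. -/
def topoSort : Prog := topoInit ;; .loop topoCond topoStep

theorem exec_topoSort {M : Config} {n m c : ℕ} {sz us vs : ℕ → ℕ} (hM : Setting M n m c sz us vs)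
    {σ : Mem} (hin : σ.reg rN = n) {hd tl : ℕ → ℕ} {T : SPTree} (hE : Encodes n hd tl T)
    (hm : ∀ v, T.Mem v ↔ v < n) (hhd' : ∀ a, hd a ≤ n) (hσ : EdgesAdded hd tl n σ) :
    ∃ t τ, Exec M topoSort σ t τ ∧
      t ≤ topoInit.bound + (2 * n + 2) * roundCost topoCond topoStep + 6 ∧
      IsTopo n hd tl (τ.reg rQ) (τ.arr aOrd) ∧ τ.reg rQ ≤ n + 2 := by
  have hl := hM.le_len
  have hw := hM.len_lt
  have hn := hM.n_pos
  have w1 : 1 < M.word := by omega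
  have w0 : 0 < M.word := by omega
  obtain ⟨t₀, e₀, b₀⟩ := Cmd.exec_run (M := M) (p := topoInit) (σ := σ) (by
    simp [topoInit, hin, w0, w1]
    omega)
  set nx := σ.arr aNxO with hnx
  set fs := σ.arr aFsO with hfs
  have hfib : AreFibers tl nx fs n := hσ.tails
  obtain ⟨t, τ, φ, e, ⟨U, l, -, hin, h1, h2, h3, H⟩, hb, ht⟩ :=
    exec_loop_run (M := M) (b := topoCond) (p := topoStep)
    -- Each round scans one edge or processes one of at most n + 2 nodes. At the start this
    -- potential is 2n + 2.
    (fun φ σ => ∃ U l, φ = U.card + (n + 2 - σ.reg rH) ∧ σ.reg rN = n ∧ σ.arr aHd = hd ∧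
      σ.arr aNxO = nx ∧ σ.arr aFsO = fs ∧
      TopoInv n hd tl nx (σ.reg rH) (σ.reg rQ) (σ.reg rE) (σ.arr aOrd) (σ.arr aPd) U l)
    (by
      rintro φ σ ⟨U, l, -, hin, h1, h2, h3, H⟩
      have b1 := H.le_add fun a _ => hhd' a
      have b2 : σ.reg rE ≤ n := by
        have := H.linked
        cases l with
        | nil => simp only [IsLinked] at this; omega
        | cons a l => have := (H.mem_l a (by simp)).1; have := H.linked.1; omega
      simp [topoCond, w1]
      split_ifs <;> omega)
    (by
      rintro φ σ ⟨U, l, rfl, hin, h1, h2, h3, H⟩ hv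
      have b1 := H.le_add fun a _ => hhd' a
      have b3 := H.le
      rcases Nat.eq_zero_or_pos (σ.reg rE) with c1 | c1
      · have hq : σ.reg rH < σ.reg rQ := by simpa [topoCond, c1] using hv
        have b4 := H.ord_le (fun a _ => hhd' a) hq
        rw [c1] at H
        constructor
        · simp [topoStep, c1]
          omega
        · refine ⟨U.card + (n + 2 - (σ.reg rH + 1)), by omega, U,
            fiber tl (σ.arr aOrd (σ.reg rH)) n, ?_⟩
          simpa [topoStep, c1, hin, h1, h2, h3] using H.pop hfib hq
      · obtain ⟨x, hx⟩ : ∃ x, σ.reg rE = x + 1 := ⟨σ.reg rE - 1, by omega⟩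
        rw [hx] at H
        obtain ⟨a1, a2, a3, a4, a5⟩ := H.scan fun a _ => hhd' a
        have b5 : U.card ≤ n := by
          simpa using Finset.card_le_card (t := Finset.range n) fun b hb =>
            Finset.mem_range.2 ((H.mem_U b).1 hb).1
        have b6 : σ.arr aPd (hd x) ≤ n := by
          rw [H.pd_eq]; exact (Finset.card_filter_le _ _).trans b5
        have b7 := hhd' x
        have b8 : (U.erase x).card < U.card := Finset.card_erase_lt_of_mem a2
        by_cases c2 : σ.arr aPd (hd x) - 1 = 0
        · have H' := a5 c2
          have b9 := H'.le_add fun a _ => hhd' a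
          constructor
          · simp [topoStep, hx, h1, c2]
            omega
          · refine ⟨(U.erase x).card + (n + 2 - σ.reg rH), by omega, U.erase x, l.tail, ?_⟩
            rw [c2] at H'
            simpa [topoStep, hin, hx, h1, h2, h3, c2] using H'
        · have H' := a4 c2
          constructor
          · simp [topoStep, hx, h1, c2]
            omega
          · refine ⟨(U.erase x).card + (n + 2 - σ.reg rH), by omega, U.erase x, l.tail, ?_⟩
            simpa [topoStep, hin, hx, h1, h2, h3, c2] using H')
    (2 * n + 2) (topoInit.run M σ) ⟨Finset.range n, [], by
      refine ⟨by simp [topoInit]; omega, by simp [topoInit, hin], by simp [topoInit, hσ.hd_eq],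
        by simp [topoInit, hnx], by simp [topoInit, hfs], ?_⟩
      have := TopoInv.init (n := n) (hd := hd) (tl := tl) (nx := nx)
        (ord := Function.update (σ.arr aOrd) 0 (n + 1)) (pd := σ.arr aPd) (fun a _ => hhd' a)
        (by simp) hσ.indeg_eq
      simpa [topoInit, hin] using this⟩
  obtain ⟨c1, c2⟩ : τ.reg rE = 0 ∧ ¬ τ.reg rH < τ.reg rQ := by
    simpa [topoCond] using hb
  have c3 := H.le
  rw [c1, show τ.reg rH = τ.reg rQ by omega] at H
  refine ⟨_, τ, .seq e₀ e, ?_, H.isTopo hE hm, H.le_add fun a _ => hhd' a⟩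
  -- The final test costs 5 + 1, which is the summand 6.
  have : Expr.cost topoCond = 5 := rfl
  omega

end WordRAM

/-! ### Reduction of the multigraph in topological order -/

/-- The invariant of the reduction: at the nodes before `ord k` only one incoming edge is left, and
the edges into the nodes from `ord u` on are untouched. -/
structure RedCore (n : ℕ) (hd : ℕ → ℕ) (q : ℕ) (ord : ℕ → ℕ) (T₀ : SPTree) (k u cnt : ℕ)
    (tl od inE lab typ lc rc : ℕ → ℕ) (T : SPTree) : Prop where
  enc : Encodes n hd tl T
  od_eq : od = outdeg n tl T
  forest : IsForest n cnt typ lc rc lab T T₀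
  le_cnt : n ≤ cnt
  cnt_add : cnt + T.size = 2 * n
  exists_lt : ∀ a, T.Mem a → ∀ j < q, hd a = ord j → ∃ j' < j, ord j' = tl a
  done : ∀ j, 1 ≤ j → j < k → ∀ a, T.Mem a → hd a = ord j → a = inE (ord j)
  untouched : ∀ j, u ≤ j → j < q → ∀ a < n, hd a = ord j → T.Mem a

/-- The invariant while the edges into the node `ord k` are handled: `l` is the rest of the list
of these edges, `f - 1` is the current edge if `f` is not `0`, and `mk x - 1` is the edge from `x`
to `ord k` that has been handled if `mk x` is not `0`. -/
structure RedInner (n : ℕ) (hd : ℕ → ℕ) (q : ℕ) (ord : ℕ → ℕ) (T₀ : SPTree) (nx : ℕ → ℕ)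
    (k e f cnt : ℕ) (tl od inE lab typ lc rc mk : ℕ → ℕ) (T : SPTree) (l : List ℕ) : Prop where
  core : RedCore n hd q ord T₀ k (k + 1) cnt tl od inE lab typ lc rc T
  pos : 1 ≤ k
  lt : k < q
  linked : IsLinked nx e l
  nodup : l.Nodup
  mem_l : ∀ a ∈ l, T.Mem a ∧ hd a = ord k
  current : f ≠ 0 → T.Mem (f - 1) ∧ hd (f - 1) = ord k ∧ f - 1 ∉ l ∧ ∀ x, mk x ≠ f
  marked : ∀ x, mk x ≠ 0 → T.Mem (mk x - 1) ∧ hd (mk x - 1) = ord k ∧ tl (mk x - 1) = x ∧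
    mk x - 1 ∉ l ∧ (x = n + 1 ∨ 2 ≤ od x)
  cover : ∀ a, T.Mem a → hd a = ord k → a ∈ l ∨ f = a + 1 ∨ mk (tl a) = a + 1
  last : f = 0 → ∀ x, mk x ≠ 0 → T.Mem (inE (ord k)) ∧ hd (inE (ord k)) = ord k
  exists_mem : ∃ a, T.Mem a ∧ hd a = ord k

/-- The invariant between two nodes. -/
structure RedOuter (n : ℕ) (hd : ℕ → ℕ) (q : ℕ) (ord : ℕ → ℕ) (T₀ : SPTree)
    (k cnt : ℕ) (tl od inE lab typ lc rc mk : ℕ → ℕ) (T : SPTree) : Prop where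
  core : RedCore n hd q ord T₀ k k cnt tl od inE lab typ lc rc T
  pos : 1 ≤ k
  le : k ≤ q
  unmarked : mk = fun _ => 0
  last : 2 ≤ k → tl (inE (ord (k - 1))) = n + 1 ∨ 2 ≤ od (tl (inE (ord (k - 1))))

/-! ### Correctness of the single steps of the reduction -/

section

variable {n : ℕ} {hd : ℕ → ℕ} {q : ℕ} {ord : ℕ → ℕ} {T₀ : SPTree} {nx : ℕ → ℕ} {k e f cnt : ℕ}
  {tl₀ tl od inE lab typ lc rc mk : ℕ → ℕ} {T : SPTree} {l : List ℕ}

theorem RedOuter.start (H : RedOuter n hd q ord T₀ k cnt tl od inE lab typ lc rc mk T)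
    (ht : IsTopo n hd tl₀ q ord) {fs : ℕ → ℕ} (hfs : AreFibers hd nx fs n) (hk : k < q) :
    RedInner n hd q ord T₀ nx k (fs (ord k)) 0 cnt tl od inE lab typ lc rc mk T
      (fiber hd (ord k) n) := by
  have h0 : ∀ x, mk x = 0 := fun x => congrFun H.unmarked x
  refine ⟨{ H.core with untouched := fun j hj => H.core.untouched j (by omega) }, H.pos, hk, hfs _,
    nodup_fiber _ _ _, fun a ha => ?_, fun h => (h rfl).elim, fun x hx => (hx (h0 x)).elim,
    fun a ha hak => .inl (mem_fiber.2 ⟨H.core.enc.lt a ha, hak⟩), fun _ x hx => (hx (h0 x)).elim, ?_⟩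
  · obtain ⟨h1, h2⟩ := mem_fiber.1 ha
    exact ⟨H.core.untouched k le_rfl hk a h1 h2, h2⟩
  · obtain ⟨a, h1, h2⟩ := ht.exists_edge k H.pos hk
    exact ⟨a, H.core.untouched k le_rfl hk a h1 h2, h2⟩

theorem RedInner.fetch (H : RedInner n hd q ord T₀ nx k (e + 1) 0 cnt tl od inE lab typ lc rc mk T l) :
    e < n ∧ l.length = l.tail.length + 1 ∧
    RedInner n hd q ord T₀ nx k (nx e) (e + 1) cnt tl od inE lab typ lc rc mk T l.tail := by
  obtain ⟨a, l', rfl⟩ : ∃ a l', l = a :: l' := by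
    cases l with
    | nil => have : e + 1 = 0 := H.linked; omega
    | cons a l => exact ⟨a, l, rfl⟩
  obtain ⟨h1, h2⟩ := H.linked
  obtain rfl : a = e := by omega
  have hnd := List.nodup_cons.1 H.nodup
  obtain ⟨h3, h4⟩ := H.mem_l a (by simp)
  refine ⟨H.core.enc.lt a h3, rfl, H.core, H.pos, H.lt, h2, hnd.2,
    fun b hb => H.mem_l b (List.mem_cons_of_mem _ hb), fun _ => ⟨h3, h4, hnd.1, fun x hx => ?_⟩,
    fun x hx => ?_, fun b hb hbk => ?_, fun h => by omega, H.exists_mem⟩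
  · have := (H.marked x (by omega)).2.2.2.1
    rw [hx] at this
    simp at this
  · obtain ⟨a1, a2, a3, a4, a5⟩ := H.marked x hx
    exact ⟨a1, a2, a3, fun h => a4 (List.mem_cons_of_mem _ h), a5⟩
  · rcases H.cover b hb hbk with h | h | h
    · rcases List.mem_cons.1 h with rfl | h
      exacts [.inr (.inl rfl), .inl h]
    · omega
    · exact .inr (.inr h)

theorem RedInner.tail_lt (H : RedInner n hd q ord T₀ nx k e (f + 1) cnt tl od inE lab typ lc rc mk T l)
    : ∃ j < k, ord j = tl f :=
  H.core.exists_lt f (H.current (by omega)).1 k H.lt (H.current (by omega)).2.1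

/-- The tail of the current edge precedes `ord k`, so only one edge enters it, and that edge is
remembered in `inE`. If the current edge is the only one that leaves this tail, the two edges form a
series pair. After the reduction the current edge starts at an earlier node and the step can be
repeated. -/
theorem RedInner.climb (H : RedInner n hd q ord T₀ nx k e (f + 1) cnt tl od inE lab typ lc rc mk T l)
    (ht : IsTopo n hd tl₀ q ord) (h1 : od (tl f) = 1) (h2 : tl f ≠ n + 1) :
    T.Mem (inE (tl f)) ∧ ∃ T' : SPTree, T.size = T'.size + 1 ∧
      RedInner n hd q ord T₀ nx k e (f + 1) (cnt + 1)
        (Function.update tl f (tl (inE (tl f)))) (Function.update od (tl f) 0) inE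
        (Function.update lab f cnt) (Function.update typ cnt 1)
        (Function.update lc cnt (lab (inE (tl f)))) (Function.update rc cnt (lab f)) mk T' l := by
  obtain ⟨hf, hfk, hfl, hfm⟩ := H.current (by omega)
  rw [Nat.add_sub_cancel] at hf hfk hfl
  obtain ⟨j', hj', hx⟩ := H.tail_lt
  have hlt := H.lt
  have hj1 : 1 ≤ j' := by
    rcases Nat.eq_zero_or_pos j' with rfl | h
    · exact (h2 (hx.symm.trans ht.zero)).elim
    · exact h
  obtain ⟨g, hg, hgx⟩ := H.core.enc.exists_hd_eq hf h2
  have hun : ∀ a, T.Mem a → hd a = tl f → a = g := fun a ha hax => by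
    rw [H.core.done j' hj1 hj' a ha (hax.trans hx.symm), H.core.done j' hj1 hj' g hg (hgx.trans hx.symm)]
  have hgE : inE (tl f) = g := by
    have := H.core.done j' hj1 hj' g hg (hgx.trans hx.symm)
    rw [this, hx]
  rw [hgE]
  have hod : outdeg n tl T (tl f) = 1 := by rw [← H.core.od_eq]; exact h1
  have hun' : ∀ a, T.Mem a → tl a = tl f → a = f := fun a ha hax =>
    eq_of_outdeg_eq_one H.core.enc.lt hod ha hf hax rfl
  obtain ⟨T', a1, a2, a3, a4⟩ := H.core.enc.series hf hg hgx hun' hun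
  have hgf : g ≠ f := by
    rintro rfl; exact H.core.enc.hd_ne_tl hg hgx
  have htl : tl g ≠ tl f := fun h => H.core.enc.hd_ne_tl hg (hgx.trans h.symm)
  -- The absorbed edge ends at a node before `ord k`. It is therefore neither in the list nor
  -- marked, and it does not count as an edge into an untouched node.
  have hgk : ∀ j, k ≤ j → j < q → hd g ≠ ord j := by
    intro j hj hjq h
    rw [hgx, ← hx] at h
    have := ht.inj j' (by omega) j hjq h
    omega
  refine ⟨hg, T', a3, ?_, H.pos, H.lt, H.linked, H.nodup, ?_, fun _ => ?_, ?_, ?_, fun h => by omega, ?_⟩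
  · refine ⟨a4, ?_, ?_, by have := H.core.le_cnt; omega, by have := H.core.cnt_add; omega, ?_, ?_, ?_⟩
    · rw [H.core.od_eq, outdeg_series H.core.enc.lt hf hg htl hun' a2]
    · exact H.core.forest.merge H.core.le_cnt H.core.enc.lt hg hf hgf a2 (.inr ⟨one_ne_zero, a1⟩)
    · intro a ha j hj haj
      by_cases haf : a = f
      · subst haf
        obtain ⟨j₁, b1, b2⟩ := H.core.exists_lt a hf j hj haj
        obtain ⟨j₂, b3, b4⟩ := H.core.exists_lt g hg j₁ (by omega) (hgx.trans b2.symm)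
        exact ⟨j₂, by omega, by rw [Function.update_self]; exact b4⟩
      · rw [Function.update_of_ne haf]
        exact H.core.exists_lt a ((a2 a).1 ha).1 j hj haj
    · exact fun j b1 b2 a ha => H.core.done j b1 b2 a ((a2 a).1 ha).1
    · intro j b1 b2 a ha haj
      refine (a2 a).2 ⟨H.core.untouched j b1 b2 a ha haj, ?_⟩
      rintro rfl
      exact hgk j (by omega) b2 haj
  · intro a ha
    obtain ⟨b1, b2⟩ := H.mem_l a ha
    refine ⟨(a2 a).2 ⟨b1, ?_⟩, b2⟩
    rintro rfl
    exact hgk k le_rfl hlt b2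
  · rw [Nat.add_sub_cancel]
    exact ⟨(a2 f).2 ⟨hf, hgf.symm⟩, hfk, hfl, hfm⟩
  · intro x hx
    obtain ⟨b1, b2, b3, b4, b5⟩ := H.marked x hx
    have b6 : mk x - 1 ≠ f := by
      have := hfm x; omega
    rw [Function.update_of_ne b6]
    refine ⟨(a2 _).2 ⟨b1, ?_⟩, b2, b3, b4, ?_⟩
    · intro h
      rw [h] at b2
      exact hgk k le_rfl hlt b2
    -- A marked inner node has out-degree at least 2, so the node whose out-degree drops from 1 to 0
    -- is not marked.
    · by_cases hxf : x = tl f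
      · subst hxf
        omega
      · rwa [Function.update_of_ne hxf]
  · intro a ha hak
    rcases H.cover a ((a2 a).1 ha).1 hak with h | h | h
    · exact .inl h
    · exact .inr (.inl h)
    · by_cases haf : a = f
      · exact .inr (.inl (by rw [haf]))
      · rw [Function.update_of_ne haf]; exact .inr (.inr h)
  · exact ⟨f, (a2 f).2 ⟨hf, hgf.symm⟩, hfk⟩

/-- The marked edge has the same tail and the same head as the current one, so the two form a
parallel pair. The mark is removed and the current edge is kept, because the out-degree of its tail
drops and the edge may now be able to climb. -/
theorem RedInner.merge (H : RedInner n hd q ord T₀ nx k e (f + 1) cnt tl od inE lab typ lc rc mk T l)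
    (ht : IsTopo n hd tl₀ q ord) (h1 : mk (tl f) ≠ 0) :
    T.Mem (mk (tl f) - 1) ∧ ∃ T' : SPTree, T.size = T'.size + 1 ∧
      RedInner n hd q ord T₀ nx k e (f + 1) (cnt + 1) tl
        (Function.update od (tl f) (od (tl f) - 1)) inE
        (Function.update lab f cnt) (Function.update typ cnt 0)
        (Function.update lc cnt (lab (mk (tl f) - 1))) (Function.update rc cnt (lab f))
        (Function.update mk (tl f) 0) T' l := by
  obtain ⟨hf, hfk, hfl, hfm⟩ := H.current (by omega)
  rw [Nat.add_sub_cancel] at hf hfk hfl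
  have hlt := H.lt
  obtain ⟨hg, hgk, hgt, hgl, -⟩ := H.marked _ h1
  have hgf : mk (tl f) - 1 ≠ f := by
    have := hfm (tl f); omega
  obtain ⟨g, hgE⟩ : ∃ g, g = mk (tl f) - 1 := ⟨_, rfl⟩
  rw [← hgE] at hg hgk hgt hgl hgf ⊢
  obtain ⟨T', a1, a2, a3, a4⟩ := H.core.enc.parallel hgf hg hf (hgk.trans hfk.symm) hgt
  have hgj : ∀ j, j < q → j ≠ k → hd g ≠ ord j := by
    intro j hj hjk h
    exact hjk (ht.inj j hj k hlt (h.symm.trans hgk))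
  refine ⟨hg, T', a3, ?_, H.pos, H.lt, H.linked, H.nodup, ?_, fun _ => ?_, ?_, ?_, fun h => by omega, ?_⟩
  · refine ⟨a4, ?_, ?_, by have := H.core.le_cnt; omega, by have := H.core.cnt_add; omega, ?_, ?_, ?_⟩
    · rw [H.core.od_eq, outdeg_parallel H.core.enc.lt hg a2, hgt]
    · exact H.core.forest.merge H.core.le_cnt H.core.enc.lt hg hf hgf a2 (.inl ⟨rfl, a1⟩)
    · exact fun a ha => H.core.exists_lt a ((a2 a).1 ha).1
    · exact fun j b1 b2 a ha => H.core.done j b1 b2 a ((a2 a).1 ha).1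
    · intro j b1 b2 a ha haj
      refine (a2 a).2 ⟨H.core.untouched j b1 b2 a ha haj, ?_⟩
      rintro rfl
      exact hgj j b2 (by omega) haj
  · intro a ha
    obtain ⟨b1, b2⟩ := H.mem_l a ha
    refine ⟨(a2 a).2 ⟨b1, ?_⟩, b2⟩
    rintro rfl
    exact hgl ha
  · rw [Nat.add_sub_cancel]
    refine ⟨(a2 f).2 ⟨hf, hgf.symm⟩, hfk, hfl, fun x => ?_⟩
    by_cases hx : x = tl f
    · subst hx; simp
    · rw [Function.update_of_ne hx]; exact hfm x
  · intro x hx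
    by_cases hxf : x = tl f
    · subst hxf; simp at hx
    · rw [Function.update_of_ne hxf] at hx ⊢
      rw [Function.update_of_ne hxf]
      obtain ⟨b1, b2, b3, b4, b5⟩ := H.marked x hx
      refine ⟨(a2 _).2 ⟨b1, fun h => ?_⟩, b2, b3, b4, b5⟩
      rw [h, hgt] at b3
      exact hxf b3.symm
  · intro a ha hak
    obtain ⟨ha, hag⟩ := (a2 a).1 ha
    rcases H.cover a ha hak with h | h | h
    · exact .inl h
    · exact .inr (.inl h)
    · by_cases haf : tl a = tl f
      · rw [haf] at h; omega
      · rw [Function.update_of_ne haf]; exact .inr (.inr h)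
  · exact ⟨f, (a2 f).2 ⟨hf, hgf.symm⟩, hfk⟩

/-- Neither reduction applies to the current edge: its tail is the source or has further outgoing
edges, and no handled edge shares its tail. Marking preserves that handled edges have distinct tails
of this kind. -/
theorem RedInner.mark (H : RedInner n hd q ord T₀ nx k e (f + 1) cnt tl od inE lab typ lc rc mk T l)
    (ht : IsTopo n hd tl₀ q ord) (h1 : mk (tl f) = 0) (h2 : tl f ≠ n + 1 → od (tl f) ≠ 1) :
    RedInner n hd q ord T₀ nx k e 0 cnt tl od (Function.update inE (ord k) f) lab typ lc rc
      (Function.update mk (tl f) (f + 1)) T l := by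
  obtain ⟨hf, hfk, hfl, hfm⟩ := H.current (by omega)
  rw [Nat.add_sub_cancel] at hf hfk hfl
  have hlt := H.lt
  refine ⟨{ H.core with done := fun j b1 b2 a ha haj => ?_ }, H.pos, H.lt, H.linked, H.nodup, H.mem_l,
    fun h => (h rfl).elim, fun x hx => ?_, fun a ha hak => ?_, fun _ x _ => by simp [hf, hfk],
    H.exists_mem⟩
  · have : ord j ≠ ord k := fun h => b2.ne (ht.inj j (by omega) k hlt h)
    rw [Function.update_of_ne this]
    exact H.core.done j b1 b2 a ha haj
  · by_cases hxf : x = tl f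
    · subst hxf
      simp only [Function.update_self, Nat.add_sub_cancel]
      refine ⟨hf, hfk, trivial, hfl, ?_⟩
      by_cases hx : tl f = n + 1
      · exact .inl hx
      · have := h2 hx
        have h3 := outdeg_pos (tl := tl) H.core.enc.lt hf
        rw [← H.core.od_eq] at h3
        omega
    · rw [Function.update_of_ne hxf] at hx ⊢
      exact H.marked x hx
  · rcases H.cover a ha hak with h | h | h
    · exact .inl h
    · obtain rfl : f = a := by omega
      simp
    · by_cases haf : tl a = tl f
      · rw [haf, h1] at h; omega
      · rw [Function.update_of_ne haf]; exact .inr (.inr h)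

/-- At the end every edge into `ord k` is marked. Marked edges have different tails, and each of
these tails is the source or has at least two outgoing edges. If there were two edges into `ord k`,
then `Encodes.exists_reducible` would give two of them with the same tail, or one that is the only
edge out of a tail other than the source; both are excluded. So only the edge that was marked last
remains, and clearing its mark clears the whole array. -/
theorem RedInner.finish (H : RedInner n hd q ord T₀ nx k 0 0 cnt tl od inE lab typ lc rc mk T l)
    : T.Mem (inE (ord k)) ∧ RedOuter n hd q ord T₀ (k + 1) cnt tl od inE lab typ lc rc
        (Function.update mk (tl (inE (ord k))) 0) T := by
  have hl : l = [] := by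
    cases l with
    | nil => rfl
    | cons a l => have := H.linked.1; omega
  subst hl
  have hcov : ∀ a, T.Mem a → hd a = ord k → mk (tl a) = a + 1 := fun a ha hak => by
    rcases H.cover a ha hak with h | h | h
    · simp at h
    · omega
    · exact h
  have huniq : ∀ a b, T.Mem a → T.Mem b → hd a = ord k → hd b = ord k → a = b := by
    intro a b ha hb hak hbk
    by_contra hne
    rcases H.core.enc.exists_reducible hne ha hb (hak.trans hbk.symm) with
      ⟨e', f', c1, c2, c3, c4, c5, c6⟩ | ⟨e', c1, c2, c3, c4⟩
    · have d1 := hcov e' c2 (c4.trans hak)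
      have d2 := hcov f' c3 (c5.trans hak)
      rw [c6] at d1
      omega
    · have d1 := hcov e' c1 (c2.trans hak)
      have d2 := (H.marked (tl e') (by omega)).2.2.2.2.resolve_left c3
      rw [H.core.od_eq] at d2
      obtain ⟨a', b1, b2, b3⟩ := exists_ne_of_two_le_outdeg d2 e'
      exact b3 (c4 a' b1 b2)
  obtain ⟨a, ha, hak⟩ := H.exists_mem
  obtain ⟨hz, hzk⟩ := H.last rfl (tl a) (by rw [hcov a ha hak]; omega)
  refine ⟨hz, { H.core with done := fun j b1 b2 b hb hbj => ?_ }, by omega, H.lt, ?_, fun _ => ?_⟩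
  · rcases Nat.lt_succ_iff_lt_or_eq.1 b2 with b2 | rfl
    · exact H.core.done j b1 b2 b hb hbj
    · exact huniq b _ hb hz hbj hzk
  · funext x
    by_cases hx : x = tl (inE (ord k))
    · rw [hx]; simp
    · rw [Function.update_of_ne hx]
      by_contra h0
      obtain ⟨b1, b2, b3, -⟩ := H.marked x h0
      exact hx (by rw [← b3, huniq _ _ b1 hz b2 hzk])
  · rw [Nat.add_sub_cancel]
    refine (H.marked _ ?_).2.2.2.2
    rw [hcov _ hz hzk]; omega

theorem RedCore.bounds {u : ℕ} (H : RedCore n hd q ord T₀ k u cnt tl od inE lab typ lc rc T) :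
    cnt < 2 * n ∧ (∀ a, T.Mem a → lab a < 2 * n) ∧ ∀ x, od x ≤ n := by
  have h1 := T.size_pos
  have h2 := H.cnt_add
  obtain ⟨π, h3, -⟩ := H.forest.parents
  refine ⟨by omega, fun a ha => ?_, fun x => by rw [H.od_eq]; exact outdeg_le⟩
  have := (h3 a ha).1
  omega

theorem IsTopo.le (ht : IsTopo n hd tl₀ q ord) (hhd : ∀ a, hd a ≤ n) {j : ℕ} (hj : j < q) :
    ord j ≤ n + 1 := by
  rcases Nat.eq_zero_or_pos j with rfl | h
  · exact ht.zero.le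
  · obtain ⟨a, -, ha⟩ := ht.exists_edge j h hj
    have := hhd a
    omega

/-- Every edge has one head, so the lists of incoming edges of different nodes are disjoint. This
bounds the number of fetched edges over all nodes. -/
theorem IsTopo.sum_length_fiber (ht : IsTopo n hd tl₀ q ord) :
    ∑ j ∈ Finset.Ico 1 q, (fiber hd (ord j) n).length ≤ n := by
  simp only [length_fiber]
  rw [← Finset.card_biUnion]
  · refine (Finset.card_le_card ?_).trans (Finset.card_range n).le
    intro a ha
    obtain ⟨j, -, hj⟩ := Finset.mem_biUnion.1 ha
    exact (Finset.mem_filter.1 hj).1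
  · intro i hi j hj hij
    refine Finset.disjoint_left.2 fun a ha hb => hij ?_
    rw [Finset.mem_coe, Finset.mem_Ico] at hi hj
    exact ht.inj i hi.2 j hj.2 ((Finset.mem_filter.1 ha).2.symm.trans (Finset.mem_filter.1 hb).2)

/-- The sink is the last node in topological order. -/
theorem IsTopo.ord_last (ht : IsTopo n hd tl₀ q ord) (hE : Encodes n hd tl₀ T₀)
    (hm : ∀ v, T₀.Mem v ↔ v < n) (hn : 0 < n) : 2 ≤ q ∧ ord (q - 1) = 0 := by
  obtain ⟨k, h1, h2, h3⟩ := ht.exists_eq 0 hn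
  refine ⟨by omega, ?_⟩
  obtain ⟨a, ha, hak⟩ := ht.exists_edge (q - 1) (by omega) (by omega)
  by_contra hne
  obtain ⟨g, hg, hga⟩ := hE.exists_tl_eq ((hm a).2 ha) (by omega)
  obtain ⟨j, h4, h5, h6⟩ := ht.exists_eq g ((hm g).1 hg)
  obtain ⟨j', h7, h8⟩ := ht.exists_lt j h5 g ((hm g).1 hg) h6.symm
  have := ht.inj j' (by omega) (q - 1) (by omega) (h8.trans (hga.trans hak))
  omega

/-- The sink is handled last. Afterwards one edge enters it, and the tail of this edge is the source
or has another outgoing edge; by `Encodes.eq_leaf` no other edge exists at all. The tree stored as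
its label is then equivalent to the original one. -/
theorem RedOuter.finish (H : RedOuter n hd q ord T₀ q cnt tl od inE lab typ lc rc mk T)
    (hq : 2 ≤ q) (h0 : ord (q - 1) = 0) :
    ∃ R, Equiv R T₀ ∧ Decodes n cnt typ lc rc (lab (inE 0)) R ∧ lab (inE 0) < cnt ∧ inE 0 < n ∧
      cnt < 2 * n ∧
      ∃ π : ℕ → ℕ, π (lab (inE 0)) < n ∧ ∀ j, n ≤ j → j < cnt →
        lc j < j ∧ rc j < j ∧ π (lc j) = n + 2 * j ∧ π (rc j) = n + 2 * j + 1 := by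
  have hl := H.last hq
  rw [h0] at hl
  have hT : T = leaf (inE 0) := by
    refine H.core.enc.eq_leaf (fun a ha ha0 => ?_) (hl.imp_right fun h => ?_)
    · have := H.core.done (q - 1) (by omega) (by omega) a ha (ha0.trans h0.symm)
      rwa [h0] at this
    · rw [H.core.od_eq] at h
      exact exists_ne_of_two_le_outdeg h _
  have hmem : T.Mem (inE 0) := by rw [hT]; rfl
  obtain ⟨L, h1, h2⟩ := H.core.forest.decodes
  obtain ⟨π, h3, h4⟩ := H.core.forest.parents
  refine ⟨L (inE 0), ?_, h1 _ hmem, (h3 _ hmem).1, H.core.enc.lt _ hmem, H.core.bounds.1, π,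
    by rw [(h3 _ hmem).2]; exact H.core.enc.lt _ hmem, h4⟩
  rw [hT] at h2
  exact h2

theorem SPTree.card_leaves {T : SPTree} (hT : T.Nodup) : T.leaves.card = T.size := by
  induction T with
  | leaf v => simp [leaves, size]
  | par A B ihA ihB =>
    rw [leaves, Finset.card_union_of_disjoint (IsTable.disjoint_leaves hT.2.2), ihA hT.1, ihB hT.2.1,
      size]
  | ser A B ihA ihB =>
    rw [leaves, Finset.card_union_of_disjoint (IsTable.disjoint_leaves hT.2.2), ihA hT.1, ihB hT.2.1,
      size]

theorem RedOuter.init (hE : Encodes n hd tl₀ T₀) (hm : ∀ v, T₀.Mem v ↔ v < n)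
    (ht : IsTopo n hd tl₀ q ord) (htl : ∀ j < n, tl j = tl₀ j) (hlab : ∀ j < n, lab j = j)
    (hod : ∀ x, od x = (fiber tl₀ x n).length) (hmk : mk = fun _ => 0) :
    RedOuter n hd q ord T₀ 1 n tl od inE lab typ lc rc mk T₀ := by
  have hs : T₀.size = n := by
    rw [← SPTree.card_leaves hE.nodup]
    have : T₀.leaves = Finset.range n := by
      ext v; rw [mem_leaves, hm, Finset.mem_range]
    rw [this, Finset.card_range]
  have htl' : ∀ e, T₀.Mem e → tl e = tl₀ e := fun e he => htl e ((hm e).1 he)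
  refine ⟨⟨⟨hE.nodup, hE.lt, fun e f he hf => ?_, hE.snk, fun e he => ?_⟩, ?_, ⟨⟨leaf, ?_, ?_⟩,
    id, ?_, ?_⟩, le_rfl, by omega, ?_, ?_, ?_⟩, le_rfl, ht.pos, hmk, fun h => by omega⟩
  · rw [hE.arc e f he hf, htl' f hf]
  · rw [hE.src e he, htl' e he]
  · classical
    funext x
    rw [hod, length_fiber]
    unfold outdeg
    congr 1
    ext a
    simp only [Finset.mem_filter, Finset.mem_range, hm]
    refine and_congr_right fun ha => ?_
    rw [htl a ha]
    simp [ha]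
  · exact fun e he => ⟨hlab e ((hm e).1 he), (hm e).1 he⟩
  · rw [bind_leaf]; exact .refl _
  · exact fun e he => by rw [hlab e ((hm e).1 he)]; exact ⟨(hm e).1 he, rfl⟩
  · intro j h1 h2; omega
  · intro a ha j hj haj
    rw [htl' a ha]
    exact ht.exists_lt j hj a ((hm a).1 ha) haj
  · intro j h1 h2; omega
  · exact fun j _ _ a ha _ => (hm a).2 ha

end

/-! ### The program: reducing the multigraph to one edge -/

namespace WordRAM

open WordRAM.Expr WordRAM.Cmd

/-- Create a new node of the decomposition tree that becomes the label of the edge `rF - 1`. -/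
def newNode (a : ℕ) (e : Expr 16 21) : Prog :=
  .store aTy (.reg rT) (.const a) ;;
  .store aLc (.reg rT) (.cell aLab e) ;;
  .store aRc (.reg rT) (.cell aLab (.reg rF - 1)) ;;
  .store aLab (.reg rF - 1) (.reg rT) ;;
  .set rT (.reg rT + 1)

/-- Series reduction of the edge `rF - 1`. -/
def climbEdge : Prog :=
  newNode 1 (.cell aIn (.reg rU)) ;;
  .store aTl (.reg rF - 1) (.cell aTl (.cell aIn (.reg rU))) ;;
  .store aOd (.reg rU) 0

/-- Parallel reduction of the edge `rF - 1`. -/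
def mergeEdge : Prog :=
  newNode 0 (.cell aMk (.reg rU) - 1) ;;
  .store aOd (.reg rU) (.cell aOd (.reg rU) - 1) ;;
  .store aMk (.reg rU) 0

/-- Mark the edge `rF - 1` as handled. -/
def markEdge : Prog :=
  .store aMk (.reg rU) (.reg rF) ;; .store aIn (.reg rV) (.reg rF - 1) ;; .set rF 0

/-- One step of the handling of the edges into the node `rV`. -/
def reduceStep : Prog :=
  .ite (.reg rF)
    (.set rU (.cell aTl (.reg rF - 1)) ;;
      .ite (lt (eq (.reg rU) (.reg rN + 1)) (eq (.cell aOd (.reg rU)) 1)) climbEdge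
        (.ite (.cell aMk (.reg rU)) mergeEdge markEdge))
    (.set rF (.reg rE) ;; .set rE (.cell aNxI (.reg rE - 1)))

theorem exec_reduceSteps {M : Config} {n m c : ℕ} {sz us vs : ℕ → ℕ} (hM : Setting M n m c sz us vs)
    {hd tl₀ nx : ℕ → ℕ} {q k : ℕ} {ord : ℕ → ℕ} {T₀ T : SPTree} {l : List ℕ}
    (ht : IsTopo n hd tl₀ q ord) (hhd : ∀ a, hd a ≤ n) {σ : Mem} (hin : σ.reg rN = n)
    (hv : σ.reg rV = ord k) (hnx : σ.arr aNxI = nx) (hf : σ.reg rF = 0)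
    (H : RedInner n hd q ord T₀ nx k (σ.reg rE) 0 (σ.reg rT) (σ.arr aTl) (σ.arr aOd)
      (σ.arr aIn) (σ.arr aLab) (σ.arr aTy) (σ.arr aLc) (σ.arr aRc) (σ.arr aMk) T l) :
    ∃ t τ T', Exec M (.loop (.reg rE + .reg rF) reduceStep) σ t τ ∧
      t + T'.size * roundCost (.reg rE + .reg rF) reduceStep ≤
        (T.size + 2 * l.length) * roundCost (.reg rE + .reg rF) reduceStep + 4 ∧
      RedInner n hd q ord T₀ nx k 0 0 (τ.reg rT) (τ.arr aTl) (τ.arr aOd)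
        (τ.arr aIn) (τ.arr aLab) (τ.arr aTy) (τ.arr aLc) (τ.arr aRc) (τ.arr aMk) T' [] := by
  have hl := hM.le_len
  have hw := hM.len_lt
  have hn := hM.n_pos
  have w1 : 1 < M.word := by omega
  have w0 : 0 < M.word := by omega
  obtain ⟨t, τ, φ, e, ⟨T', l', hφ, -, -, -, H'⟩, hb, hle⟩ :=
    exec_loop_run (M := M) (b := .reg rE + .reg rF) (p := reduceStep)
    -- Every round lowers this potential by at least one: fetching an edge pays 2 for its list entry
    -- and gets 1 back for the current edge, a reduction removes a leaf of the tree, and marking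
    -- gives up the current edge.
    (fun φ σ => ∃ T l, φ = T.size + 2 * l.length + (if σ.reg rF = 0 then 0 else 1) ∧
      σ.reg rN = n ∧ σ.reg rV = ord k ∧ σ.arr aNxI = nx ∧
      RedInner n hd q ord T₀ nx k (σ.reg rE) (σ.reg rF) (σ.reg rT) (σ.arr aTl) (σ.arr aOd)
        (σ.arr aIn) (σ.arr aLab) (σ.arr aTy) (σ.arr aLc) (σ.arr aRc) (σ.arr aMk) T l)
    (by
      rintro φ σ ⟨T, l, -, hin, hv, hnx, H⟩
      have b1 : σ.reg rE ≤ n := by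
        have := H.linked
        cases l with
        | nil => simp only [IsLinked] at this; omega
        | cons a l => have := H.core.enc.lt a (H.mem_l a (by simp)).1; have := H.linked.1; omega
      have b2 : σ.reg rF ≤ n := by
        by_cases h0 : σ.reg rF = 0
        · omega
        · have := H.core.enc.lt _ (H.current h0).1; omega
      simp
      omega)
    (by
      rintro φ σ ⟨T, l, rfl, hin, hv, hnx, H⟩ hne
      have b4 := ht.le hhd H.lt
      rcases Nat.eq_zero_or_pos (σ.reg rF) with c1 | c1
      · obtain ⟨x, hx⟩ : ∃ x, σ.reg rE = x + 1 :=
          ⟨σ.reg rE - 1, by have : σ.reg rE ≠ 0 := by simpa [c1] using hne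
                            omega⟩
        rw [c1, hx] at H
        obtain ⟨b1, b2, H'⟩ := H.fetch
        constructor
        · simp [reduceStep, c1, hx, w1]
          omega
        · refine ⟨T.size + 2 * l.tail.length + 1, by simp [c1]; omega, T, l.tail, ?_⟩
          simpa [reduceStep, c1, hx, hin, hv, hnx] using H'
      · obtain ⟨x, hx⟩ : ∃ x, σ.reg rF = x + 1 := ⟨σ.reg rF - 1, by omega⟩
        rw [hx] at H
        obtain ⟨j, hj, hjx⟩ := H.tail_lt
        have b5 : σ.arr aTl x ≤ n + 1 := by
          rw [← hjx]; exact ht.le hhd (hj.trans H.lt)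
        have b6 := H.core.enc.lt _ (H.current (by omega)).1
        obtain ⟨b7, b8, b9⟩ := H.core.bounds
        have b10 := b9 (σ.arr aTl x)
        rw [Nat.add_sub_cancel] at b6
        by_cases c2 : σ.arr aTl x ≠ n + 1 ∧ σ.arr aOd (σ.arr aTl x) = 1
        · obtain ⟨d1, T', d2, H'⟩ := H.climb ht c2.2 c2.1
          have d3 := H.core.enc.lt _ d1
          constructor
          · simp [reduceStep, climbEdge, newNode, hx, hin, c2, w0, w1]
            omega
          · refine ⟨T'.size + 2 * l.length + 1, by simp [hx]; omega, T', l, ?_⟩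
            simpa [reduceStep, climbEdge, newNode, hx, hin, hv, hnx, c2] using H'
        -- For truth values 0 and 1 the test `a < b` says that `a` fails and `b` holds. In this way
        -- the program expresses a conjunction with a negation.
        · have c2' : ¬ (if σ.arr aTl x = n + 1 then 1 else 0) <
              (if σ.arr aOd (σ.arr aTl x) = 1 then 1 else 0) := by
            split_ifs <;> simp_all
          by_cases c3 : σ.arr aMk (σ.arr aTl x) = 0
          · have H' := H.mark ht c3 (by tauto)
            constructor
            · simp [reduceStep, markEdge, hx, hin, hv, c2', c3, w0, w1]
              omega
            · refine ⟨T.size + 2 * l.length, by simp [hx], T, l, ?_⟩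
              simpa [reduceStep, markEdge, hx, hin, hv, hnx, c2', c3] using H'
          · obtain ⟨d1, T', d2, H'⟩ := H.merge ht c3
            have d3 := H.core.enc.lt _ d1
            constructor
            · simp [reduceStep, mergeEdge, newNode, hx, hin, c2', c3, w0, w1]
              omega
            · refine ⟨T'.size + 2 * l.length + 1, by simp [hx]; omega, T', l, ?_⟩
              simpa [reduceStep, mergeEdge, newNode, hx, hin, hv, hnx, c2', c3] using H')
    (T.size + 2 * l.length) σ ⟨T, l, by simp [hf], hin, hv, hnx, by rwa [hf]⟩
  obtain ⟨c1, c2⟩ : τ.reg rE = 0 ∧ τ.reg rF = 0 := by simpa using hb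
  rw [c1, c2] at H'
  obtain rfl : l' = [] := by
    cases l' with
    | nil => rfl
    | cons a l => have := H'.linked.1; omega
  refine ⟨t, τ, T', e, ?_, H'⟩
  have : Expr.cost (.reg rE + .reg rF : Expr 16 21) = 3 := rfl
  rw [hφ] at hle
  simp only [c2, if_true, List.length_nil] at hle
  simpa [this] using hle

/-- Start handling the edges into the node with the number `rI`. -/
def enterNode : Prog :=
  .set rV (.cell aOrd (.reg rI)) ;; .set rE (.cell aFsI (.reg rV)) ;; .set rF 0

/-- Finish handling the edges into the node with the number `rI`. -/
def leaveNode : Prog :=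
  .store aMk (.cell aTl (.cell aIn (.reg rV))) 0 ;; .set rI (.reg rI + 1)

/-- Handle the node with the number `rI`. -/
def reduceNode : Prog := enterNode ;; .loop (.reg rE + .reg rF) reduceStep ;; leaveNode

/-- Prepare the reduction. -/
def reduceInit : Prog := .set rI 1 ;; .set rT (.reg rN)

/-- Reduce the multigraph to one edge, which is labelled by the root of a decomposition tree. -/
def reduceAll : Prog := reduceInit ;; .loop (lt (.reg rI) (.reg rQ)) reduceNode

theorem exec_reduceAll {M : Config} {n m c : ℕ} {sz us vs : ℕ → ℕ} (hM : Setting M n m c sz us vs)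
    {σ : Mem} (hin : σ.reg rN = n) {hd tl : ℕ → ℕ} {T₀ : SPTree} (hE : Encodes n hd tl T₀)
    (hm : ∀ v, T₀.Mem v ↔ v < n) (hhd : ∀ a, hd a ≤ n)
    (ht : IsTopo n hd tl (σ.reg rQ) (σ.arr aOrd)) (hq : σ.reg rQ ≤ n + 2)
    (htl : ∀ j < n, σ.arr aTl j = tl j) (hlab : ∀ j < n, σ.arr aLab j = j)
    (hfs : AreFibers hd (σ.arr aNxI) (σ.arr aFsI) n)
    (hod : ∀ x, σ.arr aOd x = (fiber tl x n).length) (hmk : σ.arr aMk = fun _ => 0) :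
    ∃ t τ, Exec M reduceAll σ t τ ∧
      t ≤ reduceInit.bound + 3 * n * roundCost (.reg rE + .reg rF) reduceStep +
        (n + 2) * (enterNode.bound + leaveNode.bound + 8) + 4 ∧
      ∃ R, SPTree.Equiv R T₀ ∧
        Decodes n (τ.reg rT) (τ.arr aTy) (τ.arr aLc) (τ.arr aRc) (τ.arr aLab (τ.arr aIn 0)) R ∧
        τ.arr aLab (τ.arr aIn 0) < τ.reg rT ∧ τ.arr aIn 0 < n ∧ n ≤ τ.reg rT ∧ τ.reg rT < 2 * n ∧
        ∃ π : ℕ → ℕ, π (τ.arr aLab (τ.arr aIn 0)) < n ∧ ∀ j, n ≤ j → j < τ.reg rT → τ.arr aLc j < j ∧ τ.arr aRc j < j ∧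
          π (τ.arr aLc j) = n + 2 * j ∧ π (τ.arr aRc j) = n + 2 * j + 1 := by
  have hl := hM.le_len
  have hw := hM.len_lt
  have hn := hM.n_pos
  have w1 : 1 < M.word := by omega
  have w0 : 0 < M.word := by omega
  obtain ⟨t₀, e₀, b₀⟩ := Cmd.exec_run (M := M) (p := reduceInit) (σ := σ) (by
    simp [reduceInit, w1])
  obtain ⟨κ, hκ⟩ : ∃ κ, κ = roundCost (.reg rE + .reg rF : Expr 16 21) reduceStep := ⟨_, rfl⟩
  rw [← hκ]
  set q := σ.reg rQ with hq'
  set ord := σ.arr aOrd with hord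
  set nx := σ.arr aNxI with hnx
  set fs := σ.arr aFsI with hfs'
  obtain ⟨t, τ, φ, e, ⟨T, k, hφ, hk, hin, h1, h2, h3, h4, H⟩, hb, hle⟩ :=
    exec_loop (M := M) (b := lt (.reg rI) (.reg rQ)) (p := reduceNode)
    -- The size of the tree is carried from node to node, so reductions are paid for globally: n
    -- leaves at the start and 2 units for each of at most n list entries give 3n rounds in total.
    -- The 8 per node is 4 for the final test of the inner loop and 4 for the test of the outer
    -- loop.
    (fun φ σ => ∃ T k, φ = (T.size + 2 * ∑ j ∈ Finset.Ico k q, (fiber hd (ord j) n).length) * κ +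
        (q - k) * (enterNode.bound + leaveNode.bound + 8) ∧
      σ.reg rI = k ∧ σ.reg rN = n ∧ σ.reg rQ = q ∧ σ.arr aOrd = ord ∧ σ.arr aNxI = nx ∧
      σ.arr aFsI = fs ∧
      RedOuter n hd q ord T₀ k (σ.reg rT) (σ.arr aTl) (σ.arr aOd)
        (σ.arr aIn) (σ.arr aLab) (σ.arr aTy) (σ.arr aLc) (σ.arr aRc) (σ.arr aMk) T)
    (by
      rintro φ σ ⟨T, k, -⟩
      simp [w1])
    (by
      rintro φ σ ⟨T, k, rfl, hk, hin, h1, h2, h3, h4, H⟩ hne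
      have hlt : k < q := by simpa [hk, h1] using hne
      have b1 := ht.le hhd hlt
      obtain ⟨t₁, e₁, b₁⟩ := Cmd.exec_run (M := M) (p := enterNode) (σ := σ) (by
        simp [enterNode, hk, h2, w0]
        omega)
      have H1 := H.start ht hfs hlt
      obtain ⟨t₂, τ, T', e₂, b₂, H2⟩ := exec_reduceSteps hM (nx := nx) (k := k) ht hhd
        (σ := enterNode.run M σ) (T₀ := T₀) (T := T) (l := fiber hd (ord k) n)
        (by simpa [enterNode] using hin) (by simp [enterNode, hk, h2])
        (by simpa [enterNode] using h3) (by simp [enterNode])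
        (by simpa [enterNode, hk, h2, h3, h4] using H1)
      obtain ⟨hmem, H3⟩ := H2.finish
      have hv : τ.reg rV = ord k := by
        rw [e₂.reg_eq (by rfl)]; simp [enterNode, hk, h2]
      have hi : τ.reg rI = k := by
        rw [e₂.reg_eq (by rfl)]; simpa [enterNode] using hk
      have b3 := H2.core.enc.lt _ hmem
      obtain ⟨j, hj, hjx⟩ := H2.core.exists_lt _ hmem k H2.lt (by
        have := H2.last rfl
        by_contra hne
        obtain ⟨a, ha, hak⟩ := H2.exists_mem
        rcases H2.cover a ha hak with h | h | h
        · simp at h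
        · omega
        · exact hne (this _ (by rw [h]; omega)).2)
      have b4 := ht.le hhd (hj.trans H2.lt)
      rw [hjx] at b4
      obtain ⟨t₃, e₃, b₃⟩ := Cmd.exec_run (M := M) (p := leaveNode) (σ := τ) (by
        simp [leaveNode, hv, hi, w0, w1]
        omega)
      have e' := Exec.seq e₁ (Exec.seq e₂ e₃)
      refine ⟨_, _, _, e', ⟨T', k + 1, rfl, ?_, ?_, ?_, ?_, ?_, ?_, ?_⟩, ?_⟩
      · simp [leaveNode, hi]
      · rw [e'.reg_eq (by rfl), hin]
      · rw [e'.reg_eq (by rfl), h1]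
      · rw [e'.arr_eq (by rfl), h2]
      · rw [e'.arr_eq (by rfl), h3]
      · rw [e'.arr_eq (by rfl), h4]
      · simpa [leaveNode, hv] using H3
      · rw [← hκ] at b₂
        have h5 : q - k = q - (k + 1) + 1 := by omega
        rw [Finset.sum_eq_sum_Ico_succ_bot hlt, h5]
        have h6 : Expr.cost (lt (.reg rI) (.reg rQ) : Expr 16 21) = 3 := rfl
        rw [h6]
        nlinarith)
    ((n + 2 * ∑ j ∈ Finset.Ico 1 q, (fiber hd (ord j) n).length) * κ +
        (q - 1) * (enterNode.bound + leaveNode.bound + 8)) (reduceInit.run M σ) ⟨T₀, 1, by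
      have H := RedOuter.init (typ := σ.arr aTy) (lc := σ.arr aLc) (rc := σ.arr aRc)
        (inE := σ.arr aIn) hE hm ht htl hlab hod hmk
      have hs : T₀.size = n := by have := H.core.cnt_add; omega
      rw [hs]
      refine ⟨rfl, by simp [reduceInit], by simpa [reduceInit] using hin, by simp [reduceInit, hq'],
        by simp [reduceInit, hord], by simp [reduceInit, hnx], by simp [reduceInit, hfs'], ?_⟩
      simpa [reduceInit, hin] using H⟩
  obtain rfl : k = q := by
    have : ¬ k < q := by simpa [hk, h1] using hb
    have := H.le
    omega
  obtain ⟨c1, c2⟩ := ht.ord_last hE hm hn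
  obtain ⟨R, d1, d2, d3, d4, d5, d6⟩ := H.finish c1 c2
  refine ⟨_, τ, .seq e₀ e, ?_, R, d1, d2, d3, d4, H.core.le_cnt, d5, d6⟩
  have h5 := ht.sum_length_fiber
  have h6 : Expr.cost (lt (.reg rI) (.reg rQ) : Expr 16 21) = 3 := rfl
  rw [h6] at hle
  have h7 : (n + 2 * ∑ j ∈ Finset.Ico 1 q, (fiber hd (ord j) n).length) * κ ≤ 3 * n * κ :=
    Nat.mul_le_mul_right _ (by omega)
  have h8 : (q - 1) * (enterNode.bound + leaveNode.bound + 8) ≤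
      (n + 2) * (enterNode.bound + leaveNode.bound + 8) := Nat.mul_le_mul_right _ (by omega)
  omega

end WordRAM

/-! ### Filling the table of the dynamic program -/

/-- The encoding of the combination of `p₁` and `p₂`. -/
def combination (c ty p₁ p₂ : ℕ) : ℕ :=
  (if ty = 0 then bit c p₁ * bit c p₂ else bit c p₂) * (c + 1) + (amount c p₁ + amount c p₂)

/-- The condition under which `p₁` and `p₂` can be combined. -/
def Fits (c ty t p₁ p₂ : ℕ) : Prop :=
  amount c p₁ + amount c p₂ ≤ c ∧ (ty ≠ 0 → bit c p₁ ≠ 0 → p₂ = c + 1 + t)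

theorem bit_le_one (c p : ℕ) : bit c p ≤ 1 := by
  unfold bit; split_ifs <;> omega

theorem combines_iff {c ty t p₁ p₂ p : ℕ} :
    Combines c ty t p₁ p₂ p ↔ Fits c ty t p₁ p₂ ∧ p = combination c ty p₁ p₂ := by
  unfold Combines Fits combination
  by_cases h : ty = 0 <;> simp [h]
  tauto

theorem Fits.combination_lt {c ty t p₁ p₂ : ℕ} (h : Fits c ty t p₁ p₂) :
    combination c ty p₁ p₂ < 2 * (c + 1) := by
  have h1 := h.1
  have h2 : (if ty = 0 then bit c p₁ * bit c p₂ else bit c p₂) ≤ 1 := by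
    split_ifs
    · exact Nat.mul_le_mul (bit_le_one c p₁) (bit_le_one c p₂)
    · exact bit_le_one c p₂
  have h3 := Nat.mul_le_mul_right (c + 1) h2
  unfold combination
  omega

/-- Row of the table for an inner node after all pairs that precede `(P, R)` lexicographically. -/
structure PairInv (c ty t : ℕ) (D₁ D₂ : ℕ → ℕ) (P R : ℕ) (d x y : ℕ → ℕ) : Prop where
  sound : ∀ p < 2 * (c + 1), d p ≠ 0 → x p < 2 * (c + 1) ∧ y p < 2 * (c + 1) ∧ D₁ (x p) ≠ 0 ∧
    D₂ (y p) ≠ 0 ∧ Combines c ty t (x p) (y p) p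
  complete : ∀ p₁ < 2 * (c + 1), ∀ p₂ < 2 * (c + 1), (p₁ < P ∨ p₁ = P ∧ p₂ < R) → D₁ p₁ ≠ 0 →
    D₂ p₂ ≠ 0 → ∀ p, Combines c ty t p₁ p₂ p → d p ≠ 0

namespace PairInv

variable {c ty t P R : ℕ} {D₁ D₂ d x y : ℕ → ℕ}

theorem init : PairInv c ty t D₁ D₂ 0 0 (fun _ => 0) x y :=
  ⟨fun p _ h => (h rfl).elim, fun p₁ _ p₂ _ h => by omega⟩

theorem skip (H : PairInv c ty t D₁ D₂ P R d x y)
    (h : ¬ (D₁ P ≠ 0 ∧ D₂ R ≠ 0 ∧ Fits c ty t P R)) : PairInv c ty t D₁ D₂ P (R + 1) d x y := by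
  refine ⟨H.sound, fun p₁ h1 p₂ h2 hlt a1 a2 p hp => ?_⟩
  by_cases hR : p₁ = P ∧ p₂ = R
  · obtain ⟨rfl, rfl⟩ := hR
    exact (h ⟨a1, a2, (combines_iff.1 hp).1⟩).elim
  · exact H.complete p₁ h1 p₂ h2 (by omega) a1 a2 p hp

/-- Overwriting an entry that has been set before does no harm, because the new pair of witnesses is
as valid as the old one. -/
theorem add (H : PairInv c ty t D₁ D₂ P R d x y) (hP : P < 2 * (c + 1)) (hR : R < 2 * (c + 1))
    (h1 : D₁ P ≠ 0) (h2 : D₂ R ≠ 0) (h : Fits c ty t P R) :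
    PairInv c ty t D₁ D₂ P (R + 1) (Function.update d (combination c ty P R) 1)
      (Function.update x (combination c ty P R) P) (Function.update y (combination c ty P R) R) := by
  refine ⟨fun p hp hd => ?_, fun p₁ h1 p₂ h2 hlt a1 a2 p hp => ?_⟩
  · by_cases hpc : p = combination c ty P R
    · subst hpc
      simp only [Function.update_self]
      exact ⟨hP, hR, h1, h2, combines_iff.2 ⟨h, rfl⟩⟩
    · simp only [Function.update_of_ne hpc] at hd ⊢
      exact H.sound p hp hd
  · by_cases hpc : p = combination c ty P R
    · subst hpc; simp
    · rw [Function.update_of_ne hpc]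
      refine H.complete p₁ h1 p₂ h2 ?_ a1 a2 p hp
      by_cases hR : p₁ = P ∧ p₂ = R
      · obtain ⟨rfl, rfl⟩ := hR
        exact (hpc (combines_iff.1 hp).2).elim
      · omega

theorem carry (H : PairInv c ty t D₁ D₂ P (2 * (c + 1)) d x y) :
    PairInv c ty t D₁ D₂ (P + 1) 0 d x y :=
  ⟨H.sound, fun p₁ h1 p₂ h2 hlt => H.complete p₁ h1 p₂ h2 (by omega)⟩

theorem congr {D₁' D₂' : ℕ → ℕ} (H : PairInv c ty t D₁ D₂ P R d x y)
    (h1 : ∀ p < 2 * (c + 1), D₁' p = D₁ p) (h2 : ∀ p < 2 * (c + 1), D₂' p = D₂ p) :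
    PairInv c ty t D₁' D₂' P R d x y := by
  refine ⟨fun p hp hd => ?_, fun p₁ hp₁ p₂ hp₂ hlt a1 a2 => ?_⟩
  · obtain ⟨b1, b2, b3, b4, b5⟩ := H.sound p hp hd
    rw [h1 _ b1, h2 _ b2]
    exact ⟨b1, b2, b3, b4, b5⟩
  · rw [h1 _ hp₁] at a1
    rw [h2 _ hp₂] at a2
    exact H.complete p₁ hp₁ p₂ hp₂ hlt a1 a2

end PairInv

/-- Row `i` of a table with `w` columns that is stored row by row. -/
def row (w : ℕ) (g : ℕ → ℕ) (i p : ℕ) : ℕ := g (i * w + p)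

theorem row_update_self (w : ℕ) (g : ℕ → ℕ) (i b v : ℕ) :
    row w (Function.update g (i * w + b) v) i = Function.update (row w g i) b v := by
  funext p
  simp [row, Function.update_apply]

/-- This serves both for range checks and for the separation of different rows in row-by-row
storage. -/
theorem add_lt_mul {i j w p : ℕ} (h : i < j) (hp : p < w) : i * w + p < j * w := by
  have := Nat.mul_le_mul_right w h
  rw [Nat.succ_mul] at this
  omega

/-- The table is complete except for row `i`, which is filled according to `P`. -/
theorem IsTable.succ {n i c : ℕ} {sz typ lc rc tot tot' : ℕ → ℕ} {D X Y D' X' Y' : ℕ → ℕ → ℕ}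
    (H : IsTable n i c sz typ lc rc tot D X Y) (hi : n ≤ i)
    (hlt : ∀ j, n ≤ j → j ≤ i → lc j < j ∧ rc j < j) (ht : ∀ j < i, tot' j = tot j)
    (ht' : tot' i = min (tot (lc i) + tot (rc i)) (c + 1))
    (hD : ∀ j < i, ∀ p < 2 * (c + 1), D' j p = D j p)
    (hX : ∀ j < i, ∀ p < 2 * (c + 1), X' j p = X j p)
    (hY : ∀ j < i, ∀ p < 2 * (c + 1), Y' j p = Y j p)
    (h : PairInv c (typ i) (tot (rc i)) (D (lc i)) (D (rc i)) (2 * (c + 1)) 0 (D' i) (X' i) (Y' i)) :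
    IsTable n (i + 1) c sz typ lc rc tot' D' X' Y' := by
  refine ⟨fun j hj => ?_, fun j h1 h2 => ?_, fun j hj p hp => ?_, fun j h1 h2 p hp hd => ?_,
    fun j h1 h2 p₁ hp₁ p₂ hp₂ a1 a2 p hp => ?_⟩
  · rw [ht j (by omega), H.tot_leaf j hj]
  · obtain ⟨c1, c2⟩ := hlt j h1 (by omega)
    rw [ht (lc j) (by omega), ht (rc j) (by omega)]
    rcases Nat.lt_succ_iff_lt_or_eq.1 h2 with h2 | rfl
    · rw [ht j h2, H.tot_node j h1 h2]
    · exact ht'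
  · rw [hD j (by omega) p hp, H.leaf j hj p hp]
  · obtain ⟨c1, c2⟩ := hlt j h1 (by omega)
    rw [ht (rc j) (by omega)]
    rcases Nat.lt_succ_iff_lt_or_eq.1 h2 with h2 | rfl
    · rw [hD j h2 p hp] at hd
      obtain ⟨b1, b2, b3, b4, b5⟩ := H.sound j h1 h2 p hp hd
      rw [hX j h2 p hp, hY j h2 p hp, hD _ (by omega) _ b1, hD _ (by omega) _ b2]
      exact ⟨b1, b2, b3, b4, b5⟩
    · obtain ⟨b1, b2, b3, b4, b5⟩ := h.sound p hp hd
      rw [hD _ c1 _ b1, hD _ c2 _ b2]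
      exact ⟨b1, b2, b3, b4, b5⟩
  · obtain ⟨c1, c2⟩ := hlt j h1 (by omega)
    rw [ht (rc j) (by omega)] at hp
    rw [hD _ (by omega) _ hp₁] at a1
    rw [hD _ (by omega) _ hp₂] at a2
    rcases Nat.lt_succ_iff_lt_or_eq.1 h2 with h2 | rfl
    · have h3 := (combines_iff.1 hp).1.combination_lt
      rw [← (combines_iff.1 hp).2] at h3
      rw [hD j h2 p h3]
      exact H.complete j h1 h2 p₁ hp₁ p₂ hp₂ a1 a2 p hp
    · exact h.complete p₁ hp₁ p₂ hp₂ (.inl hp₁) a1 a2 p hp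

/-! ### Rows of the leaves and the treatment of one pair of entries -/

namespace WordRAM

open WordRAM.Expr WordRAM.Cmd

/-- Fill the row of the leaf `rI`. -/
def leafRow : Prog :=
  .set rU (.input (3 + .reg rI)) ;;
  .ite (lt (.reg rC) (.reg rU)) (.store aTot (.reg rI) (.reg rC + 1))
    (.store aTot (.reg rI) (.reg rU) ;;
      .store aD (.reg rI * .reg rW + (.reg rC + 1 + .reg rU)) 1) ;;
  .store aD (.reg rI * .reg rW) 1 ;;
  .set rI (.reg rI + 1)

/-- Prepare the dynamic program. -/
def leafInit : Prog := .set rW (2 * (.reg rC + 1)) ;; .set rI 0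

/-- Fill the rows of all leaves. -/
def leafRows : Prog := leafInit ;; .loop (lt (.reg rI) (.reg rN)) leafRow

theorem exec_leafRows {M : Config} {n m c : ℕ} {sz us vs : ℕ → ℕ} (hM : Setting M n m c sz us vs)
    {σ : Mem} (hin : σ.reg rN = n) (hc : σ.reg rC = c) (hD : σ.arr aD = fun _ => 0)
    {typ lc rc : ℕ → ℕ} {X Y : ℕ → ℕ → ℕ} :
    ∃ t τ, Exec M leafRows σ t τ ∧
      t ≤ leafInit.bound + n * roundCost (lt (.reg rI) (.reg rN)) leafRow + 4 ∧
      τ.reg rI = n ∧ τ.reg rW = 2 * (c + 1) ∧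
      (∀ x, n * (2 * (c + 1)) ≤ x → τ.arr aD x = 0) ∧
      IsTable n n c sz typ lc rc (τ.arr aTot) (row (2 * (c + 1)) (τ.arr aD)) X Y := by
  have hl := hM.le_len
  have hw := hM.len_lt
  -- A decomposition tree has fewer than 2n nodes, and each has a row of 2(c + 1) entries.
  have hlen : M.len = 2 * n * (2 * (c + 1)) := by rw [hM.len]; ring
  have w1 : 1 < M.word := by omega
  have w0 : 0 < M.word := by omega
  obtain ⟨t₀, e₀, b₀⟩ := Cmd.exec_run (M := M) (p := leafInit) (σ := σ) (by
    simp [leafInit, hc, w0, w1]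
    omega)
  obtain ⟨t, τ, φ, e, ⟨i, -, hi, hin, hc, hW, hle, h1, h2, h3⟩, hb, ht⟩ :=
    exec_loop_run (M := M) (b := lt (.reg rI) (.reg rN)) (p := leafRow)
    (fun φ σ => ∃ i, φ = n - i ∧ σ.reg rI = i ∧ σ.reg rN = n ∧ σ.reg rC = c ∧
      σ.reg rW = 2 * (c + 1) ∧ i ≤ n ∧ (∀ x, i * (2 * (c + 1)) ≤ x → σ.arr aD x = 0) ∧
      (∀ j < i, σ.arr aTot j = min (sz j) (c + 1)) ∧
      ∀ j < i, ∀ p < 2 * (c + 1), row (2 * (c + 1)) (σ.arr aD) j p ≠ 0 ↔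
        p = 0 ∨ sz j ≤ c ∧ p = c + 1 + sz j)
    (by
      rintro φ σ ⟨i, -⟩
      simp [w1])
    (by
      rintro φ σ ⟨i, rfl, hi, hin, hc, hW, hle, h1, h2, h3⟩ hv
      have hlt : i < n := by simpa [hi, hin] using hv
      have q1 := hM.read_size i hlt
      have q2 := hM.size_lt i hlt
      have q3 := hM.length
      have q4 := add_lt_mul (i := i) (j := 2 * n) (w := 2 * (c + 1)) (p := 2 * c + 1) (by omega)
        (by omega)
      rw [← hlen] at q4
      have q5 := add_one_mul i (2 * (c + 1))
      have ok : leafRow.Ok M σ := by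
        by_cases c1 : c < sz i
        · simp [leafRow, hi, hW, hc, q1, q2, c1, w1]
          omega
        · simp [leafRow, hi, hW, hc, q1, q2, c1, w1]
          omega
      obtain ⟨t', ex, -⟩ := Cmd.exec_run ok
      refine ⟨ok, n - (i + 1), by omega, i + 1, rfl, ?_, by rw [ex.reg_eq (by rfl), hin],
        by rw [ex.reg_eq (by rfl), hc], by rw [ex.reg_eq (by rfl), hW], hlt, fun x hx => ?_,
        fun j hj => ?_, fun j hj p hp => ?_⟩
      · by_cases c1 : c < sz i <;> simp [leafRow, hi, hc, q1, c1]
      · have h4 : x ≠ i * (2 * (c + 1)) := by omega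
        by_cases c1 : c < sz i
        · simpa [leafRow, hi, hW, hc, q1, c1, h4] using h1 x (by omega)
        · have : x ≠ i * (2 * (c + 1)) + (c + 1 + sz i) := by omega
          simpa [leafRow, hi, hW, hc, q1, c1, h4, this] using h1 x (by omega)
      · by_cases hji : j = i
        · subst hji
          by_cases c1 : c < sz j
          · simp [leafRow, hi, hW, hc, q1, c1]
          · simp [leafRow, hi, hW, hc, q1, c1]
            omega
        · by_cases c1 : c < sz i <;>
            simpa [leafRow, hi, hW, hc, q1, c1, hji] using h2 j (by omega)
      · by_cases hji : j = i
        · subst hji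
          have h4 := h1 (j * (2 * (c + 1)) + p) (by omega)
          by_cases c1 : c < sz j
          · simp [leafRow, hi, hW, hc, q1, c1, row, Function.update_apply, h4]
          · simp only [not_lt] at c1
            have c2 := not_lt.2 c1
            by_cases c3 : p = 0
            · simp [leafRow, hi, hW, hc, q1, c2, row, c3]
            · simp [leafRow, hi, hW, hc, q1, c1, c2, row, Function.update_apply, h4, c3]
        · have q6 := add_lt_mul (i := j) (j := i) (w := 2 * (c + 1)) (p := p) (by omega) hp
          have h4 : j * (2 * (c + 1)) + p ≠ i * (2 * (c + 1)) := by omega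
          have h5 := h3 j (by omega) p hp
          by_cases c1 : c < sz i
          · simpa [leafRow, hi, hW, hc, q1, c1, row, h4] using h5
          · have : j * (2 * (c + 1)) + p ≠ i * (2 * (c + 1)) + (c + 1 + sz i) := by omega
            simpa [leafRow, hi, hW, hc, q1, c1, row, h4, this] using h5)
    n (leafInit.run M σ) ⟨0, rfl, by simp [leafInit], by simpa [leafInit] using hin,
      by simpa [leafInit] using hc, by simp [leafInit, hc], Nat.zero_le _, by simp [leafInit, hD],
      by simp, by simp⟩
  obtain rfl : i = n := by
    have : ¬ i < n := by simpa [hi, hin] using hb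
    omega
  refine ⟨_, τ, .seq e₀ e, ?_, hi, hW, h1, ⟨h2, fun j a b => by omega, h3, fun j a b => by omega,
    fun j a b => by omega⟩⟩
  simp only [Expr.cost, lt] at ht
  simp only [lt]
  omega

/-- Write the current pair into the table. -/
def storePair : Prog :=
  .ite (.cell aTy (.reg rI)) (.set rB (.reg rV)) (.set rB (.reg rU * .reg rV)) ;;
  .set rB (.reg rI * .reg rW + (.reg rB * (.reg rC + 1) + .reg rS)) ;;
  .store aD (.reg rB) 1 ;; .store aX (.reg rB) (.reg rP) ;; .store aY (.reg rB) (.reg rR)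

/-- Decode the current pair. -/
def decodePair : Prog :=
  .set rU (lt (.reg rC) (.reg rP)) ;; .set rV (lt (.reg rC) (.reg rR)) ;;
  .set rS ((.reg rP - .reg rU * (.reg rC + 1)) + (.reg rR - .reg rV * (.reg rC + 1)))

/-- Write the current pair into the table if it is valid. -/
def tryPair : Prog :=
  .ite (.cell aD (.reg rE * .reg rW + .reg rP))
    (.ite (.cell aD (.reg rF * .reg rW + .reg rR))
      (.ite (lt (.reg rC) (.reg rS)) .skip
        (.ite (.cell aTy (.reg rI))
          (.ite (.reg rU) (.ite (eq (.reg rR) (.reg rH)) storePair .skip) storePair) storePair))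
      .skip) .skip

/-- Advance to the next pair. -/
def nextPair : Prog :=
  .set rR (.reg rR + 1) ;; .ite (lt (.reg rR) (.reg rW)) .skip (.set rR 0 ;; .set rP (.reg rP + 1))

theorem run_storePair {M : Config} {n m c : ℕ} {sz us vs : ℕ → ℕ} (hM : Setting M n m c sz us vs)
    {σ : Mem} {i P R t : ℕ} (hi : σ.reg rI = i) (hc : σ.reg rC = c) (hW : σ.reg rW = 2 * (c + 1))
    (hP : σ.reg rP = P) (hR : σ.reg rR = R) (hU : σ.reg rU = bit c P) (hV : σ.reg rV = bit c R)
    (hS : σ.reg rS = amount c P + amount c R) (hi' : i < 2 * n) (hf : Fits c (σ.arr aTy i) t P R) :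
    storePair.Ok M σ ∧
    (storePair.run M σ).arr aD = Function.update (σ.arr aD)
      (i * (2 * (c + 1)) + combination c (σ.arr aTy i) P R) 1 ∧
    (storePair.run M σ).arr aX = Function.update (σ.arr aX)
      (i * (2 * (c + 1)) + combination c (σ.arr aTy i) P R) P ∧
    (storePair.run M σ).arr aY = Function.update (σ.arr aY)
      (i * (2 * (c + 1)) + combination c (σ.arr aTy i) P R) R := by
  have hl := hM.le_len
  have hw := hM.len_lt
  have hlen : M.len = 2 * n * (2 * (c + 1)) := by rw [hM.len]; ring
  have w1 : 1 < M.word := by omega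
  have q1 := add_lt_mul hi' hf.combination_lt
  rw [← hlen] at q1
  have h1 := bit_le_one c P
  have h2 := bit_le_one c R
  have h3 : bit c P * bit c R ≤ 1 := Nat.mul_le_mul h1 h2
  by_cases c1 : σ.arr aTy i = 0
  · have e : combination c 0 P R = bit c P * bit c R * (c + 1) + (amount c P + amount c R) := by
      simp [combination]
    rw [c1, e] at q1
    rw [c1, e]
    refine ⟨?_, ?_, ?_, ?_⟩
    · simp [storePair, hi, hc, hW, hU, hV, hS, c1, w1]
      omega
    all_goals simp [storePair, hi, hc, hW, hU, hV, hS, hP, hR, c1]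
  · have e : combination c (σ.arr aTy i) P R = bit c R * (c + 1) + (amount c P + amount c R) := by
      simp [combination, c1]
    rw [e] at q1
    rw [e]
    refine ⟨?_, ?_, ?_, ?_⟩
    · simp [storePair, hi, hc, hW, hU, hV, hS, c1, w1]
      omega
    all_goals simp [storePair, hi, hc, hW, hV, hS, hP, hR, c1]

/-- Register `rH` holds c + 1 plus the total of the right subtree, which is the code of its full
set. The last conclusion confines all changes to row `i`, with values below the width of a row, so
that the rows of the children stay intact and the witnesses stay usable as column numbers. -/
theorem run_tryPair {M : Config} {n m c : ℕ} {sz us vs : ℕ → ℕ} (hM : Setting M n m c sz us vs)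
    {σ : Mem} {i P R t e f : ℕ} (hi : σ.reg rI = i) (hc : σ.reg rC = c)
    (hW : σ.reg rW = 2 * (c + 1)) (hP : σ.reg rP = P) (hR : σ.reg rR = R) (hU : σ.reg rU = bit c P)
    (hV : σ.reg rV = bit c R) (hS : σ.reg rS = amount c P + amount c R) (hE : σ.reg rE = e)
    (hF : σ.reg rF = f) (hH : σ.reg rH = c + 1 + t) (hi' : i < 2 * n) (he : e < 2 * n)
    (hf : f < 2 * n) (hP' : P < 2 * (c + 1)) (hR' : R < 2 * (c + 1))
    (H : PairInv c (σ.arr aTy i) t (row (2 * (c + 1)) (σ.arr aD) e) (row (2 * (c + 1)) (σ.arr aD) f)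
      P R (row (2 * (c + 1)) (σ.arr aD) i) (row (2 * (c + 1)) (σ.arr aX) i)
      (row (2 * (c + 1)) (σ.arr aY) i)) :
    tryPair.Ok M σ ∧
    PairInv c (σ.arr aTy i) t (row (2 * (c + 1)) (σ.arr aD) e) (row (2 * (c + 1)) (σ.arr aD) f)
      P (R + 1) (row (2 * (c + 1)) ((tryPair.run M σ).arr aD) i)
      (row (2 * (c + 1)) ((tryPair.run M σ).arr aX) i)
      (row (2 * (c + 1)) ((tryPair.run M σ).arr aY) i) ∧
    ∀ a, a = aD ∨ a = aX ∨ a = aY → (tryPair.run M σ).arr a = σ.arr a ∨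
      ∃ p < 2 * (c + 1), ∃ v < 2 * (c + 1),
        (tryPair.run M σ).arr a = Function.update (σ.arr a) (i * (2 * (c + 1)) + p) v := by
  have hl := hM.le_len
  have hw := hM.len_lt
  have hlen : M.len = 2 * n * (2 * (c + 1)) := by rw [hM.len]; ring
  have w1 : 1 < M.word := by omega
  have q1 := add_lt_mul he hP'
  have q2 := add_lt_mul hf hR'
  have q3 := add_lt_mul (w := 2 * (c + 1)) (p := 0) hi' (by omega)
  rw [← hlen] at q1 q2 q3
  by_cases hv : row (2 * (c + 1)) (σ.arr aD) e P ≠ 0 ∧ row (2 * (c + 1)) (σ.arr aD) f R ≠ 0 ∧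
      Fits c (σ.arr aTy i) t P R
  · obtain ⟨v1, v2, v3⟩ := hv
    have H' := H.add hP' hR' v1 v2 v3
    obtain ⟨s1, s2, s3, s4⟩ := run_storePair hM hi hc hW hP hR hU hV hS hi' v3
    have hp := v3.combination_lt
    obtain ⟨f1, f2⟩ := v3
    have f1 := not_lt.2 f1
    unfold row at v1 v2
    have key : tryPair.run M σ = storePair.run M σ ∧ tryPair.Ok M σ := by
      by_cases c1 : σ.arr aTy i = 0
      · constructor
        · simp [tryPair, hi, hc, hW, hP, hR, hS, hE, hF, v1, v2, f1, c1]
        · simp [tryPair, hi, hc, hW, hP, hR, hS, hE, hF, v1, v2, f1, c1, w1, s1]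
          omega
      · by_cases c2 : bit c P = 0
        · constructor
          · simp [tryPair, hi, hc, hW, hP, hR, hS, hU, hE, hF, v1, v2, f1, c1, c2]
          · simp [tryPair, hi, hc, hW, hP, hR, hS, hU, hE, hF, v1, v2, f1, c1, c2, w1, s1]
            omega
        · have c3 := hH.trans (f2 c1 c2).symm
          constructor
          · simp [tryPair, hi, hc, hW, hP, hR, hS, hU, hE, hF, v1, v2, f1, c1, c2, c3]
          · simp [tryPair, hi, hc, hW, hP, hR, hS, hU, hE, hF, v1, v2, f1, c1, c2, c3, w1, s1]
            omega
    rw [key.1]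
    refine ⟨key.2, ?_, ?_⟩
    · rw [s2, s3, s4, row_update_self, row_update_self, row_update_self]
      exact H'
    · rintro a (rfl | rfl | rfl)
      · exact .inr ⟨_, hp, 1, by omega, s2⟩
      · exact .inr ⟨_, hp, P, hP', s3⟩
      · exact .inr ⟨_, hp, R, hR', s4⟩
  · have H' := H.skip hv
    have key : tryPair.run M σ = σ ∧ tryPair.Ok M σ := by
      unfold row Fits at hv
      by_cases v1 : σ.arr aD (e * (2 * (c + 1)) + P) = 0
      · constructor
        · simp [tryPair, hW, hP, hE, v1]
        · simp [tryPair, hW, hP, hE, v1]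
          omega
      · by_cases v2 : σ.arr aD (f * (2 * (c + 1)) + R) = 0
        · constructor
          · simp [tryPair, hW, hP, hE, hF, hR, v1, v2]
          · simp [tryPair, hW, hP, hE, hF, hR, v1, v2]
            omega
        · by_cases f1 : c < amount c P + amount c R
          · constructor
            · simp [tryPair, hW, hP, hE, hF, hR, hS, hc, v1, v2, f1]
            · simp [tryPair, hW, hP, hE, hF, hR, hS, hc, v1, v2, f1, w1]
              omega
          · obtain ⟨c1, c2, c3⟩ : σ.arr aTy i ≠ 0 ∧ bit c P ≠ 0 ∧ R ≠ c + 1 + t := by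
              by_contra hne
              exact hv ⟨v1, v2, by omega, by tauto⟩
            constructor
            · simp [tryPair, hW, hP, hE, hF, hR, hS, hc, hU, hH, hi, v1, v2, f1, c1, c2, c3]
            · simp [tryPair, hW, hP, hE, hF, hR, hS, hc, hU, hH, hi, v1, v2, f1, c1, c2, c3, w1]
              omega
    rw [key.1]
    exact ⟨key.2, H', fun a _ => .inl rfl⟩

end WordRAM

/-! ### The loop over all pairs of entries -/

namespace WordRAM

open WordRAM.Expr WordRAM.Cmd

/-- Handle the current pair. -/
def pairStep : Prog := decodePair ;; tryPair ;; nextPair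

theorem row_eq_of_lt {w i j : ℕ} {g g' : ℕ → ℕ} (h : ∀ x < i * w, g' x = g x) (hj : j < i) {p : ℕ}
    (hp : p < w) : row w g' j p = row w g j p :=
  h _ (add_lt_mul hj hp)

/-- The arrays `g` and `g'` differ only in row `i`, where the values are below `w`. -/
structure OnlyRow (w i : ℕ) (g g' : ℕ → ℕ) : Prop where
  before : ∀ x < i * w, g' x = g x
  after : ∀ x, (i + 1) * w ≤ x → g' x = g x
  lt : (∀ x, g x < w) → ∀ x, g' x < w

theorem OnlyRow.refl (w i : ℕ) (g : ℕ → ℕ) : OnlyRow w i g g := ⟨by simp, by simp, fun h => h⟩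

theorem OnlyRow.update {w i p v : ℕ} {g g' : ℕ → ℕ} (h : OnlyRow w i g g') (hp : p < w) (hv : v < w) :
    OnlyRow w i g (Function.update g' (i * w + p) v) := by
  have h1 := add_one_mul i w
  refine ⟨fun x hx => ?_, fun x hx => ?_, fun hg x => ?_⟩
  · rw [Function.update_of_ne (by omega), h.before x hx]
  · rw [Function.update_of_ne (by omega), h.after x hx]
  · by_cases hx : x = i * w + p
    · subst hx; simpa using hv
    · rw [Function.update_of_ne hx]; exact h.lt hg x

theorem exec_pairs {M : Config} {n m c : ℕ} {sz us vs : ℕ → ℕ} (hM : Setting M n m c sz us vs)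
    {σ : Mem} {i t e f : ℕ} (hi : σ.reg rI = i) (hc : σ.reg rC = c) (hW : σ.reg rW = 2 * (c + 1))
    (hP : σ.reg rP = 0) (hR : σ.reg rR = 0) (hE : σ.reg rE = e) (hF : σ.reg rF = f)
    (hH : σ.reg rH = c + 1 + t) (hi' : i < 2 * n) (he : e < i) (hf : f < i)
    (h0 : ∀ x, i * (2 * (c + 1)) ≤ x → σ.arr aD x = 0) :
    ∃ s τ, Exec M (.loop (lt (.reg rP) (.reg rW)) pairStep) σ s τ ∧
      s ≤ 2 * (c + 1) * (2 * (c + 1)) * roundCost (lt (.reg rP) (.reg rW)) pairStep + 4 ∧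
      (∀ a, a = aD ∨ a = aX ∨ a = aY → OnlyRow (2 * (c + 1)) i (σ.arr a) (τ.arr a)) ∧
      PairInv c (σ.arr aTy i) t (row (2 * (c + 1)) (σ.arr aD) e) (row (2 * (c + 1)) (σ.arr aD) f)
        (2 * (c + 1)) 0 (row (2 * (c + 1)) (τ.arr aD) i) (row (2 * (c + 1)) (τ.arr aX) i)
        (row (2 * (c + 1)) (τ.arr aY) i) := by
  have hl := hM.le_len
  have hw := hM.len_lt
  have hlen : M.len = 2 * n * (2 * (c + 1)) := by rw [hM.len]; ring
  have hn := hM.n_pos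
  have w1 : 1 < M.word := by omega
  have w0 : 0 < M.word := by omega
  have w2 : 2 * (c + 1) < M.word := by omega
  obtain ⟨w, hw'⟩ : ∃ w, w = 2 * (c + 1) := ⟨_, rfl⟩
  set ty := σ.arr aTy i with hty
  set D₀ := σ.arr aD with hD₀
  set X₀ := σ.arr aX with hX₀
  set Y₀ := σ.arr aY with hY₀
  obtain ⟨s, τ, φ, ex, ⟨P, R, -, hP, hR, hle, hRW, hi, hc, hW, hE, hF, hH, h1, h2, H⟩, hb, ht⟩ :=
    exec_loop_run (M := M) (b := lt (.reg rP) (.reg rW)) (p := pairStep)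
    -- The potential counts the pairs that have not been tried.
    (fun φ σ => ∃ P R, φ = (w - P) * w - R ∧ σ.reg rP = P ∧ σ.reg rR = R ∧ P ≤ w ∧
      -- The first alternative admits the final position P = w, R = 0.
      (R = 0 ∨ P < w ∧ R < w) ∧
      σ.reg rI = i ∧ σ.reg rC = c ∧ σ.reg rW = w ∧ σ.reg rE = e ∧ σ.reg rF = f ∧
      σ.reg rH = c + 1 + t ∧ σ.arr aTy i = ty ∧
      (OnlyRow w i D₀ (σ.arr aD) ∧ OnlyRow w i X₀ (σ.arr aX) ∧ OnlyRow w i Y₀ (σ.arr aY)) ∧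
      PairInv c ty t (row w D₀ e) (row w D₀ f) P R (row w (σ.arr aD) i) (row w (σ.arr aX) i)
        (row w (σ.arr aY) i))
    (by
      rintro φ σ ⟨P, R, -⟩
      simp [w1])
    (by
      rintro φ σ ⟨P, R, rfl, hP, hR, hle, hRW, hi, hc, hW, hE, hF, hH, h1, ⟨h2, h3, h4⟩, H⟩ hv
      have hlt : P < w := by simpa [hP, hW] using hv
      have hR' : R < w := by omega
      -- Both children have smaller numbers than `i`, and only row `i` is written. Their rows may
      -- hence be read from the initial array or from the current one.
      have hrow : ∀ j < i, ∀ p < 2 * (c + 1), row w (σ.arr aD) j p = row w D₀ j p :=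
        fun j hj p hp => row_eq_of_lt h2.before hj (by omega)
      have hb : ∀ p, (if c < p then 1 else 0) = bit c p := fun _ => rfl
      have hb' : ∀ p, p - bit c p * (c + 1) = amount c p := fun _ => rfl
      have b1 : ∀ p, bit c p * (c + 1) ≤ c + 1 := fun p => by
        simpa using Nat.mul_le_mul_right (c + 1) (bit_le_one c p)
      have ok₁ : decodePair.Ok M σ := by
        have b2 := b1 P
        have b3 := b1 R
        have b4 : amount c P ≤ c := amount_le (by omega)
        have b5 : amount c R ≤ c := amount_le (by omega)
        simp [decodePair, hP, hR, hc, hb, hb', w1]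
        omega
      obtain ⟨t₁, e₁, -⟩ := Cmd.exec_run ok₁
      obtain ⟨σ', hσ'⟩ : ∃ σ', σ' = decodePair.run M σ := ⟨_, rfl⟩
      rw [← hσ'] at e₁
      have harr : σ'.arr = σ.arr := by rw [hσ']; simp [decodePair]
      obtain ⟨ok₂, H', hrows⟩ := run_tryPair hM (σ := σ') (t := t) (i := i) (P := P) (R := R) (e := e)
        (f := f) (by rw [e₁.reg_eq (by rfl), hi]) (by rw [e₁.reg_eq (by rfl), hc])
        (by rw [e₁.reg_eq (by rfl), hW, hw']) (by rw [e₁.reg_eq (by rfl), hP])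
        (by rw [e₁.reg_eq (by rfl), hR]) (by rw [hσ']; simp [decodePair, hc, hP, hb])
        (by rw [hσ']; simp [decodePair, hc, hR, hb])
        (by rw [hσ']; simp [decodePair, hc, hP, hR, hb, hb'])
        (by rw [e₁.reg_eq (by rfl), hE]) (by rw [e₁.reg_eq (by rfl), hF])
        (by rw [e₁.reg_eq (by rfl), hH]) hi' (by omega) (by omega) (by omega) (by omega)
        (by rw [harr, h1, ← hw']; exact H.congr (hrow e he) (hrow f hf))
      obtain ⟨t₂, e₂, -⟩ := Cmd.exec_run ok₂
      rw [← hw'] at H' hrows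
      rw [harr] at hrows
      obtain ⟨σ'', hσ''⟩ : ∃ σ'', σ'' = tryPair.run M σ' := ⟨_, rfl⟩
      rw [← hσ''] at e₂ H' hrows
      have e₃ := e₁.seq e₂
      have hP₂ : σ''.reg rP = P := by rw [e₃.reg_eq (by rfl), hP]
      have hR₂ : σ''.reg rR = R := by rw [e₃.reg_eq (by rfl), hR]
      have hW₂ : σ''.reg rW = w := by rw [e₃.reg_eq (by rfl), hW]
      have ok₃ : nextPair.Ok M σ'' := by
        simp [nextPair, hP₂, hR₂, hW₂, w0, w1]
        omega
      have ok : pairStep.Ok M σ := ⟨ok₁, by rw [← hσ']; exact ⟨ok₂, by rw [← hσ'']; exact ok₃⟩⟩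
      have hrun : pairStep.run M σ = nextPair.run M σ'' := by rw [hσ'', hσ']; rfl
      have hrun' : (pairStep.run M σ).arr = σ''.arr := by
        rw [hrun]
        by_cases c1 : R + 1 < w <;> simp [nextPair, hR₂, hW₂, c1]
      obtain ⟨t₄, e₄, -⟩ := Cmd.exec_run ok
      have honly : ∀ a, a = aD ∨ a = aX ∨ a = aY → ∀ g, OnlyRow w i g (σ.arr a) →
          OnlyRow w i g ((pairStep.run M σ).arr a) := by
        intro a ha g hg
        rw [hrun']
        rcases hrows a ha with h | ⟨p, hp, v, hv, h⟩
        · rwa [h]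
        · rw [h]; exact hg.update hp hv
      rw [harr, h1, ← hrun'] at H'
      have H' := H'.congr (fun p hp => (hrow e he p hp).symm) fun p hp => (hrow f hf p hp).symm
      have hsq := Nat.succ_mul (w - P - 1) w
      rw [show (w - P - 1).succ = w - P by omega] at hsq
      refine ⟨ok, ?_⟩
      by_cases c1 : R + 1 < w
      · refine ⟨(w - P) * w - (R + 1), by omega, P, R + 1, rfl,
          by simp [hrun, nextPair, hP₂, hR₂, hW₂, c1],
          by simp [hrun, nextPair, hR₂, hW₂, c1], hle, .inr ⟨hlt, c1⟩,
          by rw [e₄.reg_eq (by rfl), hi], by rw [e₄.reg_eq (by rfl), hc], by rw [e₄.reg_eq (by rfl), hW],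
          by rw [e₄.reg_eq (by rfl), hE], by rw [e₄.reg_eq (by rfl), hF],
          by rw [e₄.reg_eq (by rfl), hH], by rw [e₄.arr_eq (by rfl), h1],
          ⟨honly _ (by simp) _ h2, honly _ (by simp) _ h3, honly _ (by simp) _ h4⟩, H'⟩
      · obtain rfl : R + 1 = w := by omega
        refine ⟨(R + 1 - (P + 1)) * (R + 1) - 0, by rw [Nat.sub_sub] at hsq; omega, P + 1, 0, rfl,
          by simp [hrun, nextPair, hP₂, hR₂, hW₂],
          by simp [hrun, nextPair, hR₂, hW₂], hlt, .inl rfl,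
          by rw [e₄.reg_eq (by rfl), hi], by rw [e₄.reg_eq (by rfl), hc], by rw [e₄.reg_eq (by rfl), hW],
          by rw [e₄.reg_eq (by rfl), hE], by rw [e₄.reg_eq (by rfl), hF],
          by rw [e₄.reg_eq (by rfl), hH], by rw [e₄.arr_eq (by rfl), h1],
          ⟨honly _ (by simp) _ h2, honly _ (by simp) _ h3, honly _ (by simp) _ h4⟩, ?_⟩
        rw [hw'] at H' ⊢
        exact H'.carry)
    (w * w) σ ⟨0, 0, by simp, hP, hR, by omega, .inl rfl, hi, hc, by rw [hW, hw'], hE, hF, hH, rfl,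
      ⟨.refl _ _ _, .refl _ _ _, .refl _ _ _⟩, by
        have : row w D₀ i = fun _ => 0 := by
          funext p; exact h0 _ (by rw [hw']; omega)
        rw [this]
        exact .init⟩
  obtain rfl : P = w := by
    have : ¬ P < w := by simpa [hP, hW] using hb
    omega
  obtain rfl : R = 0 := by omega
  subst hw'
  refine ⟨s, τ, ex, ?_, ?_, H⟩
  · simp only [Expr.cost, lt] at ht
    simp only [lt]
    omega
  · rintro a (rfl | rfl | rfl)
    exacts [h2.1, h2.2.1, h2.2.2]

end WordRAM

/-! ### Existence of entries and consistency of the choices -/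

namespace IsTable

variable {n cnt c : ℕ} {sz typ lc rc tot : ℕ → ℕ} {D X Y : ℕ → ℕ → ℕ}

theorem tot_le (H : IsTable n cnt c sz typ lc rc tot D X Y) {j : ℕ} (hj : j < cnt) :
    tot j ≤ c + 1 := by
  rcases lt_or_ge j n with h | h
  · rw [H.tot_leaf j h]; omega
  · rw [H.tot_node j h hj]; omega

/-- The code 0 stands for the empty set, which is admissible in every subtree. The search at the
root can therefore start with entry 0. -/
theorem entry_zero (H : IsTable n cnt c sz typ lc rc tot D X Y)
    (hlt : ∀ j, n ≤ j → j < cnt → lc j < j ∧ rc j < j) {j : ℕ} (hj : j < cnt) : D j 0 ≠ 0 := by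
  induction j using Nat.strong_induction_on with
  | _ j ih =>
    rcases lt_or_ge j n with h | h
    · exact (H.leaf j h 0 (by omega)).2 (.inl rfl)
    · obtain ⟨h1, h2⟩ := hlt j h hj
      refine H.complete j h hj 0 (by omega) 0 (by omega) (ih _ h1 (by omega)) (ih _ h2 (by omega)) 0 ?_
      simp [Combines, amount, bit]

end IsTable

/-- The choices for the children of the nodes from `i` on are made; `best` is the choice for `root`. -/
structure Chosen (n cnt i w : ℕ) (lc rc : ℕ → ℕ) (X Y : ℕ → ℕ → ℕ) (root best : ℕ)
    (sel : ℕ → ℕ) : Prop where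
  lt : ∀ j, sel j < w
  root_eq : sel root = best
  child_eq : ∀ j, i ≤ j → j < cnt → sel (lc j) = X j (sel j) ∧ sel (rc j) = Y j (sel j)

/-- Children have smaller numbers than their parent, so the choices for the nodes from `i` on are
not changed. By the roles that `π` assigns, the children of `i` are not children of another node and
not the root, so no choice made earlier is overwritten. The bound is kept for all nodes because
every choice is used as a column number. -/
theorem Chosen.step {n cnt i w root best : ℕ} {lc rc sel π : ℕ → ℕ} {X Y : ℕ → ℕ → ℕ}
    (H : Chosen n cnt (i + 1) w lc rc X Y root best sel) (hi : n ≤ i) (hi' : i < cnt)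
    (hX : ∀ p < w, X i p < w) (hY : ∀ p < w, Y i p < w) (hr : π root < n)
    (hπ : ∀ j, n ≤ j → j < cnt →
      lc j < j ∧ rc j < j ∧ π (lc j) = n + 2 * j ∧ π (rc j) = n + 2 * j + 1) :
    Chosen n cnt i w lc rc X Y root best
      (Function.update (Function.update sel (lc i) (X i (sel i))) (rc i) (Y i (sel i))) := by
  obtain ⟨h1, h2, h3, h4⟩ := hπ i hi hi'
  have hne : ∀ j, π j ≠ n + 2 * i → π j ≠ n + 2 * i + 1 →
      Function.update (Function.update sel (lc i) (X i (sel i))) (rc i) (Y i (sel i)) j = sel j := by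
    intro j a1 a2
    rw [Function.update_of_ne (by rintro rfl; exact a2 h4),
      Function.update_of_ne (by rintro rfl; exact a1 h3)]
  have hge : ∀ j, i ≤ j →
      Function.update (Function.update sel (lc i) (X i (sel i))) (rc i) (Y i (sel i)) j = sel j := by
    intro j a1
    rw [Function.update_of_ne (by omega), Function.update_of_ne (by omega)]
  refine ⟨fun j => ?_, ?_, fun j a1 a2 => ?_⟩
  · simp only [Function.update_apply]
    split_ifs
    exacts [hY _ (H.lt i), hX _ (H.lt i), H.lt j]
  · rw [hne _ (by omega) (by omega), H.root_eq]
  · rw [hge j a1]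
    by_cases hji : j = i
    · subst hji
      rw [Function.update_self, Function.update_of_ne, Function.update_self]
      · exact ⟨rfl, rfl⟩
      · intro h; rw [h] at h3; omega
    · obtain ⟨-, -, b3, b4⟩ := hπ j (by omega) a2
      rw [hne (lc j) (by omega) (by omega), hne (rc j) (by omega) (by omega)]
      exact H.child_eq j (by omega) a2

/-! ### Rows of the inner nodes, the best entry at the root and the selection -/

namespace WordRAM

open WordRAM.Expr WordRAM.Cmd

/-- Prepare the row of the inner node `rI`. -/
def nodeInit : Prog :=
  .set rE (.cell aLc (.reg rI)) ;; .set rF (.cell aRc (.reg rI)) ;;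
  .set rU (.cell aTot (.reg rE) + .cell aTot (.reg rF)) ;;
  .ite (lt (.reg rC) (.reg rU)) (.store aTot (.reg rI) (.reg rC + 1))
    (.store aTot (.reg rI) (.reg rU)) ;;
  .set rH (.reg rC + 1 + .cell aTot (.reg rF)) ;; .set rP 0 ;; .set rR 0

/-- Fill the row of the inner node `rI`. -/
def nodeRow : Prog :=
  nodeInit ;; .loop (lt (.reg rP) (.reg rW)) pairStep ;; .set rI (.reg rI + 1)

/-- Fill the rows of all inner nodes. -/
def nodeRows : Prog := .loop (lt (.reg rI) (.reg rT)) nodeRow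

theorem exec_nodeRows {M : Config} {n m c : ℕ} {sz us vs : ℕ → ℕ} (hM : Setting M n m c sz us vs)
    {σ : Mem} {cnt : ℕ} {typ lc rc : ℕ → ℕ} (hi : σ.reg rI = n) (hc : σ.reg rC = c)
    (hW : σ.reg rW = 2 * (c + 1)) (hT : σ.reg rT = cnt) (hcnt : n ≤ cnt) (hcnt' : cnt < 2 * n)
    (htyp : σ.arr aTy = typ) (hlc : σ.arr aLc = lc) (hrc : σ.arr aRc = rc)
    (hlt : ∀ j, n ≤ j → j < cnt → lc j < j ∧ rc j < j)
    (h0 : ∀ x, n * (2 * (c + 1)) ≤ x → σ.arr aD x = 0)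
    (hX : ∀ x, σ.arr aX x < 2 * (c + 1)) (hY : ∀ x, σ.arr aY x < 2 * (c + 1))
    (H : IsTable n n c sz typ lc rc (σ.arr aTot) (row (2 * (c + 1)) (σ.arr aD))
      (row (2 * (c + 1)) (σ.arr aX)) (row (2 * (c + 1)) (σ.arr aY))) :
    ∃ s τ, Exec M nodeRows σ s τ ∧
      s ≤ n * (nodeInit.bound + 14 +
        2 * (c + 1) * (2 * (c + 1)) * roundCost (lt (.reg rP) (.reg rW)) pairStep) + 4 ∧
      (∀ x, τ.arr aX x < 2 * (c + 1)) ∧ (∀ x, τ.arr aY x < 2 * (c + 1)) ∧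
      IsTable n cnt c sz typ lc rc (τ.arr aTot) (row (2 * (c + 1)) (τ.arr aD))
        (row (2 * (c + 1)) (τ.arr aX)) (row (2 * (c + 1)) (τ.arr aY)) := by
  have hl := hM.le_len
  have hw := hM.len_lt
  have w1 : 1 < M.word := by omega
  have w0 : 0 < M.word := by omega
  obtain ⟨κ, hκ⟩ : ∃ κ, κ = nodeInit.bound + 14 +
    2 * (c + 1) * (2 * (c + 1)) * roundCost (lt (.reg rP) (.reg rW)) pairStep := ⟨_, rfl⟩
  obtain ⟨s, τ, φ, ex, ⟨i, -, hi, hle, -, -, hT, -, -, -, -, hX, hY, H⟩, hb, ht⟩ :=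
    exec_loop (M := M) (b := lt (.reg rI) (.reg rT)) (p := nodeRow)
    (fun φ σ => ∃ i, φ = (cnt - i) * κ ∧ σ.reg rI = i ∧ (n ≤ i ∧ i ≤ cnt) ∧ σ.reg rC = c ∧
      σ.reg rW = 2 * (c + 1) ∧ σ.reg rT = cnt ∧ σ.arr aTy = typ ∧ σ.arr aLc = lc ∧ σ.arr aRc = rc ∧
      (∀ x, i * (2 * (c + 1)) ≤ x → σ.arr aD x = 0) ∧
      (∀ x, σ.arr aX x < 2 * (c + 1)) ∧ (∀ x, σ.arr aY x < 2 * (c + 1)) ∧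
      IsTable n i c sz typ lc rc (σ.arr aTot) (row (2 * (c + 1)) (σ.arr aD))
        (row (2 * (c + 1)) (σ.arr aX)) (row (2 * (c + 1)) (σ.arr aY)))
    (by
      rintro φ σ ⟨i, -⟩
      simp [w1])
    (by
      rintro φ σ ⟨i, rfl, hi, ⟨hle, hle'⟩, hc, hW, hT, htyp, hlc, hrc, h0, hX, hY, H⟩ hv
      have hic : i < cnt := by simpa [hi, hT] using hv
      obtain ⟨l1, l2⟩ := hlt i hle hic
      have b1 := H.tot_le l1
      have b2 := H.tot_le l2
      obtain ⟨σ', hσ'⟩ : ∃ σ', σ' = nodeInit.run M σ := ⟨_, rfl⟩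
      have ok₁ : nodeInit.Ok M σ := by
        by_cases c1 : c < σ.arr aTot (lc i) + σ.arr aTot (rc i)
        · simp [nodeInit, hi, hc, hlc, hrc, c1, w0, w1, Function.update_of_ne l2.ne]
          omega
        · simp [nodeInit, hi, hc, hlc, hrc, c1, w0, w1, Function.update_of_ne l2.ne]
          omega
      obtain ⟨t₁, e₁, b₁⟩ := Cmd.exec_run ok₁
      rw [← hσ'] at e₁
      have hE : σ'.reg rE = lc i := by
        rw [hσ']
        by_cases c1 : c < σ.arr aTot (lc i) + σ.arr aTot (rc i) <;>
          simp [nodeInit, hi, hc, hlc, hrc, c1]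
      have hF : σ'.reg rF = rc i := by
        rw [hσ']
        by_cases c1 : c < σ.arr aTot (lc i) + σ.arr aTot (rc i) <;>
          simp [nodeInit, hi, hc, hlc, hrc, c1]
      have hH : σ'.reg rH = c + 1 + σ.arr aTot (rc i) := by
        rw [hσ']
        by_cases c1 : c < σ.arr aTot (lc i) + σ.arr aTot (rc i) <;>
          simp [nodeInit, hi, hc, hlc, hrc, c1, Function.update_of_ne l2.ne]
      have htot : σ'.arr aTot = Function.update (σ.arr aTot) i
          (min (σ.arr aTot (lc i) + σ.arr aTot (rc i)) (c + 1)) := by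
        rw [hσ']
        by_cases c1 : c < σ.arr aTot (lc i) + σ.arr aTot (rc i)
        · rw [min_eq_right (by omega)]
          simp [nodeInit, hi, hc, hlc, hrc, c1]
        · rw [min_eq_left (by omega)]
          simp [nodeInit, hi, hc, hlc, hrc, c1]
      have hD' : σ'.arr aD = σ.arr aD := e₁.arr_eq (by rfl)
      have hX' : σ'.arr aX = σ.arr aX := e₁.arr_eq (by rfl)
      have hY' : σ'.arr aY = σ.arr aY := e₁.arr_eq (by rfl)
      obtain ⟨t₂, τ, e₂, b₂, hon, hpair⟩ := exec_pairs hM (σ := σ') (i := i) (t := σ.arr aTot (rc i))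
        (e := lc i) (f := rc i) (by rw [e₁.reg_eq (by rfl), hi]) (by rw [e₁.reg_eq (by rfl), hc])
        (by rw [e₁.reg_eq (by rfl), hW]) (by rw [hσ']; simp [nodeInit])
        (by rw [hσ']; simp [nodeInit]) hE hF hH (by omega) l1 l2 (by rwa [hD'])
      have hiτ : τ.reg rI = i := by rw [e₂.reg_eq (by rfl), e₁.reg_eq (by rfl), hi]
      obtain ⟨t₃, e₃, b₃⟩ := Cmd.exec_run (M := M) (p := .set rI (.reg rI + 1)) (σ := τ) (by
        simp [hiτ, w1]; omega)
      have e := e₁.seq (e₂.seq e₃)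
      have hDo := hon aD (by simp)
      have hXo := hon aX (by simp)
      have hYo := hon aY (by simp)
      rw [hD'] at hDo hpair
      rw [hX'] at hXo
      rw [hY'] at hYo
      rw [e₁.arr_eq (by rfl), htyp] at hpair
      have htot' : τ.arr aTot = σ'.arr aTot := e₂.arr_eq (by rfl)
      have hsq := add_one_mul i (2 * (c + 1))
      refine ⟨_, _, _, e, ⟨i + 1, rfl, by simp [hiτ], ⟨by omega, hic⟩, by rw [e.reg_eq (by rfl), hc],
        by rw [e.reg_eq (by rfl), hW], by rw [e.reg_eq (by rfl), hT], by rw [e.arr_eq (by rfl), htyp],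
        by rw [e.arr_eq (by rfl), hlc], by rw [e.arr_eq (by rfl), hrc], fun x hx => ?_, hXo.lt hX,
        hYo.lt hY, ?_⟩, ?_⟩
      · exact (hDo.after x hx).trans (h0 x (by omega))
      · refine H.succ hle (fun j a1 a2 => hlt j a1 (by omega)) (fun j hj => ?_) ?_
          (fun j hj p hp => row_eq_of_lt hDo.before hj hp) (fun j hj p hp => row_eq_of_lt hXo.before hj hp)
          (fun j hj p hp => row_eq_of_lt hYo.before hj hp) hpair
        · simp only [run_set, State.setReg_arr]
          rw [htot', htot, Function.update_of_ne hj.ne]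
        · simp only [run_set, State.setReg_arr]
          rw [htot', htot, Function.update_self]
      · have h6 : Expr.cost (lt (.reg rI) (.reg rT) : Expr 16 21) = 3 := rfl
        have h7 : bound (.set rI (.reg rI + 1) : Prog) = 4 := rfl
        rw [h7] at b₃
        rw [h6, show cnt - i = cnt - (i + 1) + 1 by omega, add_one_mul]
        omega)
    ((cnt - n) * κ) σ ⟨n, rfl, hi, ⟨le_rfl, hcnt⟩, hc, hW, hT, htyp, hlc, hrc, h0, hX, hY, H⟩
  obtain rfl : i = cnt := by
    have : ¬ i < cnt := by simpa [hi, hT] using hb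
    omega
  refine ⟨s, τ, ex, ?_, hX, hY, H⟩
  have h6 : Expr.cost (lt (.reg rI) (.reg rT) : Expr 16 21) = 3 := rfl
  rw [h6] at ht
  rw [← hκ]
  have : (i - n) * κ ≤ n * κ := Nat.mul_le_mul_right _ (by omega)
  omega

/-- Prepare the search for the best entry in the row of the root. -/
def pickInit : Prog := .set rE (.cell aLab (.cell aIn 0)) ;; .set rP 0 ;; .set rR 0 ;; .set rS 0

/-- Compare the entry `rP` in the row of the root with the best entry so far. -/
def pickStep : Prog :=
  .ite (.cell aD (.reg rE * .reg rW + .reg rP))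
    (.set rB (.reg rP - lt (.reg rC) (.reg rP) * (.reg rC + 1)) ;;
      .ite (lt (.reg rS) (.reg rB)) (.set rS (.reg rB) ;; .set rR (.reg rP)) .skip)
    .skip ;;
  .set rP (.reg rP + 1)

/-- Find the best entry in the row of the root. -/
def pick : Prog := pickInit ;; .loop (lt (.reg rP) (.reg rW)) pickStep

theorem exec_pick {M : Config} {n m c : ℕ} {sz us vs : ℕ → ℕ} (hM : Setting M n m c sz us vs)
    {σ : Mem} {root : ℕ} (hc : σ.reg rC = c) (hW : σ.reg rW = 2 * (c + 1))
    (hroot : σ.arr aLab (σ.arr aIn 0) = root) (hin : σ.arr aIn 0 < n) (hr : root < 2 * n)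
    (h0 : row (2 * (c + 1)) (σ.arr aD) root 0 ≠ 0) :
    ∃ t τ, Exec M pick σ t τ ∧
      t ≤ pickInit.bound + 2 * (c + 1) * roundCost (lt (.reg rP) (.reg rW)) pickStep + 4 ∧
      τ.reg rE = root ∧ τ.reg rR < 2 * (c + 1) ∧
      row (2 * (c + 1)) (σ.arr aD) root (τ.reg rR) ≠ 0 ∧
      ∀ p < 2 * (c + 1), row (2 * (c + 1)) (σ.arr aD) root p ≠ 0 → amount c p ≤ amount c (τ.reg rR) := by
  have hl := hM.le_len
  have hw := hM.len_lt
  have hlen : M.len = 2 * n * (2 * (c + 1)) := by rw [hM.len]; ring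
  have w1 : 1 < M.word := by omega
  have w0 : 0 < M.word := by omega
  set D₀ := σ.arr aD with hD₀
  obtain ⟨t₀, e₀, b₀⟩ := Cmd.exec_run (M := M) (p := pickInit) (σ := σ) (by
    simp [pickInit, w0]
    omega)
  obtain ⟨t, τ, φ, e, ⟨P, R, -, hP, hR, hS, hc, hW, hE, hle, hD, hRW, hDR, hbest⟩, hb, ht⟩ :=
    exec_loop_run (M := M) (b := lt (.reg rP) (.reg rW)) (p := pickStep)
    (fun φ σ => ∃ P R, φ = 2 * (c + 1) - P ∧ σ.reg rP = P ∧ σ.reg rR = R ∧ σ.reg rS = amount c R ∧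
      σ.reg rC = c ∧ σ.reg rW = 2 * (c + 1) ∧ σ.reg rE = root ∧ P ≤ 2 * (c + 1) ∧ σ.arr aD = D₀ ∧
      R < 2 * (c + 1) ∧ row (2 * (c + 1)) D₀ root R ≠ 0 ∧
      ∀ p < P, row (2 * (c + 1)) D₀ root p ≠ 0 → amount c p ≤ amount c R)
    (by
      rintro φ σ ⟨P, R, -⟩
      simp [w1])
    (by
      rintro φ σ ⟨P, R, rfl, hP, hR, hS, hc, hW, hE, hle, hD, hRW, hDR, hbest⟩ hv
      have hlt : P < 2 * (c + 1) := by simpa [hP, hW] using hv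
      have q1 := add_lt_mul hr hlt
      rw [← hlen] at q1
      have hb : ∀ p, (if c < p then 1 else 0) = bit c p := fun _ => rfl
      have hb' : ∀ p, p - bit c p * (c + 1) = amount c p := fun _ => rfl
      have b1 : bit c P * (c + 1) ≤ c + 1 := by
        simpa using Nat.mul_le_mul_right (c + 1) (bit_le_one c P)
      have hbest' : ∀ R', amount c R ≤ amount c R' →
          (row (2 * (c + 1)) D₀ root P ≠ 0 → amount c P ≤ amount c R') →
          ∀ p < P + 1, row (2 * (c + 1)) D₀ root p ≠ 0 → amount c p ≤ amount c R' := by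
        intro R' a1 a2 p hp hp'
        rcases Nat.lt_succ_iff_lt_or_eq.1 hp with hp | rfl
        · exact (hbest p hp hp').trans a1
        · exact a2 hp'
      unfold row at hDR
      by_cases c1 : D₀ (root * (2 * (c + 1)) + P) = 0
      · constructor
        · simp [pickStep, hE, hW, hP, hD, c1, w1]
          omega
        · refine ⟨2 * (c + 1) - (P + 1), by omega, P + 1, R, rfl, ?_, ?_, ?_, ?_, ?_, ?_, hlt, ?_, hRW,
            hDR, hbest' R le_rfl fun h => (h c1).elim⟩ <;>
          simp [pickStep, hE, hW, hP, hD, hR, hS, hc, c1]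
      · by_cases c2 : amount c R < amount c P
        · constructor
          · simp [pickStep, hE, hW, hP, hD, hS, hc, hb, hb', c1, c2, w1]
            omega
          · refine ⟨2 * (c + 1) - (P + 1), by omega, P + 1, P, rfl, ?_, ?_, ?_, ?_, ?_, ?_, hlt, ?_,
              hlt, c1, hbest' P c2.le fun h => le_rfl⟩ <;>
            simp [pickStep, hE, hW, hP, hD, hS, hc, hb, hb', c1, c2]
        · constructor
          · simp [pickStep, hE, hW, hP, hD, hS, hc, hb, hb', c1, c2, w1]
            omega
          · refine ⟨2 * (c + 1) - (P + 1), by omega, P + 1, R, rfl, ?_, ?_, ?_, ?_, ?_, ?_, hlt, ?_,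
              hRW, hDR, hbest' R le_rfl fun h => not_lt.1 c2⟩ <;>
            simp [pickStep, hE, hW, hP, hD, hR, hS, hc, hb, hb', c1, c2])
    -- The first candidate is entry 0 with amount 0, which is present by `h0`.
    (2 * (c + 1)) (pickInit.run M σ) ⟨0, 0, rfl, by simp [pickInit], by simp [pickInit],
      by simp [pickInit, amount], by simpa [pickInit] using hc, by simpa [pickInit] using hW,
      by simpa [pickInit] using hroot, by omega, by simp [pickInit, hD₀], by omega, h0, by simp⟩
  obtain rfl : P = 2 * (c + 1) := by
    have : ¬ P < 2 * (c + 1) := by simpa [hP, hW] using hb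
    omega
  subst hR
  refine ⟨_, τ, .seq e₀ e, ?_, hE, hRW, hDR, hbest⟩
  have h6 : Expr.cost (lt (.reg rP) (.reg rW) : Expr 16 21) = 3 := rfl
  rw [h6] at ht
  omega

/-- Prepare the selection. -/
def selectInit : Prog := .store aSel (.reg rE) (.reg rR) ;; .set rI (.reg rT)

/-- Make the choices for the children of the node `rI - 1`. -/
def selectStep : Prog :=
  .set rI (.reg rI - 1) ;;
  .set rB (.reg rI * .reg rW + .cell aSel (.reg rI)) ;;
  .store aSel (.cell aLc (.reg rI)) (.cell aX (.reg rB)) ;;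
  .store aSel (.cell aRc (.reg rI)) (.cell aY (.reg rB))

/-- Make the choices for all nodes. -/
def select : Prog := selectInit ;; .loop (lt (.reg rN) (.reg rI)) selectStep

theorem exec_select {M : Config} {n m c : ℕ} {sz us vs : ℕ → ℕ} (hM : Setting M n m c sz us vs)
    {σ : Mem} {root cnt : ℕ} (hin : σ.reg rN = n) (hW : σ.reg rW = 2 * (c + 1))
    (hE : σ.reg rE = root) (hR : σ.reg rR < 2 * (c + 1)) (hr : root < cnt) (hT : σ.reg rT = cnt)
    (hcnt : n ≤ cnt) (hcnt' : cnt < 2 * n) (hsel : ∀ x, σ.arr aSel x = 0) {π lc rc X Y : ℕ → ℕ}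
    (hlc : σ.arr aLc = lc) (hrc : σ.arr aRc = rc) (hX : σ.arr aX = X) (hY : σ.arr aY = Y)
    (hX' : ∀ x, X x < 2 * (c + 1)) (hY' : ∀ x, Y x < 2 * (c + 1)) (hπr : π root < n)
    (hπ : ∀ j, n ≤ j → j < cnt →
      lc j < j ∧ rc j < j ∧ π (lc j) = n + 2 * j ∧ π (rc j) = n + 2 * j + 1) :
    ∃ t τ, Exec M select σ t τ ∧
      t ≤ selectInit.bound + n * roundCost (lt (.reg rN) (.reg rI)) selectStep + 4 ∧
      Chosen n cnt n (2 * (c + 1)) lc rc (row (2 * (c + 1)) X) (row (2 * (c + 1)) Y) root (σ.reg rR)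
        (τ.arr aSel) := by
  have hl := hM.le_len
  have hw := hM.len_lt
  have hlen : M.len = 2 * n * (2 * (c + 1)) := by rw [hM.len]; ring
  have w1 : 1 < M.word := by omega
  obtain ⟨t₀, e₀, b₀⟩ := Cmd.exec_run (M := M) (p := selectInit) (σ := σ) (by
    simp [selectInit, hE]
    omega)
  obtain ⟨best, hbest⟩ : ∃ best, σ.reg rR = best := ⟨_, rfl⟩
  rw [hbest] at hR ⊢
  obtain ⟨t, τ, φ, e, ⟨i, -, hi, ⟨hle, -⟩, hin, -, -, -, -, -, H⟩, hb, ht⟩ :=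
    exec_loop_run (M := M) (b := lt (.reg rN) (.reg rI)) (p := selectStep)
    -- The nodes are visited in decreasing order. As parents have larger numbers than their
    -- children, this is a traversal from the root to the leaves.
    (fun φ σ => ∃ i, φ = i - n ∧ σ.reg rI = i ∧ (n ≤ i ∧ i ≤ cnt) ∧ σ.reg rN = n ∧
      σ.reg rW = 2 * (c + 1) ∧ σ.arr aLc = lc ∧ σ.arr aRc = rc ∧ σ.arr aX = X ∧ σ.arr aY = Y ∧
      Chosen n cnt i (2 * (c + 1)) lc rc (row (2 * (c + 1)) X) (row (2 * (c + 1)) Y) root best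
        (σ.arr aSel))
    (by
      rintro φ σ ⟨i, -⟩
      simp [w1])
    (by
      rintro φ σ ⟨i, rfl, hi, ⟨hle, hle'⟩, hin, hW, hlc, hrc, hX, hY, H⟩ hv
      have hlt : n < i := by simpa [hi, hin] using hv
      obtain ⟨j, rfl⟩ : ∃ j, i = j + 1 := ⟨i - 1, by omega⟩
      have H' := H.step (by omega) (by omega) (fun p _ => hX' _) (fun p _ => hY' _) hπr hπ
      obtain ⟨a1, a2, -⟩ := hπ j (by omega) (by omega)
      have q1 := add_lt_mul (i := j) (j := 2 * n) (by omega) (H.lt j)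
      rw [← hlen] at q1
      have ok : selectStep.Ok M σ := by
        simp [selectStep, hi, hW, hlc, hrc, w1]
        omega
      obtain ⟨t', ex, -⟩ := Cmd.exec_run ok
      refine ⟨ok, j - n, by omega, j, rfl, by simp [selectStep, hi], ⟨by omega, by omega⟩,
        by rw [ex.reg_eq (by rfl), hin], by rw [ex.reg_eq (by rfl), hW],
        by rw [ex.arr_eq (by rfl), hlc], by rw [ex.arr_eq (by rfl), hrc],
        by rw [ex.arr_eq (by rfl), hX], by rw [ex.arr_eq (by rfl), hY], ?_⟩
      simpa [selectStep, hi, hW, hlc, hrc, hX, hY, row] using H')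
    (cnt - n) (selectInit.run M σ) ⟨cnt, rfl, by simpa [selectInit] using hT, ⟨hcnt, le_rfl⟩,
      by simpa [selectInit] using hin, by simpa [selectInit] using hW,
      by simpa [selectInit] using hlc, by simpa [selectInit] using hrc,
      by simpa [selectInit] using hX, by simpa [selectInit] using hY,
      ⟨fun j => by
        simp only [selectInit, run_seq, run_store, run_set, val_reg, State.setReg_arr,
          State.setCell_arr, if_true, Function.update_apply, hsel]
        split_ifs <;> omega, by simp [selectInit, hE, hbest], fun j _ _ => by omega⟩⟩
  obtain rfl : i = n := by
    have : ¬ n < i := by simpa [hi, hin] using hb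
    omega
  refine ⟨_, τ, .seq e₀ e, ?_, H⟩
  have h6 : Expr.cost (lt (.reg rN) (.reg rI) : Expr 16 21) = 3 := rfl
  rw [h6] at ht
  have : (cnt - i) * roundCost (lt (.reg rN) (.reg rI) : Expr 16 21) selectStep ≤
      i * roundCost (lt (.reg rN) (.reg rI) : Expr 16 21) selectStep :=
    Nat.mul_le_mul_right _ (by omega)
  omega

end WordRAM

/-! ### The complete program -/

namespace WordRAM

open WordRAM.Expr WordRAM.Cmd

/-- The program that solves SSGW on minimal series-parallel digraphs. It represents the digraph by a
multigraph whose edges are the items, reduces this multigraph to one edge by series and parallel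
reductions, which yields a decomposition tree, and runs a dynamic program over the tree. An entry
`p < 2 * (c + 1)` of a row encodes the total size of a set of items of the subtree and whether the
set contains all sinks of the subtree. -/
def solve : Prog :=
  readArcs ;; addEdges ;; topoSort ;; reduceAll ;; leafRows ;; nodeRows ;; pick ;; select

/-- The constant factor in the bound for the running time of the program. -/
def timeFactor : ℕ :=
  readHeader.bound + roundCost (lt (.reg rI) (.reg rM)) readArc +
  roundCost (lt (.reg rI) (.reg rN)) addEdge +
  topoInit.bound + 4 * roundCost topoCond topoStep +
  reduceInit.bound + 3 * roundCost (.reg rE + .reg rF) reduceStep +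
  3 * (enterNode.bound + leaveNode.bound + 8) +
  leafInit.bound + roundCost (lt (.reg rI) (.reg rN)) leafRow +
  nodeInit.bound + 14 + 16 * roundCost (lt (.reg rP) (.reg rW)) pairStep +
  pickInit.bound + 4 * roundCost (lt (.reg rP) (.reg rW)) pickStep +
  selectInit.bound + roundCost (lt (.reg rN) (.reg rI)) selectStep + 36

/-- A bound for the running time of the program. -/
def timeBound (n m c : ℕ) : ℕ :=
  (readHeader.bound + m * roundCost (lt (.reg rI) (.reg rM)) readArc + 4) +
  (n * roundCost (lt (.reg rI) (.reg rN)) addEdge + 6) +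
  (topoInit.bound + (2 * n + 2) * roundCost topoCond topoStep + 6) +
  (reduceInit.bound + 3 * n * roundCost (.reg rE + .reg rF) reduceStep +
    (n + 2) * (enterNode.bound + leaveNode.bound + 8) + 4) +
  (leafInit.bound + n * roundCost (lt (.reg rI) (.reg rN)) leafRow + 4) +
  (n * (nodeInit.bound + 14 +
    2 * (c + 1) * (2 * (c + 1)) * roundCost (lt (.reg rP) (.reg rW)) pairStep) + 4) +
  (pickInit.bound + 2 * (c + 1) * roundCost (lt (.reg rP) (.reg rW)) pickStep + 4) +
  (selectInit.bound + n * roundCost (lt (.reg rN) (.reg rI)) selectStep + 4)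

/-- With the costs of the pieces of code replaced by variables, only arithmetic is left: n, m and 1
are at most n c⁴ + m, and the number of rounds of every loop is at most a fixed multiple of it. The
36 collects the additive constants of the eight phases. -/
theorem sum_of_phases_le {n m c : ℕ} (hn : 0 < n) (hc : 0 < c)
    (a1 a2 a3 a4 a5 a6 a7 a8 a9 a10 a11 a12 a13 a14 a15 a16 : ℕ) :
    (a1 + m * a2 + 4) + (n * a3 + 6) + (a4 + (2 * n + 2) * a5 + 6) +
      (a6 + 3 * n * a7 + (n + 2) * a8 + 4) + (a9 + n * a10 + 4) +
      (n * (a11 + 14 + 2 * (c + 1) * (2 * (c + 1)) * a12) + 4) + (a13 + 2 * (c + 1) * a14 + 4) +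
      (a15 + n * a16 + 4) ≤
    (a1 + a2 + a3 + a4 + 4 * a5 + a6 + 3 * a7 + 3 * a8 + a9 + a10 + a11 + 14 + 16 * a12 + a13 +
      4 * a14 + a15 + a16 + 36) * (n * c ^ 4 + m) := by
  obtain ⟨Q, hQ⟩ : ∃ Q, Q = n * c ^ 4 + m := ⟨_, rfl⟩
  have c4 : 1 ≤ c ^ 4 := Nat.one_le_pow _ _ hc
  have h1 : n ≤ Q := by nlinarith
  have h2 : c ≤ Q := by
    have : c ≤ c ^ 4 := Nat.le_self_pow (by norm_num) c
    nlinarith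
  have h3 : n * (2 * (c + 1) * (2 * (c + 1))) ≤ 16 * Q := by
    have h4 : c ^ 2 ≤ c ^ 4 := Nat.pow_le_pow_right hc (by norm_num)
    -- From c ≥ 1 follows c + 1 ≤ 2c, so 4(c + 1)² ≤ 16c² ≤ 16c⁴.
    have h5 : 2 * (c + 1) * (2 * (c + 1)) ≤ 16 * c ^ 4 := by nlinarith
    have := Nat.mul_le_mul_left n h5
    nlinarith
  have h4 : 1 ≤ Q := by omega
  have h5 : m ≤ Q := by rw [hQ]; exact Nat.le_add_left _ _
  have up : ∀ {x y : ℕ} (k : ℕ), x ≤ y → x * k ≤ y * k := fun k h => Nat.mul_le_mul_right k h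
  have one : ∀ k : ℕ, k ≤ Q * k := fun k => by simpa using up k h4
  rw [← hQ]
  linarith [up a2 h5, up a3 h1, up a5 (show 2 * n + 2 ≤ 4 * Q by omega),
    up a7 (show 3 * n ≤ 3 * Q by omega), up a8 (show n + 2 ≤ 3 * Q by omega), up a10 h1, up a11 h1,
    up a12 h3, up a14 (show 2 * (c + 1) ≤ 4 * Q by omega), up a16 h1, one a1, one a4, one a6, one a9,
    one a13, one a15]

theorem timeBound_le {n m c : ℕ} (hn : 0 < n) (hc : 0 < c) :
    timeBound n m c ≤ timeFactor * (n * c ^ 4 + m) :=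
  sum_of_phases_le hn hc _ _ _ _ _ _ _ _ _ _ _ _ _ _ _ _

/-- The phases fit together by the frame rules: a phase neither destroys what an earlier one has
computed for a later one, nor touches the arrays that a later one expects to be 0. The table belongs
to a tree `R` that is only equivalent to `T`, which is enough because equivalence preserves leaves
and arcs. -/
theorem exec_solve {M : Config} {n m c : ℕ} {sz us vs : ℕ → ℕ} (hM : Setting M n m c sz us vs)
    {T : SPTree} (hT : T.Nodup) (hm : ∀ v, T.Mem v ↔ v < n)
    (ha : ∀ x y, T.Arc x y ↔ ∃ j < m, us j = x ∧ vs j = y) :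
    ∃ t τ, Exec M solve (State.zero 16 21) t τ ∧ t ≤ timeBound n m c ∧
      ∃ (R : SPTree) (root cnt : ℕ) (typ lc rc tot : ℕ → ℕ) (D X Y : ℕ → ℕ → ℕ),
        SPTree.Equiv R T ∧ IsTable n cnt c sz typ lc rc tot D X Y ∧ Decodes n cnt typ lc rc root R ∧
        (∀ i, n ≤ i → i < cnt → τ.arr aSel (lc i) = X i (τ.arr aSel i) ∧
          τ.arr aSel (rc i) = Y i (τ.arr aSel i)) ∧
        τ.arr aSel root < 2 * (c + 1) ∧ D root (τ.arr aSel root) ≠ 0 ∧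
        ∀ p < 2 * (c + 1), D root p ≠ 0 → amount c p ≤ amount c (τ.arr aSel root) := by
  obtain ⟨t₁, σ₁, e₁, b₁, hN₁, -, hC₁, hA⟩ :=
    exec_readArcs hM (σ := State.zero 16 21) rfl rfl
  have hhd : ∀ j, σ₁.arr aHd j ≤ n := by
    intro j
    by_cases h : σ₁.arr aHd j = 0
    · omega
    · obtain ⟨i, hi, -, h1⟩ := hA.hd_pos j h
      have := hM.snd_lt i hi
      omega
  have hpr : ∀ j, σ₁.arr aPr j ≤ n := by
    intro j
    by_cases h : σ₁.arr aPr j = 0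
    · omega
    · obtain ⟨i, hi, -, h1⟩ := hA.pr_pos j h
      have := hM.fst_lt i hi
      omega
  have hE := hA.encodes hT hm ha
  -- Reading the arcs writes only to the arrays `aHd` and `aPr`, so the other arrays are still 0.
  have z : ∀ a : Fin 21, 4 ≤ a → σ₁.arr a = fun _ => 0 := by
    intro a ha
    have : readArcs.writes a = false := by revert a; decide
    exact e₁.arr_eq this
  obtain ⟨t₂, σ₂, e₂, b₂, hAd⟩ := exec_addEdges hM hN₁ rfl rfl hhd hpr z
  have hN₂ : σ₂.reg rN = n := by rw [e₂.reg_eq (by rfl), hN₁]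
  obtain ⟨t₃, σ₃, e₃, b₃, hto, hq⟩ := exec_topoSort hM hN₂ hE hm hhd hAd
  have hN₃ : σ₃.reg rN = n := by rw [e₃.reg_eq (by rfl), hN₂]
  obtain ⟨t₄, σ₄, e₄, b₄, R, hR, hdec, hroot, hin, hcnt, hcnt', π, hπr, hπ⟩ :=
    exec_reduceAll hM hN₃ hE hm hhd hto hq
      (by rw [e₃.arr_eq (by rfl)]; exact hAd.tl_eq) (by rw [e₃.arr_eq (by rfl)]; exact hAd.lab_eq)
      (by rw [e₃.arr_eq (by rfl), e₃.arr_eq (by rfl)]; exact hAd.heads)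
      (by rw [e₃.arr_eq (by rfl)]; exact hAd.outdeg_eq)
      (by rw [e₃.arr_eq (by rfl), e₂.arr_eq (by rfl)]; exact z _ (by decide))
  have e₁₄ := e₁.seq (e₂.seq (e₃.seq e₄))
  obtain ⟨t₅, σ₅, e₅, b₅, hI₅, hW₅, h0, hT₅⟩ := exec_leafRows hM (σ := σ₄)
    (typ := σ₄.arr aTy) (lc := σ₄.arr aLc) (rc := σ₄.arr aRc) (X := row (2 * (c + 1)) (σ₄.arr aX))
    (Y := row (2 * (c + 1)) (σ₄.arr aY))
    (by rw [e₄.reg_eq (by rfl), hN₃])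
    (by rw [e₄.reg_eq (by rfl), e₃.reg_eq (by rfl), e₂.reg_eq (by rfl), hC₁])
    (e₁₄.arr_eq (by rfl))
  have hC₅ : σ₅.reg rC = c := by
    rw [e₅.reg_eq (by rfl), e₄.reg_eq (by rfl), e₃.reg_eq (by rfl), e₂.reg_eq (by rfl), hC₁]
  have hX₄ : σ₄.arr aX = fun _ => 0 := e₁₄.arr_eq (by rfl)
  have hY₄ : σ₄.arr aY = fun _ => 0 := e₁₄.arr_eq (by rfl)
  have hS₄ : σ₄.arr aSel = fun _ => 0 := e₁₄.arr_eq (by rfl)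
  obtain ⟨t₆, σ₆, e₆, b₆, hX₆, hY₆, hT₆⟩ := exec_nodeRows hM (σ := σ₅) (cnt := σ₄.reg rT)
    (typ := σ₄.arr aTy) (lc := σ₄.arr aLc) (rc := σ₄.arr aRc) hI₅ hC₅ hW₅
    (e₅.reg_eq (by rfl)) hcnt hcnt' (e₅.arr_eq (by rfl)) (e₅.arr_eq (by rfl)) (e₅.arr_eq (by rfl))
    (fun j h1 h2 => ⟨(hπ j h1 h2).1, (hπ j h1 h2).2.1⟩) h0
    (fun x => by rw [e₅.arr_eq (by rfl), hX₄]; exact Nat.succ_pos _)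
    (fun x => by rw [e₅.arr_eq (by rfl), hY₄]; exact Nat.succ_pos _)
    (by rw [e₅.arr_eq (a := aX) (by rfl), e₅.arr_eq (a := aY) (by rfl)]; exact hT₅)
  have hlt : ∀ j, n ≤ j → j < σ₄.reg rT → σ₄.arr aLc j < j ∧ σ₄.arr aRc j < j :=
    fun j h1 h2 => ⟨(hπ j h1 h2).1, (hπ j h1 h2).2.1⟩
  have hW₆ : σ₆.reg rW = 2 * (c + 1) := by rw [e₆.reg_eq (by rfl), hW₅]
  have e₅₆ := e₅.seq e₆
  obtain ⟨t₇, σ₇, e₇, b₇, hE₇, hR₇, hD₇, hbest⟩ := exec_pick hM (σ := σ₆)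
    (root := σ₄.arr aLab (σ₄.arr aIn 0)) (by rw [e₆.reg_eq (by rfl), hC₅]) hW₆
    (by rw [e₅₆.arr_eq (by rfl), e₅₆.arr_eq (by rfl)]) (by rw [e₅₆.arr_eq (by rfl)]; exact hin)
    (by omega) (hT₆.entry_zero hlt hroot)
  have e₅₇ := e₅.seq (e₆.seq e₇)
  obtain ⟨t₈, σ₈, e₈, b₈, hch⟩ := exec_select hM (σ := σ₇) (root := σ₄.arr aLab (σ₄.arr aIn 0))
    (cnt := σ₄.reg rT) (π := π) (lc := σ₄.arr aLc) (rc := σ₄.arr aRc) (X := σ₆.arr aX)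
    (Y := σ₆.arr aY) (by rw [e₅₇.reg_eq (by rfl), e₄.reg_eq (by rfl), hN₃])
    (by rw [e₇.reg_eq (by rfl), hW₆]) hE₇ hR₇ hroot (e₅₇.reg_eq (by rfl)) hcnt hcnt'
    (fun x => by rw [e₅₇.arr_eq (by rfl), hS₄]) (e₅₇.arr_eq (by rfl)) (e₅₇.arr_eq (by rfl))
    (e₇.arr_eq (by rfl)) (e₇.arr_eq (by rfl)) hX₆ hY₆ hπr hπ
  refine ⟨_, σ₈, e₁.seq (e₂.seq (e₃.seq (e₄.seq (e₅.seq (e₆.seq (e₇.seq e₈)))))), ?_, R,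
    σ₄.arr aLab (σ₄.arr aIn 0), σ₄.reg rT, _, _, _, _, _, _, _, hR, hT₆, hdec, hch.child_eq, hch.lt _,
    ?_, ?_⟩
  · unfold timeBound
    omega
  · rw [hch.root_eq]; exact hD₇
  · rw [hch.root_eq]; exact hbest

end WordRAM

/-! ### The encoded input and the size of a word -/

namespace SSGWInstance

variable (I : SSGWInstance) (l : List (Fin I.n × Fin I.n))

theorem getD_flatMap_pair {α : Type*} (f g : α → ℕ) (l : List α) (j : ℕ) :
    (l.flatMap fun e => [f e, g e]).getD (2 * j) 0 = (l.map f).getD j 0 ∧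
      (l.flatMap fun e => [f e, g e]).getD (2 * j + 1) 0 = (l.map g).getD j 0 := by
  induction l generalizing j with
  | nil => simp
  | cons a l ih =>
    cases j with
    | zero => simp
    | succ j => simpa [Nat.mul_succ] using ih j

/-- The machine on which the program is run. -/
def config : WordRAM.Config where
  inp := I.encode l
  len := 4 * I.n * (I.c + 1)
  word := (I.n + I.c + I.total Finset.univ) ^ 5

theorem n_le_total : I.n ≤ I.total Finset.univ := by
  have := Finset.card_nsmul_le_sum Finset.univ I.size 1 fun j _ => I.size_pos j
  simpa [total] using this

/-- Put b = n + c + s(A). An arc list without repetitions has at most n² entries, so all numbers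
that occur are bounded by a quadratic polynomial in b. Since n, c and s(A) are positive, b ≥ 3,
hence 27b² ≤ b⁵, and the exponent 5 suffices. -/
theorem setting (hl : l.Nodup) :
    WordRAM.Setting (I.config l) I.n l.length I.c (fun j => (List.ofFn I.size).getD j 0)
      (fun j => (l.map fun e => (e.1 : ℕ)).getD j 0) fun j => (l.map fun e => (e.2 : ℕ)).getD j 0 := by
  have hn := I.n_pos
  have hc := I.c_pos
  have hS := I.n_le_total
  obtain ⟨b, hb⟩ : ∃ b, b = I.n + I.c + I.total Finset.univ := ⟨_, rfl⟩
  have hm : l.length ≤ I.n * I.n := by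
    simpa [List.toFinset_card_of_nodup hl] using Finset.card_le_univ l.toFinset
  have hb3 : 3 ≤ b := by omega
  have hw : 27 * b ^ 2 ≤ b ^ 5 := by
    have : 3 ^ 3 ≤ b ^ 3 := Nat.pow_le_pow_left hb3 3
    calc 27 * b ^ 2 ≤ b ^ 3 * b ^ 2 := Nat.mul_le_mul_right _ this
      _ = b ^ 5 := by ring
  have hbb : 9 ≤ b ^ 2 := by nlinarith
  constructor
  · rfl
  · rfl
  · rfl
  · intro j hj
    rw [add_comm 3 j]
    simp [config, encode, WordRAM.Config.read, List.getD_eq_getElem?_getD, List.getElem?_append, hj]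
  · intro j hj
    have := (getD_flatMap_pair (fun e : Fin I.n × Fin I.n => (e.1 : ℕ)) (fun e => (e.2 : ℕ)) l j).1
    simp only [config, encode, WordRAM.Config.read, List.append_assoc]
    rw [← this, List.getD_append_right, List.getD_append_right]
    · congr 1
      simp
      omega
    · simp
      omega
    · simp
      omega
  · intro j hj
    have := (getD_flatMap_pair (fun e : Fin I.n × Fin I.n => (e.1 : ℕ)) (fun e => (e.2 : ℕ)) l j).2
    simp only [config, encode, WordRAM.Config.read, List.append_assoc]
    rw [← this, List.getD_append_right, List.getD_append_right]
    · congr 1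
      simp
      omega
    · simp
      omega
    · simp
      omega
  · simp [config, encode]
    omega
  · rfl
  · change 4 * I.n * (I.c + 1) + 2 * l.length + I.n + 4 * I.c + 20 <
      (I.n + I.c + I.total Finset.univ) ^ 5
    rw [← hb]
    have h1 : I.n ≤ b := by omega
    have h2 : I.c ≤ b := by omega
    have h3 : I.n * I.c ≤ b * b := Nat.mul_le_mul h1 h2
    have h4 : I.n * I.n ≤ b * b := Nat.mul_le_mul h1 h1
    nlinarith
  · intro j hj
    change _ < (I.n + I.c + I.total Finset.univ) ^ 5
    rw [← hb, List.getD_eq_getElem _ _ (by simpa using hj)]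
    have h1 : I.size ⟨j, hj⟩ ≤ I.total Finset.univ :=
      Finset.single_le_sum (f := I.size) (fun _ _ => Nat.zero_le _) (Finset.mem_univ _)
    simp only [List.getElem_ofFn]
    nlinarith
  · exact hn
  · exact hc
  · intro j hj
    rw [List.getD_eq_getElem _ _ (by simpa using hj)]
    simp
  · intro j hj
    rw [List.getD_eq_getElem _ _ (by simpa using hj)]
    simp

end SSGWInstance

/-- One word RAM program finds an optimal solution for every SSGW instance on a minimal series-parallel
digraph, in time `O(n * c ^ 4 + m)` and work space `O(n * c ^ 2)`. All machine words are bounded by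
a fixed power of `n + c + s(A)`, that is, they have `O(log (n + c + s(A)))` bits. -/
theorem theorem4p8 :
    ∃ (r k C K : ℕ) (p : WordRAM.Cmd r (k + 1)),
      ∀ I : SSGWInstance, I.graph.IsMSP →
        ∀ l : List (Fin I.n × Fin I.n), I.IsArcList l →
          ∃ (len t : ℕ) (τ : WordRAM.State r (k + 1)),
            WordRAM.Exec
                { inp := I.encode l, len := len, word := (I.n + I.c + I.total Finset.univ) ^ K }
                p (WordRAM.State.zero r (k + 1)) t τ ∧
              I.n ≤ len ∧
              I.IsOptimal (τ.output I.n) ∧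
              t ≤ C * (I.n * I.c ^ 4 + I.m) ∧
              WordRAM.space r (k + 1) len ≤ C * (I.n * I.c ^ 2) := by
  -- The program uses 16 registers and 20 + 1 arrays of 4n(c + 1) cells. With n(c + 1) ≤ 2nc² the
  -- space is at most 16 + 21 · 8 · nc² ≤ 184nc².
  refine ⟨16, 20, WordRAM.timeFactor + 184, 5, WordRAM.solve, fun I hI l hl => ?_⟩
  have hM := I.setting l hl.1
  obtain ⟨T, hT, hm, hlt, ha⟩ := FinDigraph.IsMSP.exists_tree hI
  have hm' : ∀ v, T.Mem v ↔ v < I.n := by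
    refine fun v => ⟨hlt v, fun hv => ?_⟩
    exact (hm ⟨v, hv⟩).2 (by simp [I.verts_eq])
  have ha' : ∀ x y, T.Arc x y ↔ ∃ j < l.length, (l.map fun e => (e.1 : ℕ)).getD j 0 = x ∧
      (l.map fun e => (e.2 : ℕ)).getD j 0 = y := by
    intro x y
    constructor
    · intro h
      have hx := hlt x h.mem.1
      have hy := hlt y h.mem.2
      obtain ⟨j, hj, hjl⟩ := List.mem_iff_getElem.1 ((hl.2 _).2 ((ha ⟨x, hx⟩ ⟨y, hy⟩).1 h))
      exact ⟨j, hj, by simp [hj, hjl], by simp [hj, hjl]⟩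
    · rintro ⟨j, hj, rfl, rfl⟩
      have := (ha l[j].1 l[j].2).2 ((hl.2 _).1 (List.getElem_mem hj))
      simpa [hj] using this
  obtain ⟨t, τ, e, ht, R, root, cnt, typ, lc, rc, tot, D, X, Y, hR, htab, hdec, hsel, hp, hD, hbest⟩ :=
    WordRAM.exec_solve hM hT hm' ha'
  have hc := I.c_pos
  have hn := I.n_pos
  refine ⟨4 * I.n * (I.c + 1), t, τ, e, by nlinarith, ?_, ?_, ?_⟩
  · refine htab.isOptimal (hR.nodup.2 hT) (fun v => (hR.mem v).trans (hm' v))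
      (fun x y => (hR.arc x y).trans (ha x y)) (fun j => ?_) hdec hsel hp hD hbest
    simp
  · have h1 : l.length = I.m := by
      rw [SSGWInstance.m, ← List.toFinset_card_of_nodup hl.1]
      congr 1
      ext e
      rw [List.mem_toFinset, hl.2]
    have h2 := WordRAM.timeBound_le (m := l.length) hn hc
    rw [h1] at h2 ht
    refine (ht.trans h2).trans (Nat.mul_le_mul_right _ (by omega))
  · have h1 : I.c ≤ I.c ^ 2 := Nat.le_self_pow (by norm_num) _
    have h2 : I.n * (I.c + 1) ≤ 2 * (I.n * I.c ^ 2) := by nlinarith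
    have h3 : 1 ≤ I.n * I.c ^ 2 := by nlinarith
    have h4 : 184 * (I.n * I.c ^ 2) ≤ (WordRAM.timeFactor + 184) * (I.n * I.c ^ 2) :=
      Nat.mul_le_mul_right _ (by omega)
    unfold WordRAM.space
    nlinarith
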